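/- **Conventions.** Let $q>0$ be real, $[n]=q^{n-1}+q^{n-3}+\cdots+q^{-n+1}$, $[n]!=[1][2]\cdots[n]$ and ${n\brack k}=\frac{[n]!}{[k]!\,[n-k]!}$. For $n\ge 0$ let $V(n)$ be the complex vector space with basis $v^{-n},v^{-n+2},\dots,v^{n}$. For $s\in\{-1,1\}^n$ write $v^s=v^{s_1}\otimes\cdots\otimes v^{s_n}\in V(1)^{\otimes n}$, $|s|=\sum_i s_i$, $\|s\|_+=\#\{i<j: s_i>s_j\}$, $\|s\|_-=\#\{i<j: s_i<s_j\}$, and define $$T_n:V(1)^{\otimes n}\to V(n),\quad T_n(v^s)=q^{\|s\|_+}v^{|s|},\qquad T_n^*:V(n)\to V(1)^{\otimes n},\quad T_n^*(v^m)={n\brack \frac{n-m}{2}}^{-1}\sum_{|s|=m}q^{-\|s\|_-}v^s .$$ For $m+n=m'+n'$ put $U_{m,n}^{m',n'}=(T_{m'}\otimes T_{n'})(T_m^*\otimes T_n^*):V(m)\otimes V(n)\to V(m')\otimes V(n')$, where $V(1)^{\otimes m}\otimes V(1)^{\otimes n}=V(1)^{\otimes m'}\otimes V(1)^{\otimes n'}$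 keeping the order of the factors, and for $-m\le k\le n$ define the cascade operator $$K_{m,n}(k)=\big(U_{m,n}^{m+k,n-k}\big)^*U_{m,n}^{m+k,n-k}=U_{m+k,n-k}^{m,n}\,U_{m,n}^{m+k,n-k}\in\mathrm{End}(V(m)\otimes V(n)).$$ The cap is $\delta:V(0)\to V(1)\otimes V(1)$, $\delta(1)=v^{1}\otimes v^{-1}-q\,v^{-1}\otimes v^{1}$, and the cup is $\varepsilon:V(1)\otimes V(1)\to V(0)$ with $\varepsilon(v^{-1}\otimes v^1)=1$, $\varepsilon(v^1\otimes v^{-1})=-q^{-1}$, $\varepsilon(v^{\pm1}\otimes v^{\pm1})=0$. **Dual canonical basis.** Let $N=n_1+\cdots+n_L$. A cap diagram on $N$ points is a non-crossing partial pairing of $\{1,\dots,N\}$ by arcs such that no unpaired point lies under an arc. Given a cap diagram and an assignment of $v^{-1}$ or $v^{1}$ to each unpaired point, with all $v^{-1}$ to the left of all $v^{1}$, form the vector of $V(1)^{\otimes N}$ with a copy of $\delta(1)$ at each arc and the assigned vectors at the unpaired points. The dual canonical basis of $V(n_1)\otimes\cdots\otimes V(n_L)$ is the set of all non-zero images of such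 vectors under $T_{n_1}\otimes\cdots\otimes T_{n_L}$. **Proposition.** 1. For all $L\ge 0$ and $n_1,\dots,n_L\ge 0$, the dual canonical basis is a basis of $V(n_1)\otimes\cdots\otimes V(n_L)$, and for all $1\le i<L$ and $-n_i\le k\le n_{i+1}$ the operator $K_{n_i,n_{i+1}}(k)$, acting on the $i$-th and $(i+1)$-st tensor factors, has only non-negative real matrix entries in this basis. 2. For $j\le m$ and $j\le n$ let $$A_j=(T_m\otimes T_n)\,C_j\,(T_{m-j}^*\otimes T_{n-j}^*):V(m-j)\otimes V(n-j)\to V(m)\otimes V(n),$$ where $C_j$ inserts $j$ nested caps $\delta$ between the two groups of strands. For $j+\ell\le m$ and $j+\ell\le n$ let $$B_{j,\ell}=(T_m\otimes T_n)\,C_{j+\ell}\,D_\ell\,(T_{m-j}^*\otimes T_{n-j}^*):V(m-j)\otimes V(n-j)\to V(m)\otimes V(n),$$ where $D_\ell$ contracts, by $\ell$ nested cups $\varepsilon$, the last $\ell$ of the $m-j$ strands of the first group with the first $\ell$ of the $n-j$ strands of the second group. Then for all $j,k\ge 0$ with $j\le m$ and $j+k\le n$, $$K_{m,n}(k)\,A_j=\sum_{\ell=0}^{\min(k,\,m-j)}c_\ell\,B_{j,\ell},\qquad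 c_\ell=\frac{[m]!\,[k]!\,[n-j]!\,[n-k]!\,[m+k-j-\ell]!}{[n]!\,[\ell]!\,[m+k]!\,[k-\ell]!\,[n-j-k]!\,[m-j-\ell]!},$$ while $K_{m,n}(k)\,A_j=0$ if $j\le m$, $j\le n$, $0\le k\le n$ and $j+k>n$. -/

import Mathlib

open scoped TensorProduct

noncomputable section

/-! ### Quantum integers -/

/-- The quantum integer `[n] = q^(n-1) + q^(n-3) + ... + q^(-n+1)`. -/
def qInt {F : Type*} [Field F] (q : F) (n : ℕ) : F :=
  ∑ i ∈ Finset.range n, q ^ ((n : ℤ) - 1 - 2 * (i : ℤ))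

/-- The quantum factorial `[n]! = [1] [2] ... [n]`. -/
def qFact {F : Type*} [Field F] (q : F) (n : ℕ) : F :=
  ∏ i ∈ Finset.range n, qInt q (i + 1)

/-- The quantum binomial coefficient `[n]! / ([k]! [n-k]!)`, used for `k ≤ n`. -/
def qBinom {F : Type*} [Field F] (q : F) (n k : ℕ) : F :=
  qFact q n / (qFact q k * qFact q (n - k))

/-! ### Spin configurations and `q`-symmetrization

A configuration `s : Fin n → Bool` (`true` is the up arrow, spin `+1`; `false` is the down arrow,
spin `-1`) labels the standard basis vector `v^{s_1} ⊗ ... ⊗ v^{s_n}` of `V(1)^{⊗ n}`.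
The basis vector `v^m` of `V(n)`, `m = -n, -n+2, ..., n`, is labelled by the number
`c = (n + m) / 2 : Fin (n + 1)` of up arrows. The matrix of a linear map has in its column `b`
the coordinates of the image of the `b`-th basis vector, so that the product of matrices is the
composition of maps. -/

/-- The number of up arrows. -/
def numUp {n : ℕ} (s : Fin n → Bool) : ℕ :=
  (Finset.univ.filter fun i => s i = true).card

/-- `‖s‖₊ = #{i < j : s_i > s_j}`. -/
def normPlus {n : ℕ} (s : Fin n → Bool) : ℕ :=
  (Finset.univ.filter fun p : Fin n × Fin n => p.1 < p.2 ∧ s p.1 > s p.2).card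

/-- `‖s‖₋ = #{i < j : s_i < s_j}`. -/
def normMinus {n : ℕ} (s : Fin n → Bool) : ℕ :=
  (Finset.univ.filter fun p : Fin n × Fin n => p.1 < p.2 ∧ s p.1 < s p.2).card

/-- The `q`-symmetrization `T_n : V(1)^{⊗ n} → V(n)`, `v^s ↦ q^{‖s‖₊} v^{|s|}`. -/
def symT {F : Type*} [Field F] (q : F) (n : ℕ) : Matrix (Fin (n + 1)) (Fin n → Bool) F :=
  fun c s => if numUp s = c.val then q ^ normPlus s else 0

/-- The embedding `T_n^* : V(n) → V(1)^{⊗ n}`,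
`v^m ↦ [n choose (n-m)/2]⁻¹ ∑_{|s| = m} q^{-‖s‖₋} v^s`. -/
def symTStar {F : Type*} [Field F] (q : F) (n : ℕ) : Matrix (Fin n → Bool) (Fin (n + 1)) F :=
  fun s c => if numUp s = c.val then (qBinom q n (n - c.val))⁻¹ * q ^ (-(normMinus s : ℤ)) else 0

/-- `T_m ⊗ T_n`. -/
def symTPair {F : Type*} [Field F] (q : F) (m n : ℕ) :
    Matrix (Fin (m + 1) × Fin (n + 1)) ((Fin m → Bool) × (Fin n → Bool)) F :=
  Matrix.kroneckerMap (fun x y => x * y) (symT q m) (symT q n)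

/-- `T_m^* ⊗ T_n^*`. -/
def symTStarPair {F : Type*} [Field F] (q : F) (m n : ℕ) :
    Matrix ((Fin m → Bool) × (Fin n → Bool)) (Fin (m + 1) × Fin (n + 1)) F :=
  Matrix.kroneckerMap (fun x y => x * y) (symTStar q m) (symTStar q n)

/-! ### Cascade operators on two sites -/

/-- For `m + n = m' + n'`, the identification of `V(1)^{⊗ m} ⊗ V(1)^{⊗ n}` with
`V(1)^{⊗ m'} ⊗ V(1)^{⊗ n'}` that keeps the left-to-right order of the tensor factors. -/
def regroup (F : Type*) [Field F] (m n m' n' : ℕ) :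
    Matrix ((Fin m' → Bool) × (Fin n' → Bool)) ((Fin m → Bool) × (Fin n → Bool)) F :=
  fun s' s => if ∀ (x' : Fin (m' + n')) (x : Fin (m + n)), x'.val = x.val →
    Fin.append s'.1 s'.2 x' = Fin.append s.1 s.2 x then 1 else 0

/-- `U_{m,n}^{m',n'} = (T_{m'} ⊗ T_{n'}) (T_m^* ⊗ T_n^*) : V(m) ⊗ V(n) → V(m') ⊗ V(n')`,
used for `m + n = m' + n'`. -/
def cascadeU {F : Type*} [Field F] (q : F) (m n m' n' : ℕ) :
    Matrix (Fin (m' + 1) × Fin (n' + 1)) (Fin (m + 1) × Fin (n + 1)) F :=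
  symTPair q m' n' * regroup F m n m' n' * symTStarPair q m n

/-- The cascade operator `K_{m,n}(k) = (U_{m,n}^{m+k,n-k})^* U_{m,n}^{m+k,n-k}` on `V(m) ⊗ V(n)`,
for `-m ≤ k ≤ n`, where
`(U_{m,n}^{m+k,n-k})^* = (T_m ⊗ T_n) (T_{m+k}^* ⊗ T_{n-k}^*) = U_{m+k,n-k}^{m,n}`. -/
def cascadeK {F : Type*} [Field F] (q : F) (m n : ℕ) (k : ℤ) :
    Matrix (Fin (m + 1) × Fin (n + 1)) (Fin (m + 1) × Fin (n + 1)) F :=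
  cascadeU q ((m : ℤ) + k).toNat ((n : ℤ) - k).toNat m n *
    cascadeU q m n ((m : ℤ) + k).toNat ((n : ℤ) - k).toNat

/-! ### Caps and cups -/

/-- The coordinates of the cap
`δ(1) = v^1 ⊗ v^{-1} - q v^{-1} ⊗ v^1 ∈ V(1) ⊗ V(1)`. -/
def capDelta {F : Type*} [Field F] (q : F) : Bool → Bool → F
  | true, false => 1
  | false, true => -q
  | _, _ => 0

/-- The values on the standard basis of the cup `ε : V(1) ⊗ V(1) → V(0)`,
`ε(v^{-1} ⊗ v^1) = 1`, `ε(v^1 ⊗ v^{-1}) = -q⁻¹`, `ε(v^1 ⊗ v^1) = ε(v^{-1} ⊗ v^{-1}) = 0`. -/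
def cupEps {F : Type*} [Field F] (q : F) : Bool → Bool → F
  | true, false => -q⁻¹
  | false, true => 1
  | _, _ => 0

/-- For `m = m' + j` and `n = n' + j`, the map
`V(1)^{⊗ m'} ⊗ V(1)^{⊗ n'} → V(1)^{⊗ m} ⊗ V(1)^{⊗ n}` that inserts `j` nested caps in the middle:
they join the last `j` strands of the first block to the first `j` strands of the second one. -/
def nestedCaps {F : Type*} [Field F] (q : F) (m n m' n' j : ℕ) :
    Matrix ((Fin m → Bool) × (Fin n → Bool)) ((Fin m' → Bool) × (Fin n' → Bool)) F :=
  fun s s' =>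
    if (∀ (x : Fin m) (x' : Fin m'), x.val = x'.val → s.1 x = s'.1 x') ∧
        (∀ (y : Fin n) (y' : Fin n'), y.val = y'.val + j → s.2 y = s'.2 y') then
      ∏ x : Fin m, ∏ y : Fin n,
        if y.val < j ∧ x.val + y.val + 1 = m then capDelta q (s.1 x) (s.2 y) else 1
    else 0

/-- For `m = m' + j` and `n = n' + j`, the map
`V(1)^{⊗ m} ⊗ V(1)^{⊗ n} → V(1)^{⊗ m'} ⊗ V(1)^{⊗ n'}` that contracts by `j` nested cups the last
`j` strands of the first block with the first `j` strands of the second one. -/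
def nestedCups {F : Type*} [Field F] (q : F) (m n m' n' j : ℕ) :
    Matrix ((Fin m' → Bool) × (Fin n' → Bool)) ((Fin m → Bool) × (Fin n → Bool)) F :=
  fun s' s =>
    if (∀ (x : Fin m) (x' : Fin m'), x.val = x'.val → s.1 x = s'.1 x') ∧
        (∀ (y : Fin n) (y' : Fin n'), y.val = y'.val + j → s.2 y = s'.2 y') then
      ∏ x : Fin m, ∏ y : Fin n,
        if y.val < j ∧ x.val + y.val + 1 = m then cupEps q (s.1 x) (s.2 y) else 1
    else 0

/-- The map `V(m-j) ⊗ V(n-j) → V(m) ⊗ V(n)` whose diagram has boxes `m-j`, `n-j` on top, boxes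
`m`, `n` at the bottom, and `j` arcs joining the two bottom boxes; used for `j ≤ m`, `j ≤ n`. -/
def arcDiagram {F : Type*} [Field F] (q : F) (m n j : ℕ) :
    Matrix (Fin (m + 1) × Fin (n + 1)) (Fin (m - j + 1) × Fin (n - j + 1)) F :=
  symTPair q m n * nestedCaps q m n (m - j) (n - j) j * symTStarPair q (m - j) (n - j)

/-- The map `V(m-j) ⊗ V(n-j) → V(m) ⊗ V(n)` whose diagram has boxes `m-j`, `n-j` on top joined
by `l` down-turned arcs, boxes `m`, `n` at the bottom joined by `j + l` arcs, and `m-j-l`,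
respectively `n-j-l`, lines running from top to bottom; used for `j + l ≤ m`, `j + l ≤ n`. -/
def arcCupDiagram {F : Type*} [Field F] (q : F) (m n j l : ℕ) :
    Matrix (Fin (m + 1) × Fin (n + 1)) (Fin (m - j + 1) × Fin (n - j + 1)) F :=
  symTPair q m n * nestedCaps q m n (m - j - l) (n - j - l) (j + l) *
    nestedCups q (m - j) (n - j) (m - j - l) (n - j - l) l * symTStarPair q (m - j) (n - j)

/-- The coefficient `c_l` of the cascade expansion. -/
def cascadeCoeff {F : Type*} [Field F] (q : F) (m n k j l : ℕ) : F :=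
  (qFact q m * qFact q k * qFact q (n - j) * qFact q (n - k) * qFact q (m + k - j - l)) /
    (qFact q n * qFact q l * qFact q (m + k) * qFact q (k - l) * qFact q (n - j - k) *
      qFact q (m - j - l))

/-! ### The chain `V(n_1) ⊗ ... ⊗ V(n_L)` -/

/-- `V(n_1) ⊗ ... ⊗ V(n_L)`, where `V(n)` is the space of coordinate vectors
in the basis `v^{-n}, ..., v^n`. -/
abbrev Chain (F : Type*) [Field F] {L : ℕ} (n : Fin L → ℕ) : Type _ :=
  ⨂[F] i, (Fin (n i + 1) → F)

/-- The standard basis `v^{m_1} ⊗ ... ⊗ v^{m_L}`. -/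
def chainBasis (F : Type*) [Field F] {L : ℕ} (n : Fin L → ℕ) :
    Module.Basis (∀ i, Fin (n i + 1)) F (Chain F n) :=
  Basis.piTensorProduct fun i => Pi.basisFun F (Fin (n i + 1))

/-- The operator that acts as `A` on the tensor factors `i` and `i'`,
and as the identity on the other ones. -/
def twoSite {F : Type*} [Field F] {L : ℕ} (n : Fin L → ℕ) (i i' : Fin L)
    (A : Matrix (Fin (n i + 1) × Fin (n i' + 1)) (Fin (n i + 1) × Fin (n i' + 1)) F) :
    Chain F n →ₗ[F] Chain F n :=
  Matrix.toLin (chainBasis F n) (chainBasis F n) fun x' x =>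
    if ∀ l, l ≠ i → l ≠ i' → x' l = x l then A (x' i, x' i') (x i, x i') else 0

/-! ### The dual canonical basis -/

/-- A cap diagram on a finite linearly ordered set of strands: a non-crossing partial pairing
such that the unpaired strands (through lines) can be drawn upwards without crossing an arc.
`partner a` is the other leg of the arc at `a`, or `a` itself for a through line. -/
structure CapDiagram (S : Type*) [LinearOrder S] where
  partner : S → S
  involutive : ∀ a, partner (partner a) = a
  noncrossing : ∀ a b, ¬ (a < b ∧ b < partner a ∧ partner a < partner b)
  through : ∀ a b, partner b = b → ¬ (a < b ∧ b < partner a)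

/-- The coefficient of `v^s` in the image, under the cap diagram `D`, of the standard basis
vector in which the through line at `a` carries the arrow `t a` (the values of `t` on the legs of
arcs play no role). -/
def capCoeff {F : Type*} [Field F] (q : F) {S : Type*} [LinearOrder S] [Fintype S]
    (D : CapDiagram S) (t s : S → Bool) : F :=
  ∏ a, if a < D.partner a then capDelta q (s a) (s (D.partner a))
    else if D.partner a = a then (if s a = t a then 1 else 0)
    else 1

/-- The `n_1 + ... + n_L` strands, ordered from left to right: the `a`-th strand of site `i` is
`⟨i, a⟩`, and the order is lexicographic. -/
abbrev Strands {L : ℕ} (n : Fin L → ℕ) : Type := Σₗ i : Fin L, Fin (n i)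

/-- The image under `T_{n_1} ⊗ ... ⊗ T_{n_L}` of the vector of `V(1)^{⊗ (n_1 + ... + n_L)}` given
by the cap diagram `D` and the arrows `t` on its through lines. -/
def capVector {F : Type*} [Field F] (q : F) {L : ℕ} (n : Fin L → ℕ)
    (D : CapDiagram (Strands n)) (t : Strands n → Bool) : Chain F n :=
  ∑ s : Strands n → Bool, capCoeff q D t s •
    PiTensorProduct.tprod F fun i => fun c => symT q (n i) c fun a => s (toLex ⟨i, a⟩)

/-- The dual canonical basis of `V(n_1) ⊗ ... ⊗ V(n_L)`, as a set of vectors: the non-zero vectors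
given by a cap diagram whose through lines carry arrows, all down arrows (`false`) to the left of
all up arrows (`true`). -/
def dualCanonical {F : Type*} [Field F] (q : F) {L : ℕ} (n : Fin L → ℕ) : Set (Chain F n) :=
  {v | v ≠ 0 ∧ ∃ (D : CapDiagram (Strands n)) (t : Strands n → Bool),
    (∀ a b, D.partner a = a → D.partner b = b → a < b → t a ≤ t b) ∧ v = capVector q n D t}

end

/-!
# Cascade operators and the dual canonical basis

**Two sites.** A functional on `V(m) ⊗ V(n)` is a function `φ a b` of the numbers of up arrows at
the two sites, and every map in question is studied through its transpose, `φ ↦ φ M` (`IsRowAct`).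
Splitting off one strand at a time from `T^*` shows that `U` for `k` strands moved to the left or to
the right, `j` nested caps, and `l` nested cups act by iterates of four explicit `q`-difference
operators: `opE`, `opF`, `opA` and `opB`. These satisfy simple relations: caps commute with moved
strands (`opA_opE`, `opA_opF`, `opE_opB`), and a strand moved forth and back is a scalar plus a cap
after a cup (`opE_opF`). The expansion of `opE ^ k opF ^ k` follows by induction on `k`
(`iterE_iterF`), and the commutation of `opA` with `opE` and `opF` then gives the formula for
`K_{m,n}(k) A_j` (`cascadeK_mul_arcDiagram`). If `j + k > n`, there are too few strands left to move
(`iterE_eq_zero`).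

**Positivity.** Up to a factor `[n]`, moving one strand of a block of `n` strands into the
neighbouring block is `[n]` plus the sum over `1 < i ≤ n` of `[n + 1 - i]` times the diagram in
which the strands `i - 1` and `i` of the block are contracted and a cap is put at the first two
strands of the block (`clasp`; see `sum_mul_clasp` and its mirror image `sum_mul_claspRev`). All
these diagrams are products of cup-caps at neighbouring strands, and such a product is applied to
the vector of a cap diagram without arcs inside the block, since the symmetrizer of the block kills
the other ones. A cup-cap at neighbouring strands which are not joined by an arc maps the vector of
a cap diagram to zero or to the vector of another cap diagram (`cupCap_capCoeff`), and in the
products that occur the strands to be contracted are never joined. So the cone of non-negative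
combinations of vectors of cap diagrams is preserved when strands are moved (`exists_moveRight`,
`exists_moveLeft`), hence under the cascade operators (`exists_cascadeK`, `exists_twoSite_chainT`).

**The basis.** Up arrows at left legs and down arrows at right legs of arcs, together with the
arrows on the through lines, make up the word of a cap diagram. Every word comes from a diagram
(`CapDiagram.exists_word_eq`), whose vector it determines (`CapDiagram.capCoeff_eq_of_word_eq`). If
the image of this vector in the chain is not zero, then no arc joins neighbouring strands of a site,
and the word increases along every site (`exists_word_eq_siteWord`); so there are only as many such
vectors as the dimension. Exchanging the two arrows of an arc moves an up arrow to a later site, so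
these vectors are triangular with respect to the standard basis (`repr_capVector_of_ne`), and they
form a basis.
-/


/-! ### Quantum integers at integer arguments -/

section QuantumIntegers

variable {F : Type*} [Field F] {q : F}

/-- The quantum integer `[n]` for `n : ℤ`, with `[-n] = -[n]`. -/
def qz (q : F) : ℤ → F
  | Int.ofNat n => qInt q n
  | Int.negSucc n => -qInt q (n + 1)

@[simp] lemma qInt_zero : qInt q 0 = 0 := by simp [qInt]

@[simp] lemma qz_natCast (n : ℕ) : qz q (n : ℤ) = qInt q n := rfl

@[simp] lemma qz_zero : qz q 0 = 0 := qInt_zero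

lemma qInt_succ (hq : q ≠ 0) (n : ℕ) : qInt q (n + 1) = q ^ (n : ℤ) + q⁻¹ * qInt q n := by
  rw [qInt, Finset.sum_range_succ', add_comm, qInt, Finset.mul_sum]
  congr 1
  · congr 1; push_cast; ring
  · refine Finset.sum_congr rfl fun i _ => ?_
    rw [← zpow_neg_one, ← zpow_add₀ hq]
    congr 1; push_cast; ring

lemma qInt_succ' (hq : q ≠ 0) (n : ℕ) : qInt q (n + 1) = q * qInt q n + q ^ (-n : ℤ) := by
  rw [qInt, Finset.sum_range_succ, qInt, Finset.mul_sum]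
  congr 1
  · refine Finset.sum_congr rfl fun i _ => ?_
    nth_rewrite 2 [← zpow_one q]
    rw [← zpow_add₀ hq]
    congr 1; push_cast; ring
  · congr 1; push_cast; ring

lemma qz_add_one (hq : q ≠ 0) (n : ℤ) : qz q (n + 1) = q ^ n + q⁻¹ * qz q n := by
  obtain ⟨n, rfl | rfl⟩ := n.eq_nat_or_neg
  · exact_mod_cast qInt_succ hq n
  · cases n with
    | zero => simpa [show qz q 1 = qInt q 1 from rfl] using qInt_succ hq 0
    | succ n =>
      have h1 : qz q (-((n + 1 : ℕ) : ℤ)) = -qInt q (n + 1) := rfl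
      have h2 : qz q (-((n + 1 : ℕ) : ℤ) + 1) = -qInt q n := by
        cases n with
        | zero => simp
        | succ n =>
          have : (-((n + 1 + 1 : ℕ) : ℤ) + 1) = Int.negSucc n := by
            rw [Int.negSucc_eq]; push_cast; ring
          rw [this, qz]
      rw [h1, h2, qInt_succ' hq]
      have h3 : q ^ (-((n + 1 : ℕ) : ℤ)) = q⁻¹ * q ^ (-n : ℤ) := by
        rw [← zpow_neg_one, ← zpow_add₀ hq]; congr 1; push_cast; ring
      rw [h3]
      field_simp
      ring

lemma sub_inv_mul_qz (hq : q ≠ 0) (n : ℤ) : (q - q⁻¹) * qz q n = q ^ n - q ^ (-n) := by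
  induction n with
  | zero => simp
  | succ n ih =>
    rw [qz_add_one hq]
    have h1 : q ^ ((n : ℤ) + 1) = q * q ^ (n : ℤ) := by rw [zpow_add_one₀ hq, mul_comm]
    have h2 : q ^ (-((n : ℤ) + 1)) = q⁻¹ * q ^ (-n : ℤ) := by
      rw [← zpow_neg_one, ← zpow_add₀ hq]; congr 1; ring
    rw [h1, h2]
    linear_combination q⁻¹ * ih
  | pred n ih =>
    have h := qz_add_one hq (-(n : ℤ) - 1)
    rw [sub_add_cancel] at h
    have h1 : q ^ (-(n : ℤ)) = q * q ^ (-(n : ℤ) - 1) := by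
      nth_rewrite 2 [← zpow_one q]
      rw [← zpow_add₀ hq]; congr 1; ring
    have h2 : q ^ (- -(n : ℤ)) = q⁻¹ * q ^ (-(-(n : ℤ) - 1)) := by
      rw [← zpow_neg_one, ← zpow_add₀ hq]; congr 1; ring
    rw [h, h2, h1] at ih
    have h3 : q * q⁻¹ = 1 := mul_inv_cancel₀ hq
    linear_combination q * ih -
      ((q - q⁻¹) * qz q (-(n : ℤ) - 1) - q ^ (-(n : ℤ) - 1) + q ^ (-(-(n : ℤ) - 1))) * h3

lemma qz_add (hq : q ≠ 0) (a b : ℤ) : qz q (a + b) = q ^ b * qz q a + q ^ (-a) * qz q b := by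
  have step : ∀ b : ℤ, (qz q (a + (b + 1)) = q ^ (b + 1) * qz q a + q ^ (-a) * qz q (b + 1) ↔
      qz q (a + b) = q ^ b * qz q a + q ^ (-a) * qz q b) := by
    intro b
    rw [← add_assoc, qz_add_one hq, qz_add_one hq b, zpow_add₀ hq a, zpow_add_one₀ hq]
    have h := sub_inv_mul_qz hq a
    have h3 : q * q⁻¹ = 1 := mul_inv_cancel₀ hq
    constructor
    · intro e
      linear_combination q * e + q * q ^ b * h -
        (qz q (a + b) - q ^ b * qz q a - q ^ (-a) * qz q b) * h3
    · intro e
      linear_combination q⁻¹ * e - q ^ b * h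
  induction b with
  | zero => simp
  | succ n ih => exact (step n).2 ih
  | pred n ih => exact (step (-(n : ℤ) - 1)).1 (by rwa [sub_add_cancel])

lemma qz_add' (hq : q ≠ 0) (a b : ℤ) : qz q (a + b) = q ^ (-b) * qz q a + q ^ a * qz q b := by
  rw [add_comm a b, qz_add hq]; ring

/-- The identity behind the recursion of the coefficients of the cascade expansion. -/
lemma qz_add_mul_qz_add (hq : q ≠ 0) (u v l : ℤ) :
    qz q (u + l) * qz q (v + l) = qz q u * qz q v + qz q l * qz q (u + v + l) := by
  have h1 := qz_add hq u l
  have h2 := qz_add' hq v l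
  have h3 := qz_add' hq u (v + l)
  have h4 := qz_add hq u (v + l)
  rw [← add_assoc] at h3 h4
  have h5 : q ^ l * q ^ (-l) = 1 := by rw [← zpow_add₀ hq]; simp
  have h6 : q ^ (v + l) = q ^ v * q ^ l := zpow_add₀ hq _ _
  rw [h6] at h4
  linear_combination qz q (v + l) * h1 - qz q l * h4 + q ^ l * qz q u * h2 + qz q u * qz q v * h5

end QuantumIntegers

/-! ### Elementary operators on row functionals -/

section Operators

variable {F : Type*} [Field F] {q : F}

/-- The row action of the cap on functions `φ` of the numbers `a`, `b` of up arrows at two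
neighbouring sites; `n` is the size of the second site below the cap. -/
def opA (q : F) (n : ℤ) : (ℤ → ℤ → F) →ₗ[F] (ℤ → ℤ → F) where
  toFun φ a b := φ (a + 1) b - q ^ (n + a - b) * φ a (b + 1)
  map_add' φ ψ := by ext a b; simp only [Pi.add_apply]; ring
  map_smul' c φ := by ext a b; simp only [Pi.smul_apply, smul_eq_mul, RingHom.id_apply]; ring

/-- The row action of `[m] [n]` times the cup between sites of sizes `m` and `n`. -/
def opB (q : F) (m n : ℤ) : (ℤ → ℤ → F) →ₗ[F] (ℤ → ℤ → F) where
  toFun φ a b := qz q (m - a) * qz q b * φ a (b - 1) -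
    q ^ (a - m - b - 1) * qz q a * qz q (n - b) * φ (a - 1) b
  map_add' φ ψ := by ext a b; simp only [Pi.add_apply]; ring
  map_smul' c φ := by ext a b; simp only [Pi.smul_apply, smul_eq_mul, RingHom.id_apply]; ring

/-- The row action of `[n]` times the operator that moves one strand from the second site, of
size `n`, to the first one. -/
def opE (q : F) (n : ℤ) : (ℤ → ℤ → F) →ₗ[F] (ℤ → ℤ → F) where
  toFun φ a b := qz q b * φ (a + 1) (b - 1) + q ^ (a - b) * qz q (n - b) * φ a b
  map_add' φ ψ := by ext a b; simp only [Pi.add_apply]; ring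
  map_smul' c φ := by ext a b; simp only [Pi.smul_apply, smul_eq_mul, RingHom.id_apply]; ring

/-- The row action of `[m]` times the operator that moves one strand from the first site, of
size `m`, to the second one, of size `n`. -/
def opF (q : F) (m n : ℤ) : (ℤ → ℤ → F) →ₗ[F] (ℤ → ℤ → F) where
  toFun φ a b := qz q (m - a) * φ a b + q ^ (n - b - m + a) * qz q a * φ (a - 1) (b + 1)
  map_add' φ ψ := by ext a b; simp only [Pi.add_apply]; ring
  map_smul' c φ := by ext a b; simp only [Pi.smul_apply, smul_eq_mul, RingHom.id_apply]; ring

lemma opA_apply (n : ℤ) (φ : ℤ → ℤ → F) (a b : ℤ) :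
    opA q n φ a b = φ (a + 1) b - q ^ (n + a - b) * φ a (b + 1) := rfl

lemma opB_apply (m n : ℤ) (φ : ℤ → ℤ → F) (a b : ℤ) :
    opB q m n φ a b = qz q (m - a) * qz q b * φ a (b - 1) -
      q ^ (a - m - b - 1) * qz q a * qz q (n - b) * φ (a - 1) b := rfl

lemma opE_apply (n : ℤ) (φ : ℤ → ℤ → F) (a b : ℤ) :
    opE q n φ a b = qz q b * φ (a + 1) (b - 1) + q ^ (a - b) * qz q (n - b) * φ a b := rfl

lemma opF_apply (m n : ℤ) (φ : ℤ → ℤ → F) (a b : ℤ) :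
    opF q m n φ a b =
      qz q (m - a) * φ a b + q ^ (n - b - m + a) * qz q a * φ (a - 1) (b + 1) := rfl

lemma qz_add_one' (hq : q ≠ 0) (n : ℤ) : qz q (n + 1) = q * qz q n + q ^ (-n) := by
  rw [qz_add hq, show qz q 1 = 1 by simp [qz, qInt]]; simp

/-- A strand moved to the first site slides past a cap between the sites. -/
lemma opA_opE (hq : q ≠ 0) (n : ℤ) (φ : ℤ → ℤ → F) :
    opA q n (opE q n φ) = opE q (n - 1) (opA q (n - 1) φ) := by
  ext a b
  simp only [opA_apply, opE_apply, sub_add_cancel, add_sub_cancel_right]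
  have h1 : qz q (n - b) = q ^ (n - 1 - b) + q⁻¹ * qz q (n - 1 - b) := by
    rw [← qz_add_one hq]; congr 1; ring
  rw [show n - (b + 1) = n - 1 - b by ring, h1, qz_add_one' hq b]
  simp only [zpow_add₀ hq, zpow_sub₀ hq, zpow_neg, zpow_one]
  field_simp
  ring

/-- A strand moved to the second site slides past a cap between the sites. -/
lemma opA_opF (hq : q ≠ 0) (m n : ℤ) (φ : ℤ → ℤ → F) :
    opA q n (opF q m n φ) = opF q (m - 1) (n - 1) (opA q (n + 1) φ) := by
  ext a b
  simp only [opA_apply, opF_apply, sub_add_cancel, add_sub_cancel_right]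
  have h1 : qz q (m - a) = q * qz q (m - 1 - a) + q ^ (-(m - 1 - a)) := by
    rw [← qz_add_one' hq]; congr 1; ring
  rw [show m - (a + 1) = m - 1 - a by ring, h1, qz_add_one hq a]
  simp only [zpow_add₀ hq, zpow_sub₀ hq, zpow_neg, zpow_one]
  field_simp
  ring

/-- A strand moved to the first site slides past a cup between the sites. -/
lemma opE_opB (hq : q ≠ 0) (m n : ℤ) (φ : ℤ → ℤ → F) :
    opE q n (opB q (m + 1) (n - 1) φ) = opB q m n (opE q (n - 1) φ) := by
  ext a b
  simp only [opB_apply, opE_apply, sub_add_cancel, add_sub_cancel_right]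
  have h1 : qz q (m + 1 - a) = q * qz q (m - a) + q ^ (-(m - a)) := by
    rw [← qz_add_one' hq]; congr 1; ring
  rw [show m + 1 - (a + 1) = m - a by ring, show n - 1 - (b - 1) = n - b by ring, h1,
    qz_add_one hq a]
  simp only [zpow_add₀ hq, zpow_sub₀ hq, zpow_neg, zpow_one]
  field_simp
  ring

/-- A strand that is moved between the sites forth and back gives a scalar plus a cap after a
cup. -/
lemma opE_opF (hq : q ≠ 0) (m n : ℤ) (φ : ℤ → ℤ → F) :
    opE q n (opF q (m + 1) (n - 1) φ) = (qz q (m + 1) * qz q n) • φ + opB q m n (opA q n φ) := by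
  ext a b
  simp only [opB_apply, opE_apply, opF_apply, opA_apply, sub_add_cancel, add_sub_cancel_right,
    Pi.add_apply, Pi.smul_apply, smul_eq_mul]
  have h1 : qz q n = q ^ (-b) * qz q (n - b) + q ^ (n - b) * qz q b := by
    rw [← qz_add' hq, sub_add_cancel]
  have h2 : qz q (a + 1) = q ^ (m - a) * (qz q (m + 1) - q ^ (a + 1) * qz q (m - a)) := by
    have h := qz_add hq (m - a) (a + 1)
    rw [show m - a + (a + 1) = m + 1 by ring] at h
    rw [h, add_sub_cancel_left, ← mul_assoc, ← zpow_add₀ hq]; simp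
  have h3 : qz q (m + 1 - a) = q ^ (-a) * (qz q (m + 1) - q ^ (-(m + 1 - a)) * qz q a) := by
    have h := qz_add hq (m + 1 - a) a
    rw [show m + 1 - a + a = m + 1 by ring] at h
    rw [h, add_sub_cancel_right, ← mul_assoc, ← zpow_add₀ hq]; simp
  rw [show m + 1 - (a + 1) = m - a by ring, h1, h2, h3]
  simp only [zpow_add₀ hq, zpow_sub₀ hq, zpow_neg, zpow_one]
  field_simp
  ring

/-! ### Iterated operators -/

/-- The row action of `j` nested caps; `n` is the size of the second site below the caps. -/
def iterA (q : F) : ℕ → ℤ → (ℤ → ℤ → F) →ₗ[F] (ℤ → ℤ → F)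
  | 0, _ => LinearMap.id
  | j + 1, n => iterA q j (n - 1) ∘ₗ opA q n

/-- The row action of `l` nested cups, up to a scalar, between sites of sizes `m` and `n`. -/
def iterB (q : F) : ℕ → ℤ → ℤ → (ℤ → ℤ → F) →ₗ[F] (ℤ → ℤ → F)
  | 0, _, _ => LinearMap.id
  | l + 1, m, n => opB q m n ∘ₗ iterB q l (m - 1) (n - 1)

/-- The row action, up to a scalar, of the operator that moves `k` strands from the second site,
of size `n`, to the first one. -/
def iterE (q : F) : ℕ → ℤ → (ℤ → ℤ → F) →ₗ[F] (ℤ → ℤ → F)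
  | 0, _ => LinearMap.id
  | k + 1, n => opE q n ∘ₗ iterE q k (n - 1)

/-- The row action, up to a scalar, of the operator that moves `k` strands from the first site,
of size `m`, to the second one, of size `n`. -/
def iterF (q : F) : ℕ → ℤ → ℤ → (ℤ → ℤ → F) →ₗ[F] (ℤ → ℤ → F)
  | 0, _, _ => LinearMap.id
  | k + 1, m, n => opF q m n ∘ₗ iterF q k (m - 1) (n + 1)

lemma iterA_succ (j : ℕ) (n : ℤ) (φ : ℤ → ℤ → F) :
    iterA q (j + 1) n φ = iterA q j (n - 1) (opA q n φ) := rfl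

lemma iterB_succ (l : ℕ) (m n : ℤ) (φ : ℤ → ℤ → F) :
    iterB q (l + 1) m n φ = opB q m n (iterB q l (m - 1) (n - 1) φ) := rfl

lemma iterE_succ (k : ℕ) (n : ℤ) (φ : ℤ → ℤ → F) :
    iterE q (k + 1) n φ = opE q n (iterE q k (n - 1) φ) := rfl

lemma iterF_succ (k : ℕ) (m n : ℤ) (φ : ℤ → ℤ → F) :
    iterF q (k + 1) m n φ = opF q m n (iterF q k (m - 1) (n + 1) φ) := rfl

lemma iterA_succ' (j : ℕ) (n : ℤ) (φ : ℤ → ℤ → F) :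
    iterA q (j + 1) n φ = opA q (n - j) (iterA q j n φ) := by
  induction j generalizing n φ with
  | zero => simp [iterA]
  | succ j ih =>
    rw [iterA_succ, ih, iterA_succ]; congr 2; push_cast; ring

lemma iterB_succ' (l : ℕ) (m n : ℤ) (φ : ℤ → ℤ → F) :
    iterB q (l + 1) m n φ = iterB q l m n (opB q (m - l) (n - l) φ) := by
  induction l generalizing m n φ with
  | zero => simp [iterB]
  | succ l ih =>
    rw [iterB_succ, ih, iterB_succ]; congr 4 <;> (push_cast; ring)

lemma iterF_succ' (k : ℕ) (m n : ℤ) (φ : ℤ → ℤ → F) :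
    iterF q (k + 1) m n φ = iterF q k m n (opF q (m - k) (n + k) φ) := by
  induction k generalizing m n φ with
  | zero => simp [iterF]
  | succ k ih =>
    rw [iterF_succ, ih, iterF_succ]; congr 4 <;> (push_cast; ring)

lemma iterA_add (i j : ℕ) (n : ℤ) (φ : ℤ → ℤ → F) :
    iterA q (i + j) n φ = iterA q j (n - i) (iterA q i n φ) := by
  induction j with
  | zero => simp [iterA]
  | succ j ih =>
    rw [← add_assoc, iterA_succ', ih, iterA_succ']; congr 2; push_cast; ring

lemma opA_iterE (hq : q ≠ 0) (k : ℕ) (n : ℤ) (φ : ℤ → ℤ → F) :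
    opA q n (iterE q k n φ) = iterE q k (n - 1) (opA q (n - k) φ) := by
  induction k generalizing n φ with
  | zero => simp [iterE]
  | succ k ih =>
    rw [iterE_succ, opA_opE hq, ih, iterE_succ]; congr 4; push_cast; ring

lemma iterA_iterE (hq : q ≠ 0) (j k : ℕ) (n : ℤ) (φ : ℤ → ℤ → F) :
    iterA q j n (iterE q k n φ) = iterE q k (n - j) (iterA q j (n - k) φ) := by
  induction j generalizing n φ with
  | zero => simp [iterA]
  | succ j ih =>
    rw [iterA_succ, opA_iterE hq, ih, iterA_succ, show n - 1 - (k : ℤ) = n - k - 1 by ring]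
    congr 2; push_cast; ring

lemma iterA_opF (hq : q ≠ 0) (j : ℕ) (m n : ℤ) (φ : ℤ → ℤ → F) :
    iterA q j n (opF q m n φ) = opF q (m - j) (n - j) (iterA q j (n + 1) φ) := by
  induction j generalizing m n φ with
  | zero => simp [iterA]
  | succ j ih =>
    rw [iterA_succ, opA_opF hq, ih, iterA_succ, show n - 1 + 1 = n + 1 - 1 by ring]
    congr 2 <;> (push_cast; ring)

lemma iterA_iterF (hq : q ≠ 0) (j k : ℕ) (m n : ℤ) (φ : ℤ → ℤ → F) :
    iterA q j n (iterF q k m n φ) = iterF q k (m - j) (n - j) (iterA q j (n + k) φ) := by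
  induction k generalizing m n φ with
  | zero => simp [iterF]
  | succ k ih =>
    rw [iterF_succ, iterA_opF hq, ih, iterF_succ, show m - 1 - (j : ℤ) = m - j - 1 by ring,
      show n + 1 - (j : ℤ) = n - j + 1 by ring]
    congr 4; push_cast; ring

lemma opE_iterB (hq : q ≠ 0) (l : ℕ) (m n : ℤ) (φ : ℤ → ℤ → F) :
    opE q n (iterB q l (m + 1) (n - 1) φ) = iterB q l m n (opE q (n - l) φ) := by
  induction l generalizing m n φ with
  | zero => simp [iterB]
  | succ l ih =>
    rw [iterB_succ, opE_opB hq, show m + 1 - 1 = m - 1 + 1 by ring, ih, iterB_succ]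
    congr 4; push_cast; ring

/-- The coefficients of the expansion of `k` strands moved forth and back into caps and cups. -/
def braidCoeff (q : F) (m n k l : ℕ) : F :=
  qFact q k * qFact q (m + k - l) * qFact q (n + k - l) /
    (qFact q l * qFact q (k - l) * qFact q m * qFact q n)

lemma qFact_succ (n : ℕ) : qFact q (n + 1) = qFact q n * qInt q (n + 1) :=
  Finset.prod_range_succ _ _

lemma qFact_zero : qFact q 0 = 1 := rfl

lemma qFact_ne_zero (hn : ∀ n, qInt q (n + 1) ≠ 0) (n : ℕ) : qFact q n ≠ 0 :=
  Finset.prod_ne_zero_iff.2 fun i _ => hn i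

/-- One more strand moved forth and back around `l` cups and caps gives the same `l` cups and caps,
with a factor, plus `l + 1` cups and caps. -/
lemma opE_iterB_iterA_opF (hq : q ≠ 0) (l : ℕ) (m N : ℤ) (φ : ℤ → ℤ → F) :
    opE q N (iterB q l (m + 1) (N - 1) (iterA q l (N - 1) (opF q (m + 1) (N - 1) φ))) =
      (qz q (m + 1 - l) * qz q (N - l)) • iterB q l m N (iterA q l N φ) +
        iterB q (l + 1) m N (iterA q (l + 1) N φ) := by
  rw [iterA_opF hq, opE_iterB hq, sub_add_cancel, show m + 1 - (l : ℤ) = (m - l) + 1 by ring,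
    show N - 1 - (l : ℤ) = (N - l) - 1 by ring, opE_opF hq, map_add, map_smul, ← iterA_succ',
    ← iterB_succ']

lemma braidCoeff_zero_succ (hn : ∀ n, qInt q (n + 1) ≠ 0) (m n k : ℕ) :
    braidCoeff q m n (k + 1) 0 =
      braidCoeff q (m + 1) n k 0 * (qInt q (m + 1) * qInt q (n + k + 1)) := by
  have h0 := qFact_ne_zero hn
  have := h0 m; have := h0 n; have := h0 k; have := hn m; have := hn k
  simp only [braidCoeff, Nat.sub_zero, qFact_zero, ← add_assoc, qFact_succ, add_right_comm m 1 k]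
  field_simp

lemma braidCoeff_self (hn : ∀ n, qInt q (n + 1) ≠ 0) (m n k : ℕ) : braidCoeff q m n k k = 1 := by
  have h0 := qFact_ne_zero hn
  simp [braidCoeff, qFact_zero, div_self, h0]

lemma braidCoeff_succ_succ (hq : q ≠ 0) (hn : ∀ n, qInt q (n + 1) ≠ 0) (m n k l : ℕ)
    (hl : l < k) :
    braidCoeff q m n (k + 1) (l + 1) =
      braidCoeff q (m + 1) n k (l + 1) * (qz q (m - l) * qInt q (n + k - l)) +
        braidCoeff q (m + 1) n k l := by
  obtain ⟨r, rfl⟩ := Nat.exists_eq_add_of_le hl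
  have h0 := qFact_ne_zero hn
  have key := qz_add_mul_qz_add hq (r + 1 : ℕ) (m - l) (l + 1 : ℕ)
  rw [show ((r + 1 : ℕ) : ℤ) + (l + 1 : ℕ) = (l + r + 2 : ℕ) by push_cast; ring,
    show (m : ℤ) - l + (l + 1 : ℕ) = (m + 1 : ℕ) by push_cast; ring,
    show ((r + 1 : ℕ) : ℤ) + (m - l) + (l + 1 : ℕ) = (m + r + 2 : ℕ) by push_cast; ring] at key
  simp only [qz_natCast] at key
  have := h0 m; have := h0 n; have := h0 l; have := h0 r; have := hn l; have := hn r
  have := hn m; have := h0 (m + 1)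
  simp only [braidCoeff]
  rw [show m + (l.succ + r + 1) - (l + 1) = m + r + 1 by omega,
    show n + (l.succ + r + 1) - (l + 1) = n + r + 1 by omega,
    show l.succ + r + 1 - (l + 1) = r + 1 by omega,
    show m + 1 + (l.succ + r) - (l + 1) = m + r + 1 by omega,
    show n + (l.succ + r) - (l + 1) = n + r by omega,
    show l.succ + r - (l + 1) = r by omega,
    show n + (l.succ + r) - l = n + r + 1 by omega,
    show m + 1 + (l.succ + r) - l = m + r + 1 + 1 by omega,
    show l.succ + r - l = r + 1 by omega,
    show l.succ + r + 1 = l + r + 1 + 1 by omega, show l.succ + r = l + r + 1 by omega]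
  simp only [qFact_succ]
  field_simp
  linear_combination (qFact q (l + r) * qInt q (l + r + 1) * qFact q (m + r) *
    qInt q (m + r + 1) * qFact q (n + r) * qInt q (n + r + 1)) * key

/-- Moving `k` strands to the first site and back is a combination of caps after cups. -/
lemma iterE_iterF (hq : q ≠ 0) (hn : ∀ n, qInt q (n + 1) ≠ 0) (m n k : ℕ) (φ : ℤ → ℤ → F) :
    iterE q k (n + k) (iterF q k (m + k) n φ) =
      ∑ l ∈ Finset.range (k + 1),
        braidCoeff q m n k l • iterB q l m (n + k) (iterA q l (n + k) φ) := by
  have h0 := qFact_ne_zero hn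
  induction k generalizing m φ with
  | zero =>
    simp [iterE, iterF, iterA, iterB, braidCoeff, qFact_zero, h0]
  | succ k ih =>
    have hm : ((m : ℤ) + (k + 1 : ℕ)) = ((m + 1 : ℕ) : ℤ) + k := by push_cast; ring
    have hnk : (n : ℤ) + k = n + (k + 1 : ℕ) - 1 := by push_cast; ring
    rw [iterE_succ, ← hnk, hm, iterF_succ',
      show ((m + 1 : ℕ) : ℤ) + k - k = m + 1 by push_cast; ring, ih, map_sum, hnk]
    simp only [map_smul]
    rw [Finset.sum_congr rfl fun l _ => by
      rw [Nat.cast_add m 1, Nat.cast_one, opE_iterB_iterA_opF hq l m (n + (k + 1 : ℕ)) φ]]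
    simp only [smul_add, Finset.sum_add_distrib, smul_smul]
    rw [Finset.sum_range_succ', Finset.sum_range_succ _ k, Finset.sum_range_succ _ (k + 1),
      Finset.sum_range_succ' _ k, braidCoeff_zero_succ hn, braidCoeff_self hn, braidCoeff_self hn]
    have : ∀ l ∈ Finset.range k, braidCoeff q m n (k + 1) (l + 1) •
        iterB q (l + 1) m (n + (k + 1 : ℕ)) (iterA q (l + 1) (n + (k + 1 : ℕ)) φ) =
        (braidCoeff q (m + 1) n k (l + 1) *
          (qz q ((m : ℤ) + 1 - (l + 1 : ℕ)) * qz q (n + (k + 1 : ℕ) - (l + 1 : ℕ)))) •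
            iterB q (l + 1) m (n + (k + 1 : ℕ)) (iterA q (l + 1) (n + (k + 1 : ℕ)) φ) +
        braidCoeff q (m + 1) n k l •
          iterB q (l + 1) m (n + (k + 1 : ℕ)) (iterA q (l + 1) (n + (k + 1 : ℕ)) φ) := by
      intro l hl
      rw [Finset.mem_range] at hl
      rw [← add_smul, braidCoeff_succ_succ hq hn m n k l hl, ← qz_natCast (n + k - l)]
      congr 5
      · push_cast; ring
      · push_cast [hl.le.trans (Nat.le_add_left k n)]; ring
    rw [Finset.sum_congr rfl this, Finset.sum_add_distrib, ← qz_natCast (m + 1),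
      ← qz_natCast (n + k + 1)]
    push_cast
    simp only [sub_zero, add_assoc]
    abel

/-- More cups than the first site has strands give zero: after some steps, the coefficients
`[m - a]` or `[a]` in `opB` vanish. -/
lemma iterB_eq_zero (l m : ℕ) (n : ℤ) (φ : ℤ → ℤ → F) (h : m < l) (a b : ℤ) (ha : 0 ≤ a)
    (ha' : a ≤ m) : iterB q l m n φ a b = 0 := by
  induction l generalizing m n a b with
  | zero => omega
  | succ l ih =>
    rw [iterB_succ, opB_apply]
    cases m with
    | zero => obtain rfl : a = 0 := by simp at ha'; omega
              simp
    | succ m =>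
      rw [show ((m + 1 : ℕ) : ℤ) - 1 = m by push_cast; ring]
      have h1 : qz q ((m + 1 : ℕ) - a) * iterB q l m (n - 1) φ a (b - 1) = 0 := by
        rcases eq_or_ne a (m + 1 : ℕ) with rfl | h'
        · simp
        · rw [ih m _ (by omega) _ _ ha (by push_cast at ha' h'; omega), mul_zero]
      have h2 : qz q a * iterB q l m (n - 1) φ (a - 1) b = 0 := by
        rcases eq_or_ne a 0 with rfl | h'
        · simp
        · rw [ih m _ (by omega) _ _ (by omega) (by push_cast at ha'; omega), mul_zero]
      linear_combination qz q b * h1 - q ^ (a - (m + 1 : ℕ) - b - 1) * qz q (n - b) * h2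

/-- More strands than the second site has cannot be moved. -/
lemma iterE_eq_zero (k n : ℕ) (φ : ℤ → ℤ → F) (h : n < k) (a b : ℤ) (hb : 0 ≤ b) (hb' : b ≤ n) :
    iterE q k n φ a b = 0 := by
  induction k generalizing n a b with
  | zero => omega
  | succ k ih =>
    rw [iterE_succ, opE_apply]
    cases n with
    | zero => obtain rfl : b = 0 := by simp at hb'; omega
              simp
    | succ n =>
      rw [show ((n + 1 : ℕ) : ℤ) - 1 = n by push_cast; ring]
      have h1 : qz q ((n + 1 : ℕ) - b) * iterE q k n φ a b = 0 := by
        rcases eq_or_ne b (n + 1 : ℕ) with rfl | h'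
        · simp
        · rw [ih n (by omega) _ _ hb (by push_cast at hb' h'; omega), mul_zero]
      have h2 : qz q b * iterE q k n φ (a + 1) (b - 1) = 0 := by
        rcases eq_or_ne b 0 with rfl | h'
        · simp
        · rw [ih n (by omega) _ _ (by omega) (by push_cast at hb'; omega), mul_zero]
      linear_combination h2 + q ^ (a - b) * h1

end Operators

/-! ### Words of arrows -/

section Words

/-- The number of up arrows of a word. -/
def up (l : List Bool) : ℕ := l.count true

/-- The number of down arrows of a word. -/
def dn (l : List Bool) : ℕ := l.count false

/-- The number of pairs of an up arrow to the left of a down arrow. -/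
def inv : List Bool → ℕ
  | [] => 0
  | x :: l => inv l + if x then dn l else 0

/-- The number of pairs of a down arrow to the left of an up arrow. -/
def coinv : List Bool → ℕ
  | [] => 0
  | x :: l => coinv l + if x then 0 else up l

@[simp] lemma up_nil : up [] = 0 := rfl
@[simp] lemma dn_nil : dn [] = 0 := rfl
@[simp] lemma inv_nil : inv [] = 0 := rfl
@[simp] lemma coinv_nil : coinv [] = 0 := rfl
@[simp] lemma up_true (l : List Bool) : up (true :: l) = up l + 1 := by simp [up]
@[simp] lemma up_false (l : List Bool) : up (false :: l) = up l := by simp [up]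
@[simp] lemma dn_true (l : List Bool) : dn (true :: l) = dn l := by simp [dn]
@[simp] lemma dn_false (l : List Bool) : dn (false :: l) = dn l + 1 := by simp [dn]
@[simp] lemma inv_true (l : List Bool) : inv (true :: l) = inv l + dn l := by simp [inv]
@[simp] lemma inv_false (l : List Bool) : inv (false :: l) = inv l := by simp [inv]
@[simp] lemma coinv_true (l : List Bool) : coinv (true :: l) = coinv l := by simp [coinv]
@[simp] lemma coinv_false (l : List Bool) : coinv (false :: l) = coinv l + up l := by simp [coinv]
@[simp] lemma up_append (l l' : List Bool) : up (l ++ l') = up l + up l' := by simp [up]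
@[simp] lemma dn_append (l l' : List Bool) : dn (l ++ l') = dn l + dn l' := by simp [dn]

lemma up_add_dn (l : List Bool) : up l + dn l = l.length := by
  induction l with
  | nil => rfl
  | cons x l ih => cases x <;> simp <;> omega

@[simp] lemma inv_append (l l' : List Bool) : inv (l ++ l') = inv l + inv l' + up l * dn l' := by
  induction l with
  | nil => simp
  | cons x l ih => cases x <;> simp [ih, Nat.add_mul] <;> omega

@[simp] lemma coinv_append (l l' : List Bool) :
    coinv (l ++ l') = coinv l + coinv l' + dn l * up l' := by
  induction l with
  | nil => simp
  | cons x l ih => cases x <;> simp [ih, Nat.add_mul] <;> omega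

lemma numUp_eq_up {n : ℕ} (s : Fin n → Bool) : numUp s = up (List.ofFn s) := by
  induction n with
  | zero => simp [numUp]
  | succ n ih =>
    have ih := ih (fun i => s i.succ)
    rw [numUp, Finset.card_filter] at ih ⊢
    rw [Fin.sum_univ_succ, ih, List.ofFn_succ]
    cases s 0 <;> simp [add_comm]

lemma dn_ofFn {n : ℕ} (s : Fin n → Bool) :
    dn (List.ofFn s) = ∑ i, if s i = false then 1 else 0 := by
  induction n with
  | zero => simp
  | succ n ih =>
    rw [Fin.sum_univ_succ, ← ih, List.ofFn_succ]
    cases s 0 <;> simp [add_comm]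

lemma up_ofFn {n : ℕ} (s : Fin n → Bool) :
    up (List.ofFn s) = ∑ i, if s i = true then 1 else 0 := by
  rw [← numUp_eq_up, numUp, Finset.card_filter]

lemma normPlus_eq_inv {n : ℕ} (s : Fin n → Bool) : normPlus s = inv (List.ofFn s) := by
  induction n with
  | zero => simp [normPlus]
  | succ n ih =>
    have ih := ih (fun i => s i.succ)
    rw [normPlus, Finset.card_filter, Fintype.sum_prod_type] at ih ⊢
    simp only [Fin.sum_univ_succ, Fin.succ_lt_succ_iff, Fin.not_lt_zero, false_and, if_false,
      zero_add, Fin.succ_pos, true_and]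
    rw [ih, List.ofFn_succ]
    cases h : s 0
    · simp
    · simp only [inv_true, dn_ofFn]
      rw [add_comm]; congr 1
      refine Finset.sum_congr rfl fun i _ => ?_
      cases s i.succ <;> simp

lemma normMinus_eq_coinv {n : ℕ} (s : Fin n → Bool) : normMinus s = coinv (List.ofFn s) := by
  induction n with
  | zero => simp [normMinus]
  | succ n ih =>
    have ih := ih (fun i => s i.succ)
    rw [normMinus, Finset.card_filter, Fintype.sum_prod_type] at ih ⊢
    simp only [Fin.sum_univ_succ, Fin.succ_lt_succ_iff, Fin.not_lt_zero, false_and, if_false,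
      zero_add, Fin.succ_pos, true_and]
    rw [ih, List.ofFn_succ]
    cases h : s 0
    · simp only [coinv_false, up_ofFn]
      rw [add_comm]; congr 1
    · simp

variable {F : Type*} [Field F] {q : F}

/-- The sum of a function over all words of length `n`. -/
def wsum (n : ℕ) (f : List Bool → F) : F := ∑ s : Fin n → Bool, f (List.ofFn s)

@[simp] lemma wsum_zero (f : List Bool → F) : wsum 0 f = f [] := by simp [wsum]

lemma wsum_succ (n : ℕ) (f : List Bool → F) :
    wsum (n + 1) f = wsum n (fun l => f (true :: l)) + wsum n fun l => f (false :: l) := by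
  simp only [wsum]
  rw [← (Fin.consEquiv fun _ => Bool).sum_comp, Fintype.sum_prod_type, Fintype.sum_bool]
  simp [Fin.consEquiv, List.ofFn_succ]

lemma ofFn_snoc {n : ℕ} (s : Fin n → Bool) (x : Bool) :
    List.ofFn (Fin.snoc s x : Fin (n + 1) → Bool) = List.ofFn s ++ [x] := by
  rw [List.ofFn_succ']; simp

lemma wsum_succ' (n : ℕ) (f : List Bool → F) :
    wsum (n + 1) f = wsum n (fun l => f (l ++ [true])) + wsum n fun l => f (l ++ [false]) := by
  simp only [wsum]
  rw [← (Fin.snocEquiv fun _ => Bool).sum_comp, Fintype.sum_prod_type, Fintype.sum_bool]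
  simp only [Fin.snocEquiv, Equiv.coe_fn_mk, ofFn_snoc]

lemma wsum_congr {n : ℕ} {f g : List Bool → F} (h : ∀ l, l.length = n → f l = g l) :
    wsum n f = wsum n g :=
  Finset.sum_congr rfl fun _ _ => h _ (List.length_ofFn)

lemma wsum_add (n : ℕ) (f g : List Bool → F) :
    wsum n (fun l => f l + g l) = wsum n f + wsum n g := Finset.sum_add_distrib

lemma mul_wsum (n : ℕ) (c : F) (f : List Bool → F) :
    c * wsum n f = wsum n fun l => c * f l := Finset.mul_sum _ _ _

/-! ### The coordinates of the embedding `T^*` -/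

/-- The coefficient of the word `l` in `T^* v`, where `v` is the basis vector with `c` up arrows. -/
def starCoeff (q : F) (l : List Bool) (c : ℤ) : F :=
  if (up l : ℤ) = c then
    qFact q (up l) * qFact q (dn l) / qFact q l.length * q ^ (-(coinv l : ℤ)) else 0

lemma symTStar_eq (n : ℕ) (s : Fin n → Bool) (c : Fin (n + 1)) :
    symTStar q n s c = starCoeff q (List.ofFn s) c := by
  have h := up_add_dn (List.ofFn s)
  rw [List.length_ofFn] at h
  simp only [symTStar, starCoeff, numUp_eq_up, normMinus_eq_coinv, List.length_ofFn, Nat.cast_inj]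
  split_ifs with hc
  · rw [qBinom, inv_div, ← hc, show n - up (List.ofFn s) = dn (List.ofFn s) by omega,
      show n - dn (List.ofFn s) = up (List.ofFn s) by omega, mul_comm (qFact q (dn _))]
  · rfl

lemma symT_eq (n : ℕ) (s : Fin n → Bool) (c : Fin (n + 1)) :
    symT q n c s = if up (List.ofFn s) = c then q ^ inv (List.ofFn s) else 0 := by
  simp only [symT, numUp_eq_up, normPlus_eq_inv]

lemma starCoeff_true_cons (hn : ∀ n, qInt q (n + 1) ≠ 0) (l : List Bool) (c : ℤ) :
    starCoeff q (true :: l) c = qz q c / qInt q (l.length + 1) * starCoeff q l (c - 1) := by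
  have := qFact_ne_zero hn l.length; have := hn l.length
  simp only [starCoeff, up_true, dn_true, List.length_cons, coinv_true]
  by_cases h : (up l : ℤ) = c - 1
  · rw [if_pos h, if_pos (by push_cast; omega), show c = (up l + 1 : ℕ) by push_cast; omega]
    simp only [qFact_succ, qz_natCast]
    field_simp
  · rw [if_neg h, if_neg (by push_cast; omega), mul_zero]

lemma starCoeff_false_cons (hq : q ≠ 0) (hn : ∀ n, qInt q (n + 1) ≠ 0) (l : List Bool) (c : ℤ) :
    starCoeff q (false :: l) c =
      qz q (l.length + 1 - c) / qInt q (l.length + 1) * q ^ (-c) * starCoeff q l c := by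
  have := qFact_ne_zero hn l.length; have := hn l.length
  simp only [starCoeff, up_false, dn_false, List.length_cons, coinv_false]
  by_cases h : (up l : ℤ) = c
  · have e : (l.length : ℤ) + 1 - c = (dn l + 1 : ℕ) := by
      rw [← h, ← up_add_dn]; push_cast; ring
    rw [if_pos h, if_pos h, e, ← h, Nat.cast_add (coinv l), neg_add, zpow_add₀ hq]
    simp only [qFact_succ, qz_natCast]
    field_simp
  · rw [if_neg h, if_neg h, mul_zero]

lemma starCoeff_append_true (hq : q ≠ 0) (hn : ∀ n, qInt q (n + 1) ≠ 0) (l : List Bool) (c : ℤ) :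
    starCoeff q (l ++ [true]) c =
      qz q c / qInt q (l.length + 1) * q ^ (c - (l.length + 1)) * starCoeff q l (c - 1) := by
  have := qFact_ne_zero hn l.length; have := hn l.length
  simp only [starCoeff, up_append, up_true, up_nil, dn_append, dn_true, dn_nil, List.length_append,
    List.length_cons, List.length_nil, coinv_append, coinv_true, coinv_nil, zero_add, add_zero,
    mul_one]
  by_cases h : (up l : ℤ) = c - 1
  · have e : c - (l.length + 1) = -(dn l : ℤ) := by
      rw [← up_add_dn]; push_cast; omega
    rw [if_pos h, if_pos (by push_cast; omega), e, show c = (up l + 1 : ℕ) by push_cast; omega,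
      Nat.cast_add (coinv l), neg_add, zpow_add₀ hq]
    simp only [qFact_succ, qz_natCast]
    field_simp
  · rw [if_neg h, if_neg (by push_cast; omega), mul_zero]

lemma starCoeff_append_false (hn : ∀ n, qInt q (n + 1) ≠ 0) (l : List Bool) (c : ℤ) :
    starCoeff q (l ++ [false]) c =
      qz q (l.length + 1 - c) / qInt q (l.length + 1) * starCoeff q l c := by
  have := qFact_ne_zero hn l.length; have := hn l.length
  simp only [starCoeff, up_append, up_false, up_nil, dn_append, dn_false, dn_nil,
    List.length_append, List.length_cons, List.length_nil, coinv_append, coinv_false, coinv_nil,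
    zero_add, add_zero, mul_zero]
  by_cases h : (up l : ℤ) = c
  · have e : (l.length : ℤ) + 1 - c = (dn l + 1 : ℕ) := by
      rw [← h, ← up_add_dn]; push_cast; ring
    rw [if_pos h, if_pos h, e]
    simp only [qFact_succ, qz_natCast]
    field_simp
  · rw [if_neg h, if_neg h, mul_zero]

/-- `T T^* = 1`, applied to a row functional. -/
lemma wsum_mul_starCoeff (hq : q ≠ 0) (hn : ∀ n, qInt q (n + 1) ≠ 0) (n : ℕ) (φ : ℤ → F) (c : ℤ)
    (h0 : 0 ≤ c) (hc : c ≤ n) :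
    wsum n (fun s => φ (up s) * q ^ inv s * starCoeff q s c) = φ c := by
  induction n generalizing φ c with
  | zero =>
    obtain rfl : c = 0 := by simp at hc; omega
    simp [starCoeff, qFact_zero]
  | succ n ih =>
    rw [wsum_succ]
    have h1 : wsum n (fun l => φ (up (true :: l)) * q ^ inv (true :: l) *
        starCoeff q (true :: l) c) = qz q c / qInt q (n + 1) * q ^ (n - (c - 1)) * φ c := by
      have e : ∀ l : List Bool, l.length = n →
          φ (up (true :: l)) * q ^ inv (true :: l) * starCoeff q (true :: l) c =
          qz q c / qInt q (n + 1) * q ^ (n - (c - 1)) *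
            (φ (up l + 1) * q ^ inv l * starCoeff q l (c - 1)) := by
        intro l hl
        rw [starCoeff_true_cons hn, hl, up_true, inv_true, pow_add]
        by_cases h : (up l : ℤ) = c - 1
        · have : q ^ dn l = q ^ (n - (c - 1)) := by
            rw [← zpow_natCast, ← h, ← hl, ← up_add_dn l]; congr 1; push_cast; ring
          rw [← this]; push_cast; ring
        · simp [starCoeff, h]
      rw [wsum_congr e, ← mul_wsum]
      rcases eq_or_ne c 0 with rfl | h
      · simp
      · rw [ih (fun x => φ (x + 1)) (c - 1) (by omega) (by push_cast at hc; omega), sub_add_cancel]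
    have h2 : wsum n (fun l => φ (up (false :: l)) * q ^ inv (false :: l) *
        starCoeff q (false :: l) c) = qz q (n + 1 - c) / qInt q (n + 1) * q ^ (-c) * φ c := by
      have e : ∀ l : List Bool, l.length = n →
          φ (up (false :: l)) * q ^ inv (false :: l) * starCoeff q (false :: l) c =
          qz q (n + 1 - c) / qInt q (n + 1) * q ^ (-c) *
            (φ (up l) * q ^ inv l * starCoeff q l c) := by
        intro l hl
        rw [starCoeff_false_cons hq hn, hl, up_false, inv_false]
        ring
      rw [wsum_congr e, ← mul_wsum]
      rcases eq_or_ne c (n + 1) with rfl | h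
      · simp
      · rw [ih φ c h0 (by push_cast at hc; omega)]
    rw [h1, h2]
    have h3 : qInt q (n + 1) = q ^ ((n : ℤ) + 1 - c) * qz q c + q ^ (-c) * qz q (n + 1 - c) := by
      rw [← qz_add hq, ← qz_natCast]; congr 1; push_cast; ring
    have := hn n
    rw [show (n : ℤ) - (c - 1) = n + 1 - c by ring]
    field_simp
    linear_combination (-φ c) * h3

end Words

/-! ### Row actions of the diagrams on two sites -/

section RowActions

variable {F : Type*} [Field F] {q : F}

/-- The row functional `φ (T ⊗ T)` on pairs of words. -/
def rowT (q : F) (φ : ℤ → ℤ → F) (s t : List Bool) : F :=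
  φ (up s) (up t) * q ^ inv s * q ^ inv t

/-- `φ M = ψ`, where `φ` and `ψ` are regarded as row vectors, with the numbers of up arrows at the
two sites as indices. -/
def IsRowAct {m n m' n' : ℕ}
    (M : Matrix (Fin (m' + 1) × Fin (n' + 1)) (Fin (m + 1) × Fin (n + 1)) F)
    (φ ψ : ℤ → ℤ → F) : Prop :=
  ∀ a b, ∑ x, φ x.1 x.2 * M x (a, b) = ψ a b

lemma IsRowAct.mul {m n m' n' m₂ n₂ : ℕ}
    {M : Matrix (Fin (m' + 1) × Fin (n' + 1)) (Fin (m + 1) × Fin (n + 1)) F}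
    {N : Matrix (Fin (m + 1) × Fin (n + 1)) (Fin (m₂ + 1) × Fin (n₂ + 1)) F}
    {φ ψ χ : ℤ → ℤ → F} (hM : IsRowAct M φ ψ) (hN : IsRowAct N ψ χ) :
    IsRowAct (M * N) φ χ := by
  intro a b
  simp only [Matrix.mul_apply, Finset.mul_sum]
  rw [Finset.sum_comm, ← hN a b]
  refine Finset.sum_congr rfl fun x _ => ?_
  rw [← hM x.1 x.2, Finset.sum_mul]
  exact Finset.sum_congr rfl fun y _ => (mul_assoc _ _ _).symm

/-- A matrix is determined by its action on row vectors. -/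
lemma eq_of_isRowAct {m n m' n' : ℕ}
    {M N : Matrix (Fin (m' + 1) × Fin (n' + 1)) (Fin (m + 1) × Fin (n + 1)) F}
    (h : ∀ φ : ℤ → ℤ → F, ∃ ψ, IsRowAct M φ ψ ∧ IsRowAct N φ ψ) : M = N := by
  ext x ⟨a, b⟩
  obtain ⟨ψ, hM, hN⟩ := h fun c d => if c = (x.1 : ℕ) ∧ d = (x.2 : ℕ) then 1 else 0
  have h := (hM a b).trans (hN a b).symm
  have e : ∀ y : Fin (m' + 1) × Fin (n' + 1),
      (((y.1 : ℕ) : ℤ) = (x.1 : ℕ) ∧ ((y.2 : ℕ) : ℤ) = (x.2 : ℕ)) ↔ y = x := by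
    intro y; rw [Prod.ext_iff, Fin.ext_iff, Fin.ext_iff]; norm_cast
  simpa only [e, ite_mul, one_mul, zero_mul, Finset.sum_ite_eq', Finset.mem_univ, if_true] using h

lemma sum_mul_symTPair (m n : ℕ) (φ : ℤ → ℤ → F) (s : Fin m → Bool) (t : Fin n → Bool) :
    ∑ x : Fin (m + 1) × Fin (n + 1), φ x.1 x.2 * symTPair q m n x (s, t) =
      rowT q φ (List.ofFn s) (List.ofFn t) := by
  have hs : up (List.ofFn s) < m + 1 := by
    have := up_add_dn (List.ofFn s); rw [List.length_ofFn] at this; omega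
  have ht : up (List.ofFn t) < n + 1 := by
    have := up_add_dn (List.ofFn t); rw [List.length_ofFn] at this; omega
  rw [Finset.sum_eq_single (⟨up (List.ofFn s), hs⟩, ⟨up (List.ofFn t), ht⟩)]
  · simp [symTPair, symT_eq, rowT, mul_assoc]
  · rintro ⟨a, b⟩ - h
    simp only [symTPair, Matrix.kroneckerMap_apply, symT_eq]
    by_cases h1 : up (List.ofFn s) = a
    · by_cases h2 : up (List.ofFn t) = b
      · exact absurd (Prod.ext (Fin.ext h1.symm) (Fin.ext h2.symm)) h
      · simp [h2]
    · simp [h1]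
  · simp

lemma sum_mul_symTPair_mul (m n m' n' : ℕ) (φ : ℤ → ℤ → F)
    (X : Matrix ((Fin m' → Bool) × (Fin n' → Bool)) ((Fin m → Bool) × (Fin n → Bool)) F)
    (a : Fin (m + 1)) (b : Fin (n + 1)) :
    ∑ x, φ x.1 x.2 * (symTPair q m' n' * X * symTStarPair q m n) x (a, b) =
      ∑ s, ∑ t, (∑ s', ∑ t', rowT q φ (List.ofFn s') (List.ofFn t') * X (s', t') (s, t)) *
        starCoeff q (List.ofFn s) a * starCoeff q (List.ofFn t) b := by
  simp only [Matrix.mul_apply, Finset.mul_sum, Finset.sum_mul]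
  rw [Finset.sum_comm, Fintype.sum_prod_type]
  refine Finset.sum_congr rfl fun s _ => Finset.sum_congr rfl fun t _ => ?_
  rw [Finset.sum_comm, Fintype.sum_prod_type]
  refine Finset.sum_congr rfl fun s' _ => Finset.sum_congr rfl fun t' _ => ?_
  rw [← sum_mul_symTPair, Finset.sum_mul, Finset.sum_mul, Finset.sum_mul]
  refine Finset.sum_congr rfl fun x _ => ?_
  simp only [symTStarPair, Matrix.kroneckerMap_apply, symTStar_eq]
  ring

/-! ### Moving strands between the sites -/

lemma sum_append {k n : ℕ} (f : (Fin (k + n) → Bool) → F) :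
    ∑ t, f t = ∑ u : Fin k → Bool, ∑ t : Fin n → Bool, f (Fin.append u t) := by
  rw [← (Fin.appendEquiv k n).sum_comp, Fintype.sum_prod_type]
  rfl

lemma append_inj {m n : ℕ} {s s' : Fin m → Bool} {t t' : Fin n → Bool} :
    Fin.append s' t' = Fin.append s t ↔ s' = s ∧ t' = t := by
  have h := (Fin.appendEquiv (α := Bool) m n).injective.eq_iff (a := (s', t')) (b := (s, t))
  rw [Prod.mk.injEq] at h
  exact h

lemma regroup_append_right (m k n : ℕ) (s' : Fin (m + k) → Bool) (t' t : Fin n → Bool)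
    (s : Fin m → Bool) (u : Fin k → Bool) :
    regroup F m (k + n) (m + k) n (s', t') (s, Fin.append u t) =
      if s' = Fin.append s u ∧ t' = t then 1 else 0 := by
  have h : (∀ (x' : Fin (m + k + n)) (x : Fin (m + (k + n))), x'.val = x.val →
      Fin.append s' t' x' = Fin.append s (Fin.append u t) x) ↔ s' = Fin.append s u ∧ t' = t := by
    rw [← append_inj, Fin.append_assoc]
    constructor
    · intro h; ext1 x; exact h x _ rfl
    · intro h x' x hx
      rw [h]
      exact congrArg (Fin.append s (Fin.append u t))
        (Fin.ext hx : Fin.cast (Nat.add_assoc m k n) x' = x)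
  simp only [regroup, h]

lemma regroup_append_left (m k n : ℕ) (s' s : Fin m → Bool) (t' : Fin (k + n) → Bool)
    (t : Fin n → Bool) (u : Fin k → Bool) :
    regroup F (m + k) n m (k + n) (s', t') (Fin.append s u, t) =
      if s' = s ∧ t' = Fin.append u t then 1 else 0 := by
  have h : (∀ (x' : Fin (m + (k + n))) (x : Fin (m + k + n)), x'.val = x.val →
      Fin.append s' t' x' = Fin.append (Fin.append s u) t x) ↔ s' = s ∧ t' = Fin.append u t := by
    rw [← append_inj, Fin.append_assoc]
    constructor
    · intro h; ext1 x; exact h x (Fin.cast (Nat.add_assoc m k n).symm x) rfl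
    · intro h x' x hx; rw [h]; exact congrArg _ (Fin.ext hx)
  simp only [regroup, h]

/-- The action of the operator that moves `k` strands `u` from the second site to the first one,
which holds `a` up arrows: a down arrow of `u` forms an inversion with each of these. -/
lemma wsum_iterE (hq : q ≠ 0) (hn : ∀ n, qInt q (n + 1) ≠ 0) (k n : ℕ) (φ : ℤ → ℤ → F) (a b : ℤ)
    (h0 : 0 ≤ b) (hb : b ≤ n + k) :
    wsum k (fun u => wsum n fun t => φ (a + up u) (up t) * q ^ inv u * q ^ (a * dn u) *
      q ^ inv t * starCoeff q (u ++ t) b) =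
      qFact q n / qFact q (n + k) * iterE q k (n + k) φ a b := by
  induction k generalizing a b with
  | zero =>
    simp only [wsum_zero, up_nil, inv_nil, dn_nil, Nat.cast_zero, mul_zero, zpow_zero, pow_zero,
      mul_one, add_zero, List.nil_append]
    rw [wsum_mul_starCoeff hq hn n (φ a) b h0 (by simpa using hb)]
    simp [iterE, qFact_ne_zero hn]
  | succ k ih =>
    have h1 : qz q b * wsum k (fun u => wsum n fun t => φ (a + 1 + up u) (up t) * q ^ inv u *
        q ^ ((a + 1) * dn u) * q ^ inv t * starCoeff q (u ++ t) (b - 1)) =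
        qz q b * (qFact q n / qFact q (n + k) * iterE q k (n + k) φ (a + 1) (b - 1)) := by
      -- The induction hypothesis does not cover `b - 1 = -1`, but then `[b] = 0`.
      rcases eq_or_ne b 0 with rfl | h
      · simp
      · rw [ih _ _ (by omega) (by push_cast at hb; omega)]
    have h2 : qz q (n + k + 1 - b) * wsum k (fun u => wsum n fun t => φ (a + up u) (up t) *
        q ^ inv u * q ^ (a * dn u) * q ^ inv t * starCoeff q (u ++ t) b) =
        qz q (n + k + 1 - b) * (qFact q n / qFact q (n + k) * iterE q k (n + k) φ a b) := by
      rcases eq_or_ne b (n + k + 1) with rfl | h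
      · simp
      · rw [ih _ _ h0 (by push_cast at hb; omega)]
    have e1 : wsum k (fun u => wsum n fun t => φ (a + up (true :: u)) (up t) *
        q ^ inv (true :: u) * q ^ (a * dn (true :: u)) * q ^ inv t *
        starCoeff q (true :: u ++ t) b) = (qInt q (n + k + 1))⁻¹ * (qz q b *
        wsum k (fun u => wsum n fun t => φ (a + 1 + up u) (up t) * q ^ inv u *
        q ^ ((a + 1) * dn u) * q ^ inv t * starCoeff q (u ++ t) (b - 1))) := by
      simp only [mul_wsum]
      refine wsum_congr fun u hu => wsum_congr fun t ht => ?_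
      rw [List.cons_append, starCoeff_true_cons hn, List.length_append, hu, ht, add_comm k n,
        up_true, inv_true, dn_true, pow_add, add_mul, one_mul, zpow_add₀ hq, zpow_natCast]
      push_cast
      rw [add_assoc a 1, add_comm (1 : ℤ)]
      ring
    have e2 : wsum k (fun u => wsum n fun t => φ (a + up (false :: u)) (up t) *
        q ^ inv (false :: u) * q ^ (a * dn (false :: u)) * q ^ inv t *
        starCoeff q (false :: u ++ t) b) = (qInt q (n + k + 1))⁻¹ * q ^ (a - b) *
        (qz q (n + k + 1 - b) * wsum k (fun u => wsum n fun t => φ (a + up u) (up t) *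
        q ^ inv u * q ^ (a * dn u) * q ^ inv t * starCoeff q (u ++ t) b)) := by
      simp only [mul_wsum]
      refine wsum_congr fun u hu => wsum_congr fun t ht => ?_
      rw [List.cons_append, starCoeff_false_cons hq hn, List.length_append, hu, ht, add_comm k n,
        up_false, inv_false, dn_false, sub_eq_add_neg a b, zpow_add₀ hq]
      push_cast
      rw [mul_add, mul_one, zpow_add₀ hq]
      ring
    rw [wsum_succ, e1, e2, h1, h2, iterE_succ, opE_apply, ← add_assoc, qFact_succ,
      show (n : ℤ) + (k + 1 : ℕ) - 1 = n + k by push_cast; ring]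
    push_cast
    have := qFact_ne_zero hn (n + k); have := hn (n + k)
    rw [← add_assoc]
    field_simp

/-- The action of the operator that moves `k` strands `u` from the first site to the second one,
which holds `n - b` down arrows: an up arrow of `u` forms an inversion with each of these. -/
lemma wsum_iterF (hq : q ≠ 0) (hn : ∀ n, qInt q (n + 1) ≠ 0) (k m : ℕ) (n : ℤ) (φ : ℤ → ℤ → F)
    (a b : ℤ) (h0 : 0 ≤ a) (ha : a ≤ m + k) :
    wsum m (fun s => wsum k fun u => φ (up s) (b + up u) * q ^ inv s * q ^ inv u *
      q ^ (up u * (n - b)) * starCoeff q (s ++ u) a) =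
      qFact q m / qFact q (m + k) * iterF q k (m + k) n φ a b := by
  induction k generalizing a b n with
  | zero =>
    simp only [wsum_zero, up_nil, inv_nil, Nat.cast_zero, zero_mul, zpow_zero, pow_zero,
      mul_one, add_zero, List.append_nil]
    rw [wsum_mul_starCoeff hq hn m (fun x => φ x b) a h0 (by simpa using ha)]
    simp [iterF, qFact_ne_zero hn]
  | succ k ih =>
    have h1 : qz q a * wsum m (fun s => wsum k fun u => φ (up s) (b + 1 + up u) * q ^ inv s *
        q ^ inv u * q ^ (up u * (n + 1 - (b + 1))) * starCoeff q (s ++ u) (a - 1)) =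
        qz q a * (qFact q m / qFact q (m + k) * iterF q k (m + k) (n + 1) φ (a - 1) (b + 1)) := by
      rcases eq_or_ne a 0 with rfl | h
      · simp
      · rw [ih (n + 1) (a - 1) (b + 1) (by omega) (by push_cast at ha; omega)]
    have h2 : qz q (m + k + 1 - a) * wsum m (fun s => wsum k fun u => φ (up s) (b + up u) *
        q ^ inv s * q ^ inv u * q ^ (up u * (n + 1 - b)) * starCoeff q (s ++ u) a) =
        qz q (m + k + 1 - a) *
          (qFact q m / qFact q (m + k) * iterF q k (m + k) (n + 1) φ a b) := by
      rcases eq_or_ne a (m + k + 1) with rfl | h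
      · simp
      · rw [ih (n + 1) a b h0 (by push_cast at ha; omega)]
    have e1 : wsum m (fun s => wsum k fun u => φ (up s) (b + up (u ++ [true])) * q ^ inv s *
        q ^ inv (u ++ [true]) * q ^ (up (u ++ [true]) * (n - b)) *
        starCoeff q (s ++ (u ++ [true])) a) =
        (qInt q (m + k + 1))⁻¹ * q ^ (n - b + (a - (m + k + 1))) * (qz q a *
        wsum m (fun s => wsum k fun u => φ (up s) (b + 1 + up u) * q ^ inv s *
        q ^ inv u * q ^ (up u * (n + 1 - (b + 1))) * starCoeff q (s ++ u) (a - 1))) := by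
      simp only [mul_wsum]
      refine wsum_congr fun s hs => wsum_congr fun u hu => ?_
      rw [← List.append_assoc, starCoeff_append_true hq hn, List.length_append, hu, hs]
      simp only [up_append, up_true, up_nil, inv_append, inv_true, inv_nil, dn_true, dn_nil,
        add_zero, mul_zero, zero_add]
      rw [show ((up u + 1 : ℕ) : ℤ) * (n - b) = up u * (n + 1 - (b + 1)) + (n - b) by
        push_cast; ring, zpow_add₀ hq, zpow_add₀ hq]
      push_cast
      rw [add_assoc b 1, add_comm (1 : ℤ)]
      ring
    have e2 : wsum m (fun s => wsum k fun u => φ (up s) (b + up (u ++ [false])) * q ^ inv s *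
        q ^ inv (u ++ [false]) * q ^ (up (u ++ [false]) * (n - b)) *
        starCoeff q (s ++ (u ++ [false])) a) =
        (qInt q (m + k + 1))⁻¹ * (qz q (m + k + 1 - a) *
        wsum m (fun s => wsum k fun u => φ (up s) (b + up u) *
        q ^ inv s * q ^ inv u * q ^ (up u * (n + 1 - b)) * starCoeff q (s ++ u) a)) := by
      simp only [mul_wsum]
      refine wsum_congr fun s hs => wsum_congr fun u hu => ?_
      rw [← List.append_assoc, starCoeff_append_false hn, List.length_append, hu, hs]
      simp only [up_append, up_false, up_nil, inv_append, inv_false, inv_nil, dn_false, dn_nil,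
        add_zero, zero_add, mul_one]
      rw [show (up u : ℤ) * (n + 1 - b) = up u * (n - b) + up u by ring, zpow_add₀ hq,
        zpow_natCast, pow_add]
      push_cast
      ring
    simp only [wsum_succ' k, wsum_add]
    rw [e1, e2, h1, h2, iterF_succ, opF_apply, ← add_assoc, qFact_succ,
      show (m : ℤ) + (k + 1 : ℕ) - 1 = m + k by push_cast; ring]
    push_cast
    have := qFact_ne_zero hn (m + k); have := hn (m + k)
    rw [← add_assoc, show n - b + (a - ((m : ℤ) + k + 1)) = n - b - (m + k + 1) + a by ring]
    field_simp
    ring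

lemma cascadeU_isRowAct_right (hq : q ≠ 0) (hn : ∀ n, qInt q (n + 1) ≠ 0) {m n m' n' k : ℕ}
    (hm : m' = m + k) (hn' : n = k + n') (φ : ℤ → ℤ → F) :
    IsRowAct (cascadeU q m n m' n') φ ((qFact q n' / qFact q n) • iterE q k n φ) := by
  subst hm hn'
  intro a b
  have ha : ((a : ℕ) : ℤ) ≤ m := by exact_mod_cast Nat.lt_succ_iff.1 a.2
  have hb : ((b : ℕ) : ℤ) ≤ n' + k := by have := b.2; omega
  rw [cascadeU, sum_mul_symTPair_mul]
  have h1 : ∀ s : Fin m → Bool, ∀ u : Fin k → Bool, ∀ t : Fin n' → Bool,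
      (∑ s', ∑ t', rowT q φ (List.ofFn s') (List.ofFn t') *
        regroup F m (k + n') (m + k) n' (s', t') (s, Fin.append u t)) =
      rowT q φ (List.ofFn s ++ List.ofFn u) (List.ofFn t) := by
    intro s u t
    simp only [regroup_append_right, ite_and, mul_ite, mul_one, mul_zero]
    simp [List.ofFn_fin_append]
  refine (Finset.sum_congr rfl fun s _ => sum_append _).trans ?_
  simp only [h1, List.ofFn_fin_append]
  simp only [rowT, up_append, inv_append]
  have h2 := wsum_iterE hq hn k n' φ a b (by positivity) hb
  rw [show (n' : ℤ) + k = ((k + n' : ℕ) : ℤ) by push_cast; ring, add_comm n' k] at h2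
  refine Eq.trans ?_ h2
  simp only [wsum]
  rw [Finset.sum_comm]
  refine Finset.sum_congr rfl fun u _ => ?_
  rw [Finset.sum_comm]
  refine Finset.sum_congr rfl fun t _ => ?_
  generalize List.ofFn u = u, List.ofFn t = t
  have h3 := wsum_mul_starCoeff hq hn m
    (fun x ↦ φ (x + up u) (up t) * q ^ inv u * q ^ (x * dn u) * q ^ inv t * starCoeff q (u ++ t) b)
    a (by positivity) ha
  rw [← h3]
  refine Finset.sum_congr rfl fun s _ => ?_
  push_cast
  rw [pow_add, pow_add, pow_mul, zpow_mul, zpow_natCast, zpow_natCast]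
  ring

lemma cascadeU_isRowAct_left (hq : q ≠ 0) (hn : ∀ n, qInt q (n + 1) ≠ 0) {m n m' n' k : ℕ}
    (hm : m = m' + k) (hn' : n' = k + n) (φ : ℤ → ℤ → F) :
    IsRowAct (cascadeU q m n m' n') φ ((qFact q m' / qFact q m) • iterF q k m n φ) := by
  subst hm hn'
  intro a b
  have ha : ((a : ℕ) : ℤ) ≤ m' + k := by have := a.2; omega
  have hb : ((b : ℕ) : ℤ) ≤ n := by exact_mod_cast Nat.lt_succ_iff.1 b.2
  rw [cascadeU, sum_mul_symTPair_mul]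
  have h1 : ∀ s : Fin m' → Bool, ∀ u : Fin k → Bool, ∀ t : Fin n → Bool,
      (∑ s', ∑ t', rowT q φ (List.ofFn s') (List.ofFn t') *
        regroup F (m' + k) n m' (k + n) (s', t') (Fin.append s u, t)) =
      rowT q φ (List.ofFn s) (List.ofFn u ++ List.ofFn t) := by
    intro s u t
    simp only [regroup_append_left, ite_and, mul_ite, mul_one, mul_zero]
    simp [List.ofFn_fin_append]
  refine (sum_append _).trans ?_
  simp only [h1, List.ofFn_fin_append]
  simp only [rowT, up_append, inv_append]
  have h2 := wsum_iterF hq hn k m' n φ a b (by positivity) ha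
  rw [← Nat.cast_add] at h2
  refine Eq.trans ?_ h2
  simp only [wsum]
  refine Finset.sum_congr rfl fun s _ => Finset.sum_congr rfl fun u _ => ?_
  generalize List.ofFn s = s, List.ofFn u = u
  have h3 := wsum_mul_starCoeff hq hn n
    (fun x => φ (up s) (x + up u) * q ^ inv s * q ^ inv u * q ^ (up u * (n - x)) *
      starCoeff q (s ++ u) a) b (by positivity) hb
  rw [← h3]
  refine Finset.sum_congr rfl fun t _ => ?_
  have e : (n : ℤ) - up (List.ofFn t) = dn (List.ofFn t) := by
    have := up_add_dn (List.ofFn t)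
    rw [List.length_ofFn] at this
    omega
  dsimp only
  rw [e, pow_add, pow_add, pow_mul, zpow_mul, zpow_natCast, zpow_natCast]
  push_cast
  rw [add_comm (up u : ℤ)]
  ring

/-! ### Caps and cups -/

/-- The coefficient of `j` nested arcs with weights `g`, inserted between the words `s'` and `t'`,
at the words `s` and `t`. -/
def nest (g : Bool → Bool → F) (m n m' n' j : ℕ) (s : Fin m → Bool) (t : Fin n → Bool)
    (s' : Fin m' → Bool) (t' : Fin n' → Bool) : F :=
  if (∀ (x : Fin m) (x' : Fin m'), x.val = x'.val → s x = s' x') ∧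
      (∀ (y : Fin n) (y' : Fin n'), y.val = y'.val + j → t y = t' y') then
    ∏ x : Fin m, ∏ y : Fin n,
      if y.val < j ∧ x.val + y.val + 1 = m then g (s x) (t y) else 1
  else 0

lemma nest_zero (g : Bool → Bool → F) (m n : ℕ) (s s' : Fin m → Bool) (t t' : Fin n → Bool) :
    nest g m n m n 0 s t s' t' = if s = s' ∧ t = t' then 1 else 0 := by
  have h1 : (∀ x x' : Fin m, x.val = x'.val → s x = s' x') ↔ s = s' :=
    ⟨fun h => funext fun x => h x x rfl, fun h x x' hx => by rw [h, Fin.ext hx]⟩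
  have h2 : (∀ x x' : Fin n, x.val = x'.val + 0 → t x = t' x') ↔ t = t' :=
    ⟨fun h => funext fun x => h x x rfl, fun h x x' hx => by rw [h, Fin.ext hx]⟩
  simp only [nest, h1, h2]
  simp

lemma nest_succ (g : Bool → Bool → F) (m n m' n' j : ℕ) (hm : m' ≤ m) (s : Fin m → Bool)
    (t : Fin n → Bool) (s' : Fin m' → Bool) (t' : Fin n' → Bool) (x y : Bool) :
    nest g (m + 1) (n + 1) m' n' (j + 1) (Fin.snoc s x) (Fin.cons y t) s' t' =
      g x y * nest g m n m' n' j s t s' t' := by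
  have h1 : (∀ (z : Fin (m + 1)) (z' : Fin m'), z.val = z'.val →
      (Fin.snoc s x : Fin (m + 1) → Bool) z = s' z') ↔
      ∀ (z : Fin m) (z' : Fin m'), z.val = z'.val → s z = s' z' := by
    constructor
    · intro h z z' hz
      simpa using h z.castSucc z' hz
    · intro h z z' hz
      induction z using Fin.lastCases with
      | last => have := z'.2; simp at hz; omega
      | cast z => simpa using h z z' hz
  have h2 : (∀ (z : Fin (n + 1)) (z' : Fin n'), z.val = z'.val + (j + 1) →
      (Fin.cons y t : Fin (n + 1) → Bool) z = t' z') ↔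
      ∀ (z : Fin n) (z' : Fin n'), z.val = z'.val + j → t z = t' z' := by
    constructor
    · intro h z z' hz
      simpa using h z.succ z' (by simp; omega)
    · intro h z z' hz
      cases z using Fin.cases with
      | zero => simp at hz
      | succ z => simpa using h z z' (by simp at hz; omega)
  simp only [nest, h1, h2, mul_ite, mul_zero]
  congr 1
  rw [Fin.prod_univ_castSucc, mul_comm]
  congr 1
  · rw [Fin.prod_univ_succ]
    simp
  · refine Finset.prod_congr rfl fun z _ => ?_
    rw [Fin.prod_univ_succ, if_neg (by have := z.2; simp; omega), one_mul]
    refine Finset.prod_congr rfl fun w _ => ?_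
    simp only [Fin.snoc_castSucc, Fin.cons_succ, Fin.val_succ, Fin.val_castSucc]
    congr 1
    simp only [eq_iff_iff]
    constructor <;> (rintro ⟨h1, h2⟩; exact ⟨by omega, by omega⟩)

lemma sum_snoc {n : ℕ} (f : (Fin (n + 1) → Bool) → F) :
    ∑ s, f s = ∑ x : Bool, ∑ s : Fin n → Bool, f (Fin.snoc s x) := by
  rw [← (Fin.snocEquiv fun _ => Bool).sum_comp, Fintype.sum_prod_type]
  rfl

lemma sum_cons {n : ℕ} (f : (Fin (n + 1) → Bool) → F) :
    ∑ s, f s = ∑ x : Bool, ∑ s : Fin n → Bool, f (Fin.cons x s) := by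
  rw [← (Fin.consEquiv fun _ => Bool).sum_comp, Fintype.sum_prod_type]
  rfl

/-- Nested caps turn the row functional `φ (T ⊗ T)` into `(iterA φ) (T ⊗ T)`. -/
lemma sum_rowT_mul_nest {m n m' n' j : ℕ} (hm : m = m' + j) (hn : n = n' + j) (φ : ℤ → ℤ → F)
    (s' : Fin m' → Bool) (t' : Fin n' → Bool) :
    ∑ s : Fin m → Bool, ∑ t : Fin n → Bool,
      rowT q φ (List.ofFn s) (List.ofFn t) * nest (capDelta q) m n m' n' j s t s' t' =
      rowT q (iterA q j n φ) (List.ofFn s') (List.ofFn t') := by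
  subst hm hn
  induction j generalizing φ with
  | zero => simp [nest_zero, iterA, ite_and]
  | succ j ih =>
    have hN : ((n' + (j + 1) : ℕ) : ℤ) - 1 = (n' + j : ℕ) := by push_cast; ring
    rw [iterA_succ, hN, ← ih]
    rw [← add_assoc, ← add_assoc, sum_snoc, Finset.sum_comm]
    refine Finset.sum_congr rfl fun s _ => ?_
    simp only [sum_cons (n := n' + j)]
    simp only [Finset.sum_comm (s := (Finset.univ : Finset Bool))
      (t := (Finset.univ : Finset (Fin (n' + j) → Bool)))]
    refine Finset.sum_congr rfl fun t _ => ?_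
    simp only [nest_succ _ _ _ _ _ _ (Nat.le_add_right m' j), ← mul_assoc, ← Finset.sum_mul]
    congr 1
    simp only [Fintype.sum_bool, capDelta, mul_zero, mul_one, add_zero, zero_add, ofFn_snoc,
      List.ofFn_cons, rowT, opA_apply, up_append, up_true, up_false, up_nil, inv_append,
      inv_true, inv_false, inv_nil, dn_true, dn_false, dn_nil]
    have e : q ^ (((n' + j + 1 : ℕ) : ℤ) + up (List.ofFn s) - up (List.ofFn t)) =
        q ^ up (List.ofFn s) * q ^ dn (List.ofFn t) * q := by
      have := up_add_dn (List.ofFn t)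
      rw [List.length_ofFn] at this
      rw [← pow_add, ← pow_succ, ← zpow_natCast]
      congr 1; push_cast; omega
    rw [e]
    push_cast
    ring

/-- `(T ⊗ T) (T^* ⊗ T^*) = 1`, applied to a row functional. -/
lemma sum_rowT_mul_starCoeff (hq : q ≠ 0) (hn : ∀ n, qInt q (n + 1) ≠ 0) (m n : ℕ)
    (φ : ℤ → ℤ → F) (a b : ℤ) (ha0 : 0 ≤ a) (ha : a ≤ m) (hb0 : 0 ≤ b) (hb : b ≤ n) :
    ∑ s : Fin m → Bool, ∑ t : Fin n → Bool, rowT q φ (List.ofFn s) (List.ofFn t) *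
      starCoeff q (List.ofFn s) a * starCoeff q (List.ofFn t) b = φ a b := by
  rw [← wsum_mul_starCoeff hq hn m (fun x => φ x b) a ha0 ha]
  refine Finset.sum_congr rfl fun s _ => ?_
  dsimp only
  rw [← wsum_mul_starCoeff hq hn n (φ (up (List.ofFn s))) b hb0 hb, wsum, Finset.sum_mul,
    Finset.sum_mul]
  refine Finset.sum_congr rfl fun t _ => ?_
  rw [rowT]; ring

/-- Nested cups act on row functionals by `iterB`, up to a scalar. -/
lemma sum_rowT_mul_nest_mul_starCoeff (hq : q ≠ 0) (hn : ∀ n, qInt q (n + 1) ≠ 0)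
    {m n m' n' l : ℕ} (hm : m = m' + l) (hn' : n = n' + l) (φ : ℤ → ℤ → F)
    (a b : ℤ) (ha0 : 0 ≤ a) (ha : a ≤ m) (hb0 : 0 ≤ b) (hb : b ≤ n) :
    ∑ s : Fin m → Bool, ∑ t : Fin n → Bool,
      (∑ s', ∑ t', rowT q φ (List.ofFn s') (List.ofFn t') *
        nest (cupEps q) m n m' n' l s t s' t') *
        starCoeff q (List.ofFn s) a * starCoeff q (List.ofFn t) b =
      qFact q m' * qFact q n' / (qFact q m * qFact q n) * iterB q l m n φ a b := by
  subst hm hn'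
  induction l generalizing a b with
  | zero =>
    have h1 := qFact_ne_zero hn m'; have h2 := qFact_ne_zero hn n'
    have key : ∀ (s : Fin m' → Bool) (t : Fin n' → Bool),
        ∑ s', ∑ t', rowT q φ (List.ofFn s') (List.ofFn t') *
          nest (cupEps q) m' n' m' n' 0 s t s' t' = rowT q φ (List.ofFn s) (List.ofFn t) := by
      intro s t
      simp [nest_zero, ite_and]
    dsimp only [Nat.add_zero]
    simp only [key, iterB, LinearMap.id_apply]
    rw [div_self (mul_ne_zero h1 h2), one_mul]
    exact sum_rowT_mul_starCoeff hq hn _ _ φ a b ha0 ha hb0 hb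
  | succ l ih =>
    set X : (Fin (m' + l) → Bool) → (Fin (n' + l) → Bool) → F := fun s t =>
      ∑ s', ∑ t', rowT q φ (List.ofFn s') (List.ofFn t') *
        nest (cupEps q) (m' + l) (n' + l) m' n' l s t s' t' with hX
    have h1 : ∀ x y (s : Fin (m' + l) → Bool) (t : Fin (n' + l) → Bool),
        (∑ s', ∑ t', rowT q φ (List.ofFn s') (List.ofFn t') *
          nest (cupEps q) (m' + l + 1) (n' + l + 1) m' n' (l + 1) (Fin.snoc s x) (Fin.cons y t)
            s' t') = cupEps q x y * X s t := by
      intro x y s t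
      simp only [nest_succ _ _ _ _ _ _ (Nat.le_add_right m' l), hX, Finset.mul_sum]
      refine Finset.sum_congr rfl fun _ _ => Finset.sum_congr rfl fun _ _ => ?_
      ring
    set G : ℤ → ℤ → F := fun a b => ∑ s, ∑ t, X s t * starCoeff q (List.ofFn s) a *
      starCoeff q (List.ofFn t) b with hG
    have h2 : qz q ((m' + l + 1 : ℕ) - a) * (qz q b * G a (b - 1)) =
        qz q ((m' + l + 1 : ℕ) - a) * (qz q b * (qFact q m' * qFact q n' /
          (qFact q (m' + l) * qFact q (n' + l)) * iterB q l (m' + l : ℕ) (n' + l : ℕ) φ a (b - 1)))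
        := by
      rcases eq_or_ne b 0 with rfl | hb'
      · simp
      rcases eq_or_ne a (m' + l + 1 : ℕ) with rfl | ha'
      · simp
      rw [hG, ← ih a (b - 1) ha0 (by omega) (by push_cast at ha ha' ⊢; omega)
        (by push_cast at hb ⊢; omega)]
    have h3 : qz q a * (qz q ((n' + l + 1 : ℕ) - b) * G (a - 1) b) =
        qz q a * (qz q ((n' + l + 1 : ℕ) - b) * (qFact q m' * qFact q n' /
          (qFact q (m' + l) * qFact q (n' + l)) * iterB q l (m' + l : ℕ) (n' + l : ℕ) φ (a - 1) b))
        := by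
      rcases eq_or_ne a 0 with rfl | ha'
      · simp
      rcases eq_or_ne b (n' + l + 1 : ℕ) with rfl | hb'
      · simp
      rw [hG, ← ih (a - 1) b (by omega) hb0 (by push_cast at ha ⊢; omega)
        (by push_cast at hb hb' ⊢; omega)]
    rw [← add_assoc, ← add_assoc, sum_snoc]
    simp only [sum_cons (n := n' + l), h1, Fintype.sum_bool, cupEps, zero_mul,
      Finset.sum_const_zero, zero_add, add_zero, one_mul, ofFn_snoc, List.ofFn_cons,
      starCoeff_append_true hq hn, starCoeff_append_false hn, starCoeff_true_cons hn,
      starCoeff_false_cons hq hn, List.length_ofFn]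
    have h4 : ∑ s, ∑ t, -q⁻¹ * X s t *
        (qz q a / qInt q (m' + l + 1) * q ^ (a - ((m' + l : ℕ) + 1)) *
          starCoeff q (List.ofFn s) (a - 1)) *
        (qz q ((n' + l : ℕ) + 1 - b) / qInt q (n' + l + 1) * q ^ (-b) *
          starCoeff q (List.ofFn t) b) =
        -q⁻¹ * q ^ (a - ((m' + l : ℕ) + 1)) * q ^ (-b) / (qInt q (m' + l + 1) *
          qInt q (n' + l + 1)) * (qz q a * (qz q ((n' + l + 1 : ℕ) - b) * G (a - 1) b)) := by
      simp only [hG, Finset.mul_sum]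
      refine Finset.sum_congr rfl fun _ _ => Finset.sum_congr rfl fun _ _ => ?_
      push_cast
      ring
    have h5 : ∑ s, ∑ t, X s t *
        (qz q ((m' + l : ℕ) + 1 - a) / qInt q (m' + l + 1) * starCoeff q (List.ofFn s) a) *
        (qz q b / qInt q (n' + l + 1) * starCoeff q (List.ofFn t) (b - 1)) =
        1 / (qInt q (m' + l + 1) * qInt q (n' + l + 1)) *
          (qz q ((m' + l + 1 : ℕ) - a) * (qz q b * G a (b - 1))) := by
      simp only [hG, Finset.mul_sum]
      refine Finset.sum_congr rfl fun _ _ => Finset.sum_congr rfl fun _ _ => ?_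
      push_cast
      ring
    rw [h4, h5, h2, h3, iterB_succ, opB_apply, qFact_succ, qFact_succ]
    have e1 : ∀ x : ℕ, ((x + l + 1 : ℕ) : ℤ) - 1 = (x + l : ℕ) := by intro x; push_cast; ring
    have e2 : q ^ (a - (m' + l + 1 : ℕ) - b - 1) =
        q⁻¹ * q ^ (a - ((m' + l : ℕ) + 1)) * q ^ (-b) := by
      rw [← zpow_neg_one, ← zpow_add₀ hq, ← zpow_add₀ hq]; congr 1; push_cast; ring
    rw [e1, e1, e2]
    have := hn (m' + l); have := hn (n' + l)
    have := qFact_ne_zero hn (m' + l); have := qFact_ne_zero hn (n' + l)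
    field_simp
    ring

lemma arcDiagram_isRowAct (hq : q ≠ 0) (hn : ∀ n, qInt q (n + 1) ≠ 0) {m n j : ℕ}
    (hm : j ≤ m) (hn' : j ≤ n) (φ : ℤ → ℤ → F) :
    IsRowAct (arcDiagram q m n j) φ (iterA q j n φ) := by
  intro a b
  rw [arcDiagram, sum_mul_symTPair_mul]
  have h := fun s t => sum_rowT_mul_nest (q := q) (Nat.sub_add_cancel hm).symm
    (Nat.sub_add_cancel hn').symm φ s t
  change ∑ s, ∑ t, (∑ s', ∑ t', rowT q φ (List.ofFn s') (List.ofFn t') *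
    nest (capDelta q) m n (m - j) (n - j) j s' t' s t) * _ * _ = _
  simp only [h]
  exact sum_rowT_mul_starCoeff hq hn _ _ _ a b (by positivity)
    (by exact_mod_cast Nat.lt_succ_iff.1 a.2) (by positivity)
    (by exact_mod_cast Nat.lt_succ_iff.1 b.2)

lemma sum_sum_sum_sum_comm {α β γ δ : Type*} [Fintype α] [Fintype β] [Fintype γ] [Fintype δ]
    (f : α → β → γ → δ → F) :
    ∑ a, ∑ b, ∑ c, ∑ d, f a b c d = ∑ c, ∑ d, ∑ a, ∑ b, f a b c d := by
  have h := Finset.sum_comm (s := (Finset.univ : Finset (α × β)))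
    (t := (Finset.univ : Finset (γ × δ))) (f := fun x y => f x.1 x.2 y.1 y.2)
  simpa only [Fintype.sum_prod_type] using h

lemma arcCupDiagram_isRowAct (hq : q ≠ 0) (hn : ∀ n, qInt q (n + 1) ≠ 0) {m n j l : ℕ}
    (hm : j + l ≤ m) (hn' : j + l ≤ n) (φ : ℤ → ℤ → F) :
    IsRowAct (arcCupDiagram q m n j l) φ
      ((qFact q (m - j - l) * qFact q (n - j - l) / (qFact q (m - j) * qFact q (n - j))) •
        iterB q l (m - j : ℕ) (n - j : ℕ) (iterA q (j + l) n φ)) := by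
  intro a b
  rw [arcCupDiagram, Matrix.mul_assoc (symTPair q m n), sum_mul_symTPair_mul]
  have h : ∀ s t, ∑ s', ∑ t', rowT q φ (List.ofFn s') (List.ofFn t') *
      (nestedCaps q m n (m - j - l) (n - j - l) (j + l) *
        nestedCups q (m - j) (n - j) (m - j - l) (n - j - l) l) (s', t') (s, t) =
      ∑ s', ∑ t', rowT q (iterA q (j + l) n φ) (List.ofFn s') (List.ofFn t') *
        nest (cupEps q) (m - j) (n - j) (m - j - l) (n - j - l) l s t s' t' := by
    intro s t
    have h1 := fun s t => sum_rowT_mul_nest (q := q)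
      (show m = m - j - l + (j + l) by omega) (show n = n - j - l + (j + l) by omega) φ s t
    simp only [← h1, Matrix.mul_apply, Finset.mul_sum, Finset.sum_mul]
    simp only [Fintype.sum_prod_type]
    rw [sum_sum_sum_sum_comm]
    refine Finset.sum_congr rfl fun _ _ => Finset.sum_congr rfl fun _ _ =>
      Finset.sum_congr rfl fun _ _ => Finset.sum_congr rfl fun _ _ => ?_
    rw [mul_assoc]
    rfl
  simp only [h]
  exact sum_rowT_mul_nest_mul_starCoeff hq hn (by omega) (by omega) _ a b (by positivity)
    (by exact_mod_cast Nat.lt_succ_iff.1 a.2) (by positivity)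
    (by exact_mod_cast Nat.lt_succ_iff.1 b.2)

end RowActions

/-! ### The cascade operators on two sites -/

section Cascade

variable {F : Type*} [Field F] {q : F}

lemma cascadeK_natCast (m n k : ℕ) :
    cascadeK q m n k = cascadeU q (m + k) (n - k) m n * cascadeU q m n (m + k) (n - k) := by
  rw [cascadeK, show ((m : ℤ) + k).toNat = m + k by omega,
    show ((n : ℤ) - k).toNat = n - k by omega]

lemma cascadeK_neg_natCast (m n k : ℕ) :
    cascadeK q m n (-(k : ℤ)) =
      cascadeU q (m - k) (n + k) m n * cascadeU q m n (m - k) (n + k) := by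
  rw [cascadeK, show ((m : ℤ) + -(k : ℤ)).toNat = m - k by omega,
    show ((n : ℤ) - -(k : ℤ)).toNat = n + k by omega]

lemma cascadeK_isRowAct (hq : q ≠ 0) (hn : ∀ n, qInt q (n + 1) ≠ 0) {m n k : ℕ} (hk : k ≤ n)
    (φ : ℤ → ℤ → F) :
    IsRowAct (cascadeK q m n k) φ
      ((qFact q m * qFact q (n - k) / (qFact q (m + k) * qFact q n)) •
        iterE q k n (iterF q k (m + k : ℕ) (n - k : ℕ) φ)) := by
  rw [cascadeK_natCast]
  have h := (cascadeU_isRowAct_left hq hn (m := m + k) (n := n - k) (m' := m) (n' := n) rfl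
    (by omega) φ).mul
      (cascadeU_isRowAct_right hq hn (n := n) (n' := n - k) (k := k) rfl (by omega) _)
  convert h using 1
  rw [map_smul, smul_smul]
  congr 1
  ring

lemma cascadeK_neg_isRowAct (hq : q ≠ 0) (hn : ∀ n, qInt q (n + 1) ≠ 0) {m n k : ℕ} (hk : k ≤ m)
    (φ : ℤ → ℤ → F) :
    IsRowAct (cascadeK q m n (-(k : ℤ))) φ
      ((qFact q n * qFact q (m - k) / (qFact q (n + k) * qFact q m)) •
        iterF q k m n (iterE q k (n + k : ℕ) φ)) := by
  rw [cascadeK_neg_natCast]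
  have h := (cascadeU_isRowAct_right hq hn (m := m - k) (n := n + k) (m' := m) (n' := n) (k := k)
    (by omega) (by omega) φ).mul (cascadeU_isRowAct_left hq hn
      (m := m) (n := n) (m' := m - k) (n' := n + k) (k := k) (by omega) (by omega) _)
  convert h using 1
  rw [map_smul, smul_smul]
  congr 1
  ring

lemma IsRowAct.smul {m n m' n' : ℕ}
    {M : Matrix (Fin (m' + 1) × Fin (n' + 1)) (Fin (m + 1) × Fin (n + 1)) F}
    {φ ψ : ℤ → ℤ → F} (c : F) (h : IsRowAct M φ ψ) : IsRowAct (c • M) φ (c • ψ) := by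
  intro a b
  simp only [Matrix.smul_apply, Pi.smul_apply, smul_eq_mul, ← h a b, Finset.mul_sum]
  exact Finset.sum_congr rfl fun _ _ => by ring

lemma IsRowAct.sum {ι : Type*} (s : Finset ι) {m n m' n' : ℕ}
    {M : ι → Matrix (Fin (m' + 1) × Fin (n' + 1)) (Fin (m + 1) × Fin (n + 1)) F}
    {φ : ℤ → ℤ → F} {ψ : ι → ℤ → ℤ → F} (h : ∀ i ∈ s, IsRowAct (M i) φ (ψ i)) :
    IsRowAct (∑ i ∈ s, M i) φ (∑ i ∈ s, ψ i) := by
  intro a b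
  simp only [Matrix.sum_apply, Finset.sum_apply, Finset.mul_sum]
  rw [Finset.sum_comm]
  exact Finset.sum_congr rfl fun i hi => h i hi a b

lemma IsRowAct.congr {m n m' n' : ℕ}
    {M : Matrix (Fin (m' + 1) × Fin (n' + 1)) (Fin (m + 1) × Fin (n + 1)) F}
    {φ ψ ψ' : ℤ → ℤ → F} (h : IsRowAct M φ ψ)
    (e : ∀ a b : ℤ, 0 ≤ a → a ≤ m → 0 ≤ b → b ≤ n → ψ a b = ψ' a b) : IsRowAct M φ ψ' := by
  intro a b
  rw [h a b]
  exact e _ _ (by positivity) (by exact_mod_cast Nat.lt_succ_iff.1 a.2) (by positivity)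
    (by exact_mod_cast Nat.lt_succ_iff.1 b.2)

/-- The caps slide past the moved strands, and above them the cascade operator of the smaller sites
remains, up to a scalar. -/
lemma cascadeK_mul_arcDiagram_isRowAct (hq : q ≠ 0) (hn : ∀ n, qInt q (n + 1) ≠ 0) {m n k j : ℕ}
    (hm : j ≤ m) (hn' : j ≤ n) (hk : k ≤ n) (φ : ℤ → ℤ → F) :
    IsRowAct (cascadeK q m n k * arcDiagram q m n j) φ
      ((qFact q m * qFact q (n - k) / (qFact q (m + k) * qFact q n)) •
        iterE q k (n - j : ℕ) (iterF q k ((m - j : ℕ) + k) ((n - j : ℕ) - k) (iterA q j n φ))) := by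
  convert (cascadeK_isRowAct hq hn hk φ).mul (arcDiagram_isRowAct hq hn hm hn' _) using 1
  rw [map_smul, iterA_iterE hq, ← Nat.cast_sub hk, iterA_iterF hq]
  push_cast [hm, hn', hk]
  rw [sub_add_cancel]
  congr 4 <;> ring

theorem cascadeK_mul_arcDiagram (hq : q ≠ 0) (hn : ∀ n, qInt q (n + 1) ≠ 0) (m n k j : ℕ)
    (hm : j ≤ m) (hjk : j + k ≤ n) :
    cascadeK q m n k * arcDiagram q m n j = ∑ l ∈ Finset.range (min k (m - j) + 1),
      cascadeCoeff q m n k j l • arcCupDiagram q m n j l := by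
  refine eq_of_isRowAct fun φ => ⟨_, cascadeK_mul_arcDiagram_isRowAct hq hn hm (by omega)
    (by omega) φ, ?_⟩
  refine IsRowAct.congr (IsRowAct.sum _ fun l hl => (arcCupDiagram_isRowAct hq hn (l := l) ?_ ?_
    φ).smul _) ?_
  · rw [Finset.mem_range] at hl; omega
  · rw [Finset.mem_range] at hl; omega
  intro a b ha ha' hb hb'
  obtain ⟨m, rfl⟩ := Nat.exists_eq_add_of_le' hm
  obtain ⟨n, rfl⟩ := Nat.exists_eq_add_of_le' hjk
  rw [show m + j - j = m by omega, show n + (j + k) - j = n + k by omega,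
    show n + (j + k) - k = n + j by omega]
  rw [Nat.add_sub_cancel] at ha'
  rw [show ((n + k : ℕ) : ℤ) - k = n by push_cast; ring, Nat.cast_add n k, iterE_iterF hq hn]
  have h0 := qFact_ne_zero hn
  simp only [Finset.sum_apply, Pi.smul_apply, smul_eq_mul, Finset.mul_sum]
  have hsub : Finset.range (min k m + 1) ⊆ Finset.range (k + 1) := by
    rw [Finset.range_subset_range]; omega
  -- The terms with `l > m` vanish.
  rw [← Finset.sum_subset hsub]
  · refine Finset.sum_congr rfl fun l hl => ?_
    rw [Finset.mem_range] at hl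
    obtain ⟨k', rfl⟩ := Nat.exists_eq_add_of_le' (show l ≤ k by omega)
    obtain ⟨m', rfl⟩ := Nat.exists_eq_add_of_le' (show l ≤ m by omega)
    have e : ((n + (j + (k' + l)) : ℕ) : ℤ) - j = n + (k' + l : ℕ) := by push_cast; ring
    rw [iterA_add j l, e, ← mul_assoc, ← mul_assoc]
    congr 1
    simp only [cascadeCoeff, braidCoeff]
    rw [show m' + l + j + (k' + l) - j - l = m' + (k' + l) by omega,
      show n + (j + (k' + l)) - j = n + (k' + l) by omega,
      show n + (j + (k' + l)) - (k' + l) = n + j by omega,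
      show n + (k' + l) - (k' + l) = n by omega,
      show m' + l + j - j - l = m' by omega, show k' + l - l = k' by omega,
      show m' + l - l = m' by omega, show n + (k' + l) - l = n + k' by omega,
      show m' + l + (k' + l) - l = m' + (k' + l) by omega]
    have := h0 (m' + l); have := h0 (m' + l + j + (k' + l)); have := h0 (n + (j + (k' + l)))
    have := h0 l; have := h0 k'; have := h0 n; have := h0 m'; have := h0 (n + (k' + l))
    field_simp
  · intro l hl hl'
    rw [Finset.mem_range] at hl hl'
    rw [iterB_eq_zero l m _ _ (by omega) a b ha ha', mul_zero, mul_zero]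

theorem cascadeK_mul_arcDiagram_eq_zero (hq : q ≠ 0) (hn : ∀ n, qInt q (n + 1) ≠ 0)
    (m n k j : ℕ) (hm : j ≤ m) (hn' : j ≤ n) (hk : k ≤ n) (hjk : n < j + k) :
    cascadeK q m n k * arcDiagram q m n j = 0 := by
  refine eq_of_isRowAct fun φ => ⟨_, cascadeK_mul_arcDiagram_isRowAct hq hn hm hn' hk φ, ?_⟩
  refine IsRowAct.congr (ψ := 0) (fun a b => by simp) fun a b _ _ hb hb' => ?_
  rw [Pi.smul_apply, Pi.smul_apply, iterE_eq_zero k (n - j) _ (by omega) a b hb hb', smul_zero]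
  rfl

end Cascade

/-! ### Splitting off one strand of a symmetrizer -/

section Clasp

variable {F : Type*} [Field F] {q : F} {S : Type*} [DecidableEq S]

/-- The cap after the cup at the strands `x` and `y`, acting on vectors of `V(1)^{⊗ S}`. -/
def cupCap (q : F) (x y : S) (w : (S → Bool) → F) (s : S → Bool) : F :=
  capDelta q (s x) (s y) * ∑ a : Bool, ∑ c : Bool,
    cupEps q a c * w (Function.update (Function.update s x a) y c)

/-- For a block of strands `x_1, ..., x_n`, this is the sum over `i = 1, ..., n` of `[n + 1 - i]`
times the identity, if `i = 1`, or the diagram that contracts `x_{i-1}` with `x_i` and has a cap at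
`x_1`, `x_2`, if `i > 1`. -/
def clasp (q : F) : List S → ((S → Bool) → F) → (S → Bool) → F
  | [], w => w
  | [_], w => w
  | x :: y :: l, w => fun s => qInt q (l.length + 2) * w s + cupCap q x y (clasp q (y :: l) w) s

/-- The mirror image of `clasp`, for a block that is listed from right to left. -/
def claspRev (q : F) : List S → ((S → Bool) → F) → (S → Bool) → F
  | [], w => w
  | [_], w => w
  | x :: y :: l, w => fun s =>
    qInt q (l.length + 2) * w s + cupCap q y x (claspRev q (y :: l) w) s

lemma clasp_cons_cons (x y : S) (l : List S) (w : (S → Bool) → F) :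
    clasp q (x :: y :: l) w =
      fun s => qInt q (l.length + 2) * w s + cupCap q x y (clasp q (y :: l) w) s := rfl

lemma claspRev_cons_cons (x y : S) (l : List S) (w : (S → Bool) → F) :
    claspRev q (x :: y :: l) w =
      fun s => qInt q (l.length + 2) * w s + cupCap q y x (claspRev q (y :: l) w) s := rfl

lemma map_update_of_notMem {x : S} {l : List S} (h : x ∉ l) (s : S → Bool) (v : Bool) :
    l.map (Function.update s x v) = l.map s :=
  List.map_congr_left fun _ hz => Function.update_of_ne (ne_of_mem_of_not_mem hz h) _ _

/-- Flipping all arrows exchanges the two orders of the strands, up to the scalars `-q` and `-q⁻¹`,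
which cancel between the cup and the cap. -/
lemma cupCap_not (x y : S) (w : (S → Bool) → F) (s : S → Bool) :
    cupCap q y x w s = cupCap q x y (fun s' => w fun z => !s' z) fun z => !s z := by
  have h : ∀ (s : S → Bool) z v, (fun u => !(Function.update s z v u)) =
      Function.update (fun u => !s u) z !v := fun s z v => by
    funext u
    by_cases hu : u = z
    · subst hu; simp
    · simp [hu]
  by_cases hxy : x = y
  · subst hxy
    cases hs : s x <;> simp [cupCap, capDelta, hs]
  · simp only [cupCap, h, Bool.not_not, Function.update_comm hxy, Fintype.sum_bool]
    cases s x <;> cases s y <;> simp [capDelta, cupEps]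

lemma claspRev_eq (l : List S) (w : (S → Bool) → F) (s : S → Bool) :
    claspRev q l w s = clasp q l (fun s' => w fun z => !s' z) fun z => !s z := by
  induction l generalizing s with
  | nil => simp [clasp, claspRev]
  | cons x l ih =>
    cases l with
    | nil => simp [clasp, claspRev]
    | cons y l =>
      simp only [clasp_cons_cons, claspRev_cons_cons, cupCap_not x y, Bool.not_not]
      congr 3
      funext s'
      rw [ih]
      simp

variable [Fintype S]

/-- The transpose of `cupCap`. -/
lemma sum_mul_cupCap {x y : S} (hxy : x ≠ y) (Ψ w : (S → Bool) → F) :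
    ∑ s, Ψ s * cupCap q x y w s =
      ∑ s, (cupEps q (s x) (s y) *
        (Ψ (Function.update (Function.update s x true) y false) -
          q * Ψ (Function.update (Function.update s x false) y true))) * w s := by
  let e : (S → Bool) × Bool × Bool → (S → Bool) × Bool × Bool := fun p =>
    (Function.update (Function.update p.1 x p.2.1) y p.2.2, p.1 x, p.1 y)
  have he : Function.Involutive e := by
    rintro ⟨s, a, c⟩
    simp only [e, Function.update_self, Function.update_of_ne hxy, Prod.mk.injEq, and_true]
    funext z
    by_cases hz : z = y
    · simp [hz]
    · by_cases hz' : z = x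
      · subst hz'; simp [hxy]
      · simp [hz, hz']
  have h : ∀ G : (S → Bool) × Bool × Bool → F, ∑ p, G p = ∑ p, G (e p) := fun G =>
    (Equiv.sum_comp (he.toPerm e) G).symm
  have h1 := h fun p => Ψ p.1 * capDelta q (p.1 x) (p.1 y) * cupEps q p.2.1 p.2.2 *
    w (Function.update (Function.update p.1 x p.2.1) y p.2.2)
  have h2 : ∀ p : (S → Bool) × Bool × Bool,
      Function.update (Function.update (e p).1 x (e p).2.1) y (e p).2.2 = p.1 := fun p =>
    congrArg Prod.fst (he p)
  simp only [h2] at h1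
  simp only [Fintype.sum_prod_type] at h1
  refine Eq.trans ?_ (h1.trans ?_)
  · refine Finset.sum_congr rfl fun s _ => ?_
    simp only [cupCap, Finset.mul_sum]
    exact Finset.sum_congr rfl fun a _ => Finset.sum_congr rfl fun c _ => by ring
  · refine Finset.sum_congr rfl fun s _ => ?_
    simp only [e, Function.update_self, Function.update_of_ne hxy, Fintype.sum_bool, capDelta]
    ring

/-- The `q`-symmetrizer of a block is the `clasp` of the block, up to a scalar, after the
`q`-symmetrizer of the block without its first strand. -/
lemma sum_mul_clasp (hq : q ≠ 0) (x : S) (l : List S) (hl : (x :: l).Nodup)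
    (G : (S → Bool) → ℤ → F) (hG : ∀ y ∈ l, ∀ s v, G (Function.update s y v) = G s)
    (w : (S → Bool) → F) :
    ∑ s, G s (up (l.map s)) * q ^ inv (l.map s) * clasp q (x :: l) w s =
      ∑ s, q ^ inv ((x :: l).map s) *
        (qz q (up ((x :: l).map s)) * G (Function.update s x true) (up ((x :: l).map s) - 1) +
          qz q (l.length + 1 - up ((x :: l).map s)) * q ^ (-(up ((x :: l).map s) : ℤ)) *
            G (Function.update s x false) (up ((x :: l).map s))) * w s := by
  induction l generalizing x G with
  | nil =>
    refine Finset.sum_congr rfl fun s _ => ?_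
    simp only [List.map_cons, List.map_nil, up_nil, inv_nil, clasp, pow_zero, mul_one,
      List.length_nil]
    cases h : s x
    · have : Function.update s x false = s := by rw [← h, Function.update_eq_self]
      simp [this, show qz q 1 = 1 by simp [qz, qInt]]
    · have : Function.update s x true = s := by rw [← h, Function.update_eq_self]
      simp [this, show qz q 1 = 1 by simp [qz, qInt]]
  | cons y l ih =>
    obtain ⟨hx, hyl⟩ := List.nodup_cons.1 hl
    obtain ⟨hy, -⟩ := List.nodup_cons.1 hyl
    have hxy : x ≠ y := fun e => hx (e ▸ List.mem_cons_self)
    have hxl : x ∉ l := fun h => hx (List.mem_cons_of_mem _ h)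
    set G' : (S → Bool) → ℤ → F := fun s t => cupEps q (s x) (s y) *
      (G (Function.update s x true) t -
        q * q ^ (l.length - t) * G (Function.update s x false) (t + 1)) with hG'
    have hG'l : ∀ z ∈ l, ∀ s v, G' (Function.update s z v) = G' s := by
      intro z hz s v
      have h1 : z ≠ x := fun e => hxl (e ▸ hz)
      have h2 : z ≠ y := fun e => hy (e ▸ hz)
      funext t
      simp only [hG', Function.update_of_ne h1.symm, Function.update_of_ne h2.symm,
        Function.update_comm h1, hG z (List.mem_cons_of_mem _ hz)]
    have hΨ : ∀ s a c, G (Function.update (Function.update s x a) y c)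
        (up ((y :: l).map (Function.update (Function.update s x a) y c))) *
        q ^ inv ((y :: l).map (Function.update (Function.update s x a) y c)) =
        G (Function.update s x a) (up (c :: l.map s)) * q ^ inv (c :: l.map s) := by
      intro s a c
      rw [hG y List.mem_cons_self, List.map_cons, Function.update_self, map_update_of_notMem hy,
        map_update_of_notMem hxl]
    have key : ∑ s, G s (up ((y :: l).map s)) * q ^ inv ((y :: l).map s) *
        cupCap q x y (clasp q (y :: l) w) s =
        ∑ s, G' s (up (l.map s)) * q ^ inv (l.map s) * clasp q (y :: l) w s := by
      rw [sum_mul_cupCap hxy]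
      refine Finset.sum_congr rfl fun s _ => ?_
      rw [hΨ, hΨ]
      simp only [hG', up_true, up_false, inv_true, inv_false]
      have e : q ^ ((l.length : ℤ) - up (l.map s)) = q ^ dn (l.map s) := by
        rw [← zpow_natCast]
        congr 1
        have := up_add_dn (l.map s)
        rw [List.length_map] at this
        omega
      rw [e, pow_add]
      push_cast
      ring
    simp only [clasp_cons_cons, mul_add]
    rw [Finset.sum_add_distrib, key, ih y hyl G' hG'l, ← Finset.sum_add_distrib]
    refine Finset.sum_congr rfl fun s _ => ?_
    have hn : dn ((y :: l).map s) + up ((y :: l).map s) = l.length + 1 := by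
      rw [add_comm, up_add_dn]; simp
    have e1 : ∀ v, G (Function.update (Function.update s y v) x true) =
        G (Function.update s x true) := fun v => by
      rw [Function.update_comm hxy.symm, hG y List.mem_cons_self]
    have e2 : ∀ v, G (Function.update (Function.update s y v) x false) =
        G (Function.update s x false) := fun v => by
      rw [Function.update_comm hxy.symm, hG y List.mem_cons_self]
    simp only [hG', Function.update_self, Function.update_of_ne hxy, e1, e2]
    rw [List.map_cons (a := x)]
    generalize (y :: l).map s = m at hn
    obtain ⟨N, hN⟩ : ∃ N : ℤ, (l.length : ℤ) = N := ⟨_, rfl⟩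
    have hd : ((dn m : ℕ) : ℤ) = N + 1 - up m := by rw [← hN]; omega
    have e3 : qInt q (l.length + 2) = qz q (N + 2) := by
      rw [← qz_natCast]; congr 1; push_cast; rw [hN]
    simp only [List.length_cons, Nat.cast_add, hN, Nat.cast_one, e3]
    obtain ⟨b, hb⟩ : ∃ b : ℤ, (up m : ℤ) = b := ⟨_, rfl⟩
    rw [hb] at hd ⊢
    cases hsx : s x
    · have hs : Function.update s x false = s := by rw [← hsx, Function.update_eq_self]
      have h1 : qz q (N + 2) = q ^ (N + 2 - b) * qz q b + q ^ (-b) * qz q (N + 1 + 1 - b) := by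
        have h := qz_add hq b (N + 2 - b)
        rw [show b + (N + 2 - b) = N + 2 by ring] at h
        rw [h]; ring_nf
      have h2 : q ^ (N + 2 - b) = q * q ^ (N - (b - 1)) := by
        nth_rewrite 2 [← zpow_one q]
        rw [← zpow_add₀ hq]; congr 1; ring
      simp only [up_false, inv_false, hb, hs, cupEps, sub_add_cancel]
      rw [h1, h2]
      ring
    · have hs : Function.update s x true = s := by rw [← hsx, Function.update_eq_self]
      have h1 : qz q (N + 2) = q ^ (N + 1 - b) * qz q (b + 1) +
          q⁻¹ * q ^ (-b) * qz q (N + 1 - b) := by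
        have h := qz_add hq (b + 1) (N + 1 - b)
        rw [show b + 1 + (N + 1 - b) = N + 2 by ring] at h
        rw [h, neg_add, zpow_add₀ hq, zpow_neg_one]; ring
      have h2 : q ^ (N + 1 - b) = q * q ^ (N - b) := by
        nth_rewrite 2 [← zpow_one q]
        rw [← zpow_add₀ hq]; congr 1; ring
      have h3 : q ^ (-(b + 1)) = q⁻¹ * q ^ (-b) := by
        rw [neg_add, zpow_add₀ hq, zpow_neg_one]; ring
      simp only [up_true, inv_true, Nat.cast_add, Nat.cast_one, hb, hs, cupEps,
        add_sub_cancel_right, pow_add]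
      rw [← zpow_natCast q (dn m), hd, h1, h3, h2, show N + 1 + 1 - (b + 1) = N + 1 - b by ring]
      ring

lemma sum_not (f : (S → Bool) → F) : ∑ s, f s = ∑ s : S → Bool, f fun z => !s z := by
  have h : Function.Involutive fun (s : S → Bool) (z : S) => !s z := fun s => by simp
  exact (Equiv.sum_comp (h.toPerm _) f).symm

lemma up_map_not (l : List Bool) : up (l.map (!·)) = dn l := by
  induction l with
  | nil => rfl
  | cons x l ih => cases x <;> simp [ih]

lemma dn_map_not (l : List Bool) : dn (l.map (!·)) = up l := by
  induction l with
  | nil => rfl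
  | cons x l ih => cases x <;> simp [ih]

lemma inv_map_not (l : List Bool) : inv (l.map (!·)) = coinv l := by
  induction l with
  | nil => rfl
  | cons x l ih => cases x <;> simp [ih, dn_map_not]

/-- The mirror image of `sum_mul_clasp`. -/
lemma sum_mul_claspRev (hq : q ≠ 0) (x : S) (l : List S) (hl : (x :: l).Nodup)
    (G : (S → Bool) → ℤ → F) (hG : ∀ y ∈ l, ∀ s v, G (Function.update s y v) = G s)
    (w : (S → Bool) → F) :
    ∑ s, G s (up (l.map s)) * q ^ coinv (l.map s) * claspRev q (x :: l) w s =
      ∑ s, q ^ coinv ((x :: l).map s) *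
        (qz q (up ((x :: l).map s)) * q ^ ((up ((x :: l).map s) : ℤ) - (l.length + 1)) *
            G (Function.update s x true) (up ((x :: l).map s) - 1) +
          qz q (l.length + 1 - up ((x :: l).map s)) *
            G (Function.update s x false) (up ((x :: l).map s))) * w s := by
  have hmap : ∀ (l : List S) (s : S → Bool), l.map (fun z => !s z) = (l.map s).map (!·) := by
    intro l s; simp
  have hupd : ∀ (s : S → Bool) z v, (fun u => !(Function.update s z v u)) =
      Function.update (fun u => !s u) z !v := fun s z v => by
    funext u
    by_cases hu : u = z
    · subst hu; simp
    · simp [hu]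
  have h := sum_mul_clasp hq x l hl (fun s t => G (fun z => !s z) (l.length - t))
    (fun y hy s v => by simp only [hupd, hG y hy]) (fun s' => w fun z => !s' z)
  rw [sum_not, sum_not (fun s => q ^ inv _ * _ * _)] at h
  simp only [hmap, up_map_not, inv_map_not, ← claspRev_eq, Bool.not_not, hupd, Bool.not_true,
    Bool.not_false] at h
  have hd : ∀ (l : List S) (s : S → Bool), ((dn (l.map s) : ℕ) : ℤ) = l.length - up (l.map s) := by
    intro l s
    have := up_add_dn (l.map s)
    rw [List.length_map] at this
    omega
  simp only [hd, List.length_cons, Nat.cast_add, Nat.cast_one, sub_sub_cancel] at h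
  rw [h]
  refine Finset.sum_congr rfl fun s _ => ?_
  generalize ((up ((x :: l).map s) : ℕ) : ℤ) = a
  rw [show (l.length : ℤ) - (l.length + 1 - a - 1) = a by ring,
    show (l.length : ℤ) - (l.length + 1 - a) = a - 1 by ring, neg_sub]
  ring

end Clasp

/-! ### Contraction of cap diagrams -/

section Contraction

variable {S : Type*} [LinearOrder S]

namespace CapDiagram

/-- The partners after the strands `x` and `y` have been joined by a cup and a new cap has been
put at `x` and `y`: the former partners of `x` and `y` become partners, and if one of `x`, `y`
carries a through line, then this line ends at the former partner of the other one. -/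
def contractFun (D : CapDiagram S) (x y c : S) : S :=
  if c = x then y else if c = y then x
  else if c = D.partner x then (if D.partner y = y then c else D.partner y)
  else if c = D.partner y then (if D.partner x = x then c else D.partner x)
  else D.partner c

lemma contractFun_contractFun (D : CapDiagram S) {x y : S} (hxy : x < y)
    (hne : D.partner x ≠ y) (c : S) : D.contractFun x y (D.contractFun x y c) = c := by
  have h1 := D.involutive
  have h2 := D.involutive x
  have h3 := D.involutive y
  have h4 := D.involutive c
  simp only [contractFun]
  grind

lemma contractFun_through (D : CapDiagram S) {x y : S} (hxy : x < y) (cov : ∀ c, c ≤ x ∨ y ≤ c)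
    (a b : S) (h : D.contractFun x y b = b) :
    ¬ (a < b ∧ b < D.contractFun x y a) := by
  have h1 := D.involutive
  have h2 := D.noncrossing
  have h3 := D.through
  have ca := cov a; have cb := cov b; have cx := cov (D.partner x); have cy := cov (D.partner y)
  have cpa := cov (D.partner a); have cpb := cov (D.partner b)
  have t1 := h3 x b; have t2 := h3 y b; have t3 := h3 (D.partner x) b
  have t4 := h3 (D.partner y) b; have t5 := h3 a b; have t6 := h3 a x; have t7 := h3 a y
  clear cov
  simp only [contractFun] at *
  grind (splits := 30)

lemma contractFun_noncrossing (D : CapDiagram S) {x y : S} (hxy : x < y)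
    (cov : ∀ c, c ≤ x ∨ y ≤ c) (a b : S) :
    ¬ (a < b ∧ b < D.contractFun x y a ∧ D.contractFun x y a < D.contractFun x y b) := by
  have h1 := D.involutive
  have h2 := D.noncrossing
  have h3 := D.through
  have ca := cov a; have cb := cov b; have cx := cov (D.partner x); have cy := cov (D.partner y)
  have cpa := cov (D.partner a); have cpb := cov (D.partner b)
  clear cov
  simp only [contractFun] at *
  grind (splits := 30)

/-- The cap diagram obtained by the cup-cap at neighbouring strands `x`, `y` that are not joined by
an arc. -/
def contract (D : CapDiagram S) (x y : S) (hxy : x < y) (cov : ∀ c, c ≤ x ∨ y ≤ c)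
    (hne : D.partner x ≠ y) : CapDiagram S where
  partner := D.contractFun x y
  involutive := D.contractFun_contractFun hxy hne
  noncrossing := D.contractFun_noncrossing hxy cov
  through a b := D.contractFun_through hxy cov a b

/-- The arrows on the through lines of the contracted diagram. -/
def contractArrows (D : CapDiagram S) (t : S → Bool) (x y c : S) : Bool :=
  if c = D.partner x then t y else if c = D.partner y then t x else t c

/-- All down arrows on through lines are to the left of all up arrows. -/
def Admissible (D : CapDiagram S) (t : S → Bool) : Prop :=
  ∀ a b, D.partner a = a → D.partner b = b → a < b → t a ≤ t b

lemma Admissible.contract {D : CapDiagram S} {t : S → Bool} (h : D.Admissible t) {x y : S}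
    (hxy : x < y) (cov : ∀ c, c ≤ x ∨ y ≤ c) (hne : D.partner x ≠ y) :
    (D.contract x y hxy cov hne).Admissible (D.contractArrows t x y) := by
  intro a b
  have h' : ∀ a b, D.partner a = a → D.partner b = b → a < b → t a = true → t b = true :=
    fun a b ha hb hab => Bool.le_iff_imp.1 (h a b ha hb hab)
  rw [Bool.le_iff_imp]
  change D.contractFun x y a = a → D.contractFun x y b = b → _
  have h1 := D.involutive
  have h3 := D.through
  have ca := cov a; have cb := cov b; have cx := cov (D.partner x); have cy := cov (D.partner y)
  have t1 := h3 x b; have t2 := h3 y b; have t3 := h3 (D.partner x) b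
  have t4 := h3 (D.partner y) b; have t5 := h3 x a; have t6 := h3 y a
  have t7 := h3 (D.partner x) a; have t8 := h3 (D.partner y) a
  have m1 := h' a b; have m2 := h' x b; have m3 := h' a x; have m4 := h' y b; have m5 := h' a y
  clear cov h h'
  simp only [contractFun, contractArrows]
  grind (splits := 30)

end CapDiagram

variable {F : Type*} [Field F] {q : F}

/-- The factor of the strand `c` in the coefficient of a cap diagram. -/
def capFactor (q : F) (D : CapDiagram S) (t s : S → Bool) (c : S) : F :=
  if c < D.partner c then capDelta q (s c) (s (D.partner c))
  else if D.partner c = c then (if s c = t c then 1 else 0) else 1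

lemma capCoeff_eq_mul [Fintype S] (D : CapDiagram S) (t s : S → Bool) (Q : Finset S) :
    capCoeff q D t s = (∏ c ∈ Q, capFactor q D t s c) * ∏ c ∈ Qᶜ, capFactor q D t s c :=
  (Finset.prod_mul_prod_compl _ _).symm

/-- A cup-cap at neighbouring strands that are not joined by an arc maps the vector of a cap
diagram to zero or to the vector of a cap diagram. -/
lemma cupCap_capCoeff (hq : q ≠ 0) [Fintype S] {D : CapDiagram S} {t : S → Bool}
    (h : D.Admissible t) {x y : S} (hxy : x < y) (cov : ∀ c, c ≤ x ∨ y ≤ c)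
    (hne : D.partner x ≠ y) :
    cupCap q x y (capCoeff q D t) = 0 ∨ cupCap q x y (capCoeff q D t) =
      capCoeff q (D.contract x y hxy cov hne) (D.contractArrows t x y) := by
  classical
  set D' := D.contract x y hxy cov hne with hD'
  set t' := D.contractArrows t x y with ht'
  set Q : Finset S := {x, y, D.partner x, D.partner y} with hQ
  have hne' : D.partner y ≠ x := fun e => hne (by rw [← e, D.involutive])
  have hnotQ : ∀ c ∈ Qᶜ, c ≠ x ∧ c ≠ y ∧ c ≠ D.partner x ∧ c ≠ D.partner y ∧
      D.partner c ≠ x ∧ D.partner c ≠ y := by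
    intro c hc
    simp only [hQ, Finset.mem_compl, Finset.mem_insert, Finset.mem_singleton, not_or] at hc
    exact ⟨hc.1, hc.2.1, hc.2.2.1, hc.2.2.2, fun e => hc.2.2.1 (by rw [← e, D.involutive]),
      fun e => hc.2.2.2 (by rw [← e, D.involutive])⟩
  have hrest : ∀ s a c, ∏ z ∈ Qᶜ, capFactor q D t
      (Function.update (Function.update s x a) y c) z = ∏ z ∈ Qᶜ, capFactor q D t s z := by
    intro s a c
    refine Finset.prod_congr rfl fun z hz => ?_
    obtain ⟨h1, h2, -, -, h3, h4⟩ := hnotQ z hz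
    simp only [capFactor, Function.update_of_ne h1, Function.update_of_ne h2,
      Function.update_of_ne h3, Function.update_of_ne h4]
  have hrest' : ∀ s, ∏ z ∈ Qᶜ, capFactor q D' t' s z = ∏ z ∈ Qᶜ, capFactor q D t s z := by
    intro s
    refine Finset.prod_congr rfl fun z hz => ?_
    obtain ⟨h1, h2, h3, h4, -, -⟩ := hnotQ z hz
    have e1 : D'.partner z = D.partner z := by
      simp only [hD', CapDiagram.contract, CapDiagram.contractFun, if_neg h1, if_neg h2, if_neg h3,
        if_neg h4]
    have e2 : t' z = t z := by
      simp only [ht', CapDiagram.contractArrows, if_neg h3, if_neg h4]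
    simp only [capFactor, e1, e2]
  have key : ∀ s, cupCap q x y (capCoeff q D t) s = (capDelta q (s x) (s y) *
      ∑ a : Bool, ∑ c : Bool, cupEps q a c * ∏ z ∈ Q, capFactor q D t
        (Function.update (Function.update s x a) y c) z) * ∏ z ∈ Qᶜ, capFactor q D t s z := by
    intro s
    simp only [cupCap, capCoeff_eq_mul D t _ Q, hrest, mul_assoc, Finset.sum_mul]
  have key' : ∀ s, capCoeff q D' t' s =
      (∏ z ∈ Q, capFactor q D' t' s z) * ∏ z ∈ Qᶜ, capFactor q D t s z := by
    intro s
    rw [capCoeff_eq_mul D' t' s Q, hrest']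
  suffices (∀ s, capDelta q (s x) (s y) * (∑ a : Bool, ∑ c : Bool, cupEps q a c *
      ∏ z ∈ Q, capFactor q D t (Function.update (Function.update s x a) y c) z) = 0) ∨
      ∀ s, capDelta q (s x) (s y) * (∑ a : Bool, ∑ c : Bool, cupEps q a c *
      ∏ z ∈ Q, capFactor q D t (Function.update (Function.update s x a) y c) z) =
      ∏ z ∈ Q, capFactor q D' t' s z by
    rcases this with H | H
    · left; funext s; rw [key, H, zero_mul]; rfl
    · right; funext s; rw [key, key', H]
  have hx := D.involutive x
  have hy := D.involutive y
  have hD'p : ∀ c, D'.partner c = D.contractFun x y c := fun c => rfl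
  obtain ⟨u, hu⟩ : ∃ u, D.partner x = u := ⟨_, rfl⟩
  obtain ⟨v, hv⟩ : ∃ v, D.partner y = v := ⟨_, rfl⟩
  have htp : ∀ c, t' c = if c = u then t y else if c = v then t x else t c := by
    intro c; rw [← hu, ← hv]; rfl
  have hp : ∀ c, D'.partner c = if c = x then y else if c = y then x
      else if c = u then (if v = y then c else v)
      else if c = v then (if u = x then c else u) else D.partner c := by
    intro c; rw [← hu, ← hv]; rfl
  have p1 : D'.partner x = y := by rw [hp, if_pos rfl]
  have p2 : D'.partner y = x := by rw [hp, if_neg hxy.ne', if_pos rfl]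
  rw [hu] at hx hne
  rw [hv] at hy hne'
  have hQ' : Q = {x, y, u, v} := by rw [hQ, hu, hv]
  have hcu := cov u
  have hcv := cov v
  rw [hQ']
  clear hQ' hQ key key' hrest hrest' hnotQ
  by_cases hxu : u = x
  · have hx' : D.partner x = x := hu.trans hxu
    rw [hxu] at htp hp ⊢
    by_cases hyv : v = y
    · -- both strands carry through lines
      have hy' : D.partner y = y := hv.trans hyv
      have hle := h x y hx' hy' hxy
      rw [hyv] at htp ⊢
      have hQ2 : ({x, y, x, y} : Finset S) = {x, y} := by ext; simp
      rw [hQ2]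
      by_cases htt : t x = t y
      · left
        intro s
        simp only [Finset.prod_pair hxy.ne, capFactor, hx', hy', lt_self_iff_false, if_false,
          if_true, Function.update_self, Function.update_of_ne hxy.ne, Fintype.sum_bool]
        cases h1 : t y <;> simp [htt, h1, cupEps]
      · right
        intro s
        have h1 : t x = false ∧ t y = true := by
          cases h1 : t x <;> cases h2 : t y
          · exact absurd (h1.trans h2.symm) htt
          · exact ⟨rfl, rfl⟩
          · rw [h1, h2] at hle; exact absurd hle (by decide)
          · exact absurd (h1.trans h2.symm) htt
        simp only [Finset.prod_pair hxy.ne, capFactor, hx', hy', p1, p2, lt_self_iff_false,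
          if_false, if_true, Function.update_self, Function.update_of_ne hxy.ne, Fintype.sum_bool,
          hxy.ne', hxy.ne, hxy, hxy.not_gt, h1.1, h1.2]
        simp [cupEps]
    · -- the through line of `x` moves to the former partner of `y`
      have hthr := D.through v x hx'
      rw [hy] at hthr
      have hyv' : y < v := by
        rcases hcv with h | h
        · exact absurd ⟨lt_of_le_of_ne h hne', hxy⟩ hthr
        · exact lt_of_le_of_ne h (Ne.symm hyv)
      have hxv := hxy.trans hyv'
      have p3 : D'.partner v = v := by
        rw [hp, if_neg hxv.ne', if_neg hyv, if_neg hxv.ne', if_pos rfl, if_pos rfl]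
      have ht3 : t' v = t x := by rw [htp, if_neg hxv.ne', if_pos rfl]
      have hQ2 : ({x, y, x, v} : Finset S) = {x, y, v} := by ext; simp; tauto
      right
      intro s
      rw [hQ2, Finset.prod_insert (by simp [hxy.ne, hxv.ne]), Finset.prod_pair hyv'.ne]
      simp_rw [Finset.prod_insert (show x ∉ ({y, v} : Finset S) by simp [hxy.ne, hxv.ne]),
        Finset.prod_pair hyv'.ne]
      simp only [capFactor, hx', hv, hy, p1, p2, p3, ht3, lt_self_iff_false, if_false, if_true,
        Function.update_self, Function.update_of_ne hxy.ne, Function.update_of_ne hxv.ne',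
        Function.update_of_ne hyv'.ne', Fintype.sum_bool, hxy.ne', hxy.ne, hxy, hxy.not_gt, hyv',
        hyv'.not_gt, hyv'.ne, hyv'.ne']
      cases s x <;> cases s y <;> cases s v <;> cases t x <;> simp [capDelta, cupEps, hq]
  · by_cases hyv : v = y
    · -- the through line of `y` moves to the former partner of `x`
      have hy' : D.partner y = y := hv.trans hyv
      have hthr := D.through x y hy'
      rw [hu] at hthr
      have hux : u < x := by
        rcases hcu with h | h
        · exact lt_of_le_of_ne h hxu
        · exact absurd ⟨hxy, lt_of_le_of_ne h (Ne.symm hne)⟩ hthr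
      have huy := hux.trans hxy
      rw [hyv] at htp hp ⊢
      have p3 : D'.partner u = u := by
        rw [hp, if_neg hux.ne, if_neg huy.ne, if_pos rfl, if_pos rfl]
      have ht3 : t' u = t y := by rw [htp, if_pos rfl]
      have hQ2 : ({x, y, u, y} : Finset S) = {u, x, y} := by ext; simp; tauto
      right
      intro s
      rw [hQ2]
      simp_rw [Finset.prod_insert (show u ∉ ({x, y} : Finset S) by simp [hux.ne, huy.ne]),
        Finset.prod_pair hxy.ne]
      simp only [capFactor, hx, hu, hy', p1, p2, p3, ht3, lt_self_iff_false, if_false, if_true,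
        Function.update_self, Function.update_of_ne hxy.ne, Function.update_of_ne hux.ne,
        Function.update_of_ne huy.ne, Fintype.sum_bool, hxy.ne', hxy.ne, hxy, hxy.not_gt, hux,
        hux.not_gt, hux.ne, hux.ne']
      cases s x <;> cases s y <;> cases s u <;> cases t y <;> simp [capDelta, cupEps, hq]
    · -- the former partners of `x` and `y` become partners
      right
      have hvx : v ≠ x := hne'
      have huy : u ≠ y := hne
      have huv : u ≠ v := fun e => hxy.ne (by rw [← hx, ← hy, e])
      have p3 : D'.partner u = v := by rw [hp, if_neg hxu, if_neg huy, if_pos rfl, if_neg hyv]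
      have p4 : D'.partner v = u := by
        rw [hp, if_neg hvx, if_neg hyv, if_neg huv.symm, if_pos rfl, if_neg hxu]
      have hQ3 : ∀ f : S → F, ∏ z ∈ ({x, y, u, v} : Finset S), f z =
          f x * (f y * (f u * f v)) := by
        intro f
        rw [Finset.prod_insert (by simp [hxy.ne, Ne.symm hxu, hvx.symm]),
          Finset.prod_insert (by simp [huy.symm, Ne.symm hyv]), Finset.prod_pair huv]
      intro s
      have n1 := D.noncrossing x y
      have n2 := D.noncrossing u v
      have n3 := D.noncrossing v x
      rw [hu, hv] at n1
      rw [hx, hy] at n2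
      rw [hy, hu] at n3
      simp_rw [hQ3]
      simp only [capFactor, hx, hu, hv, hy, p1, p2, p3, p4, if_true,
        Function.update_self, Function.update_of_ne hxy.ne, Function.update_of_ne hxu,
        Function.update_of_ne huy, Function.update_of_ne hvx, Function.update_of_ne hyv,
        Fintype.sum_bool, hxy.ne', hxy.ne, hxy, hxy.not_gt, if_false, hxu, hyv, huv,
        huv.symm, Ne.symm hxu, Ne.symm hyv]
      rcases hcu with hcu | hcu <;> rcases hcv with hcv | hcv
      · have hux := lt_of_le_of_ne hcu hxu
        have hvy := (lt_of_le_of_ne hcv hvx).trans hxy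
        have hvu : v < u := lt_of_le_of_ne (not_lt.1 fun hlt => n2 ⟨hlt, lt_of_le_of_ne hcv hvx,
          hxy⟩) huv.symm
        simp only [hux, hux.not_gt, hvy, hvy.not_gt, hvu, hvu.not_gt, if_true, if_false]
        cases s x <;> cases s y <;> cases s u <;> cases s v <;> simp [capDelta, cupEps, hq]
      · have hux := lt_of_le_of_ne hcu hxu
        have hyv' := lt_of_le_of_ne hcv (Ne.symm hyv)
        have huv' := (hux.trans hxy).trans hyv'
        simp only [hux, hux.not_gt, hyv', hyv'.not_gt, huv', huv'.not_gt, if_true, if_false]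
        cases s x <;> cases s y <;> cases s u <;> cases s v <;> simp [capDelta, cupEps, hq]
      · exact absurd ⟨lt_of_le_of_ne hcv hvx, hxy, lt_of_le_of_ne hcu huy.symm⟩ n3
      · have hyv' := lt_of_le_of_ne hcv (Ne.symm hyv)
        have hxu' := hxy.trans (lt_of_le_of_ne hcu huy.symm)
        have hvu : v < u := lt_of_le_of_ne (not_lt.1 fun hlt => n1 ⟨hxy,
          lt_of_le_of_ne hcu huy.symm, hlt⟩) huv.symm
        simp only [hxu', hxu'.not_gt, hyv', hyv'.not_gt, hvu, hvu.not_gt, if_true, if_false]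
        cases s x <;> cases s y <;> cases s u <;> cases s v <;> simp [capDelta, cupEps, hq]

end Contraction

/-! ### The cone of cap diagrams -/

section Moving

open scoped NNReal

section Linearity

variable {S : Type*} [DecidableEq S] {F : Type*} [Field F] {q : F}

lemma cupCap_add (x y : S) (v w : (S → Bool) → F) :
    cupCap q x y (v + w) = cupCap q x y v + cupCap q x y w := by
  funext s
  simp only [cupCap, Pi.add_apply, mul_add, Finset.sum_add_distrib]

lemma cupCap_zero (x y : S) :
    cupCap q x y (0 : (S → Bool) → F) = 0 := by
  funext s
  simp [cupCap]

lemma cupCap_smul (q : ℂ) (x y : S) (c : ℝ≥0) (w : (S → Bool) → ℂ) :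
    cupCap q x y (c • w) = c • cupCap q x y w := by
  funext s
  simp only [cupCap, Pi.smul_apply, NNReal.smul_def, Complex.real_smul, Finset.mul_sum]
  exact Finset.sum_congr rfl fun a _ => Finset.sum_congr rfl fun c _ => by ring

end Linearity

variable {S : Type*} [LinearOrder S] [Fintype S]

section Field

variable {F : Type*} [Field F] {q : F}

/-- The vector of a cap diagram with an arc at `x`, `y` is killed by every functional that
symmetrizes `x` and `y`. -/
lemma sum_mul_capCoeff_eq_zero {D : CapDiagram S} (t : S → Bool) {x y : S}
    (hxy : x < y) (h : D.partner x = y) (Ψ : (S → Bool) → F)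
    (hΨ : ∀ s, Ψ (Function.update (Function.update s x true) y false) =
      q * Ψ (Function.update (Function.update s x false) y true)) :
    ∑ s, Ψ s * capCoeff q D t s = 0 := by
  have h' : D.partner y = x := by rw [← h, D.involutive]
  set R : (S → Bool) → F := fun s => ∏ c ∈ ({x, y} : Finset S)ᶜ, capFactor q D t s c with hR
  have hw : capCoeff q D t = cupCap q x y fun s =>
      if s x = false ∧ s y = true then R s else 0 := by
    funext s
    have hRs : ∀ a c, R (Function.update (Function.update s x a) y c) = R s := by
      intro a c
      refine Finset.prod_congr rfl fun z hz => ?_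
      simp only [Finset.mem_compl, Finset.mem_insert, Finset.mem_singleton, not_or] at hz
      have h1 : D.partner z ≠ x := fun e => hz.2 (by rw [← h, ← e, D.involutive])
      have h2 : D.partner z ≠ y := fun e => hz.1 (by rw [← h', ← e, D.involutive])
      simp only [capFactor, Function.update_of_ne hz.1, Function.update_of_ne hz.2,
        Function.update_of_ne h1, Function.update_of_ne h2]
    rw [capCoeff_eq_mul D t s {x, y}, Finset.prod_pair hxy.ne]
    simp only [cupCap, hRs, Fintype.sum_bool, Function.update_self, Function.update_of_ne hxy.ne]
    simp [capFactor, h, h', hxy, hxy.not_gt, hxy.ne, cupEps, hR]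
  rw [hw, sum_mul_cupCap hxy.ne]
  refine Finset.sum_eq_zero fun s _ => ?_
  rw [hΨ, sub_self, mul_zero, zero_mul]

/-- The functionals `q^{inv}` on a block of strands kill the vector of a cap diagram with an arc
between two neighbouring strands of this block. -/
lemma sum_mul_inv_mul_capCoeff_eq_zero {D : CapDiagram S} (t : S → Bool)
    {B : List S} (hB : B.IsChain (· ⋖ ·)) (hD : ¬ B.IsChain fun a b => D.partner a ≠ b)
    (G : (S → Bool) → ℤ → F) (hG : ∀ y ∈ B, ∀ s v, G (Function.update s y v) = G s) :
    ∑ s, G s (up (B.map s)) * q ^ inv (B.map s) * capCoeff q D t s = 0 := by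
  rw [List.isChain_iff_forall_rel_of_append_cons_cons] at hD
  push Not at hD
  obtain ⟨x, y, l₁, l₂, rfl, hp⟩ := hD
  have hxy : x < y := (List.isChain_iff_forall_rel_of_append_cons_cons.1 hB rfl).lt
  have hnd : (l₁ ++ x :: y :: l₂).Nodup :=
    (List.isChain_iff_pairwise.1 (hB.imp fun _ _ h => h.lt)).imp fun h => h.ne
  simp only [List.nodup_append, List.nodup_cons, List.mem_cons, not_or] at hnd
  obtain ⟨-, ⟨⟨-, hx2⟩, hy2, -⟩, h1⟩ := hnd
  have hx1 : x ∉ l₁ := fun h => h1 x h x (Or.inl rfl) rfl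
  have hy1 : y ∉ l₁ := fun h => h1 y h y (Or.inr (Or.inl rfl)) rfl
  refine sum_mul_capCoeff_eq_zero t hxy hp _ fun s => ?_
  simp only [List.map_append, List.map_cons, map_update_of_notMem hx1, map_update_of_notMem hy1,
    map_update_of_notMem hx2, map_update_of_notMem hy2, Function.update_self,
    Function.update_of_ne hxy.ne, hG x (by simp), hG y (by simp), up_append, inv_append, up_true,
    up_false, inv_true, inv_false, dn_true, dn_false, pow_add]
  ring

end Field

variable {q : ℝ}

/-- The cone of the non-negative real combinations of the vectors of admissible cap diagrams. -/
noncomputable def capCone (q : ℝ) (S : Type*) [LinearOrder S] [Fintype S] :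
    Submodule ℝ≥0 ((S → Bool) → ℂ) :=
  Submodule.span ℝ≥0 {w | ∃ (D : CapDiagram S) (t : S → Bool),
    D.Admissible t ∧ w = capCoeff (q : ℂ) D t}

/-- The quantum integers are non-negative. -/
lemma qInt_ofReal (hq : 0 < q) (n : ℕ) : ∃ c : ℝ≥0, qInt (q : ℂ) n = ((c : ℝ) : ℂ) := by
  refine ⟨⟨qInt q n, Finset.sum_nonneg fun i _ => (zpow_pos hq _).le⟩, ?_⟩
  change qInt (q : ℂ) n = ((qInt q n : ℝ) : ℂ)
  simp [qInt]

lemma qInt_ne_zero (hq : 0 < q) (n : ℕ) : qInt (q : ℂ) (n + 1) ≠ 0 := by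
  have h : 0 < qInt q (n + 1) :=
    Finset.sum_pos (fun i _ => zpow_pos hq _) (Finset.nonempty_range_iff.2 (Nat.succ_ne_zero n))
  have h' : qInt (q : ℂ) (n + 1) = ((qInt q (n + 1) : ℝ) : ℂ) := by simp [qInt]
  rw [h']
  exact_mod_cast h.ne'

lemma qFact_ofReal (hq : 0 < q) (n : ℕ) : ∃ c : ℝ≥0, qFact (q : ℂ) n = ((c : ℝ) : ℂ) := by
  choose f hf using qInt_ofReal hq
  exact ⟨∏ i ∈ Finset.range n, f (i + 1), by simp [qFact, hf]⟩

/-- A cup-cap at `x`, `y` maps non-negative combinations of vectors of diagrams that do not join `x`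
and `y` to non-negative combinations of vectors of diagrams that do. -/
lemma cupCap_mem_span (hq : 0 < q) {x y : S} (hxy : x ⋖ y) {A A' : Set ((S → Bool) → ℂ)}
    (hA : ∀ w ∈ A, ∃ (D : CapDiagram S) (t : S → Bool), D.Admissible t ∧ D.partner x ≠ y ∧
      w = capCoeff (q : ℂ) D t)
    (hA' : ∀ (D : CapDiagram S) (t : S → Bool), D.Admissible t → D.partner x = y →
      capCoeff (q : ℂ) D t ∈ A') {w : (S → Bool) → ℂ} (hw : w ∈ Submodule.span ℝ≥0 A) :
    cupCap (q : ℂ) x y w ∈ Submodule.span ℝ≥0 A' := by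
  induction hw using Submodule.span_induction with
  | mem w hw =>
    obtain ⟨D, t, hD, hne, rfl⟩ := hA w hw
    have cov : ∀ c, c ≤ x ∨ y ≤ c := fun c => by
      by_contra! h
      exact hxy.2 h.1 h.2
    rcases cupCap_capCoeff (q := (q : ℂ)) (by exact_mod_cast hq.ne') hD hxy.lt cov hne with h | h
    · rw [h]; exact zero_mem _
    · rw [h]
      refine Submodule.subset_span (hA' _ _ (hD.contract hxy.lt cov hne) ?_)
      change D.contractFun x y x = y
      simp [CapDiagram.contractFun]
  | zero => rw [cupCap_zero]; exact zero_mem _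
  | add v w _ _ hv hw => rw [cupCap_add]; exact add_mem hv hw
  | smul c w _ hw => rw [cupCap_smul]; exact Submodule.smul_mem _ c hw

/-- The vector of a cap diagram without arcs between neighbouring strands of a block is mapped into
the cone by `clasp`. In the new diagrams, the first strand `x` of the block is a left leg; so it can
not be joined to the strand to the left of `x`, where the next cup-cap acts. -/
lemma clasp_capCoeff_mem (hq : 0 < q) {D : CapDiagram S} {t : S → Bool} (hD : D.Admissible t)
    (x : S) (l : List S) (hl : (x :: l).IsChain (· ⋖ ·))
    (hne : (x :: l).IsChain fun a b => D.partner a ≠ b) :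
    clasp (q : ℂ) (x :: l) (capCoeff (q : ℂ) D t) ∈ Submodule.span ℝ≥0
      {w | ∃ (D' : CapDiagram S) (t' : S → Bool), D'.Admissible t' ∧
        (D' = D ∨ x < D'.partner x) ∧ w = capCoeff (q : ℂ) D' t'} := by
  induction l generalizing x with
  | nil => exact Submodule.subset_span ⟨D, t, hD, Or.inl rfl, rfl⟩
  | cons y l ih =>
    rw [List.isChain_cons_cons] at hl hne
    refine add_mem (a := fun s => qInt (q : ℂ) (l.length + 2) * capCoeff (q : ℂ) D t s) ?_ ?_
    · obtain ⟨c, hc⟩ := qInt_ofReal hq (l.length + 2)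
      have : (fun s => qInt (q : ℂ) (l.length + 2) * capCoeff (q : ℂ) D t s) =
          c • capCoeff (q : ℂ) D t := by
        funext s
        rw [Pi.smul_apply, hc, NNReal.smul_def, Complex.real_smul]
      rw [this]
      exact Submodule.smul_mem _ c (Submodule.subset_span ⟨D, t, hD, Or.inl rfl, rfl⟩)
    · refine cupCap_mem_span hq hl.1 ?_ ?_ (ih y hl.2 hne.2)
      · rintro w ⟨D', t', hD', h, rfl⟩
        refine ⟨D', t', hD', ?_, rfl⟩
        rcases h with rfl | h
        · exact hne.1
        · -- an arc at `x`, `y` would turn to the left at `y`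
          intro e
          rw [← e, D'.involutive, e] at h
          exact h.not_gt hl.1.lt
      · intro D' t' hD' e
        exact ⟨D', t', hD', Or.inr (by rw [e]; exact hl.1.lt), rfl⟩

/-- The mirror image of `clasp_capCoeff_mem`. -/
lemma claspRev_capCoeff_mem (hq : 0 < q) {D : CapDiagram S} {t : S → Bool} (hD : D.Admissible t)
    (x : S) (l : List S) (hl : (x :: l).IsChain fun a b => b ⋖ a)
    (hne : (x :: l).IsChain fun a b => D.partner b ≠ a) :
    claspRev (q : ℂ) (x :: l) (capCoeff (q : ℂ) D t) ∈ Submodule.span ℝ≥0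
      {w | ∃ (D' : CapDiagram S) (t' : S → Bool), D'.Admissible t' ∧
        (D' = D ∨ D'.partner x < x) ∧ w = capCoeff (q : ℂ) D' t'} := by
  induction l generalizing x with
  | nil => exact Submodule.subset_span ⟨D, t, hD, Or.inl rfl, rfl⟩
  | cons y l ih =>
    rw [List.isChain_cons_cons] at hl hne
    refine add_mem (a := fun s => qInt (q : ℂ) (l.length + 2) * capCoeff (q : ℂ) D t s) ?_ ?_
    · obtain ⟨c, hc⟩ := qInt_ofReal hq (l.length + 2)
      have : (fun s => qInt (q : ℂ) (l.length + 2) * capCoeff (q : ℂ) D t s) =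
          c • capCoeff (q : ℂ) D t := by
        funext s
        rw [Pi.smul_apply, hc, NNReal.smul_def, Complex.real_smul]
      rw [this]
      exact Submodule.smul_mem _ c (Submodule.subset_span ⟨D, t, hD, Or.inl rfl, rfl⟩)
    · refine cupCap_mem_span hq hl.1 ?_ ?_ (ih y hl.2 hne.2)
      · rintro w ⟨D', t', hD', h, rfl⟩
        refine ⟨D', t', hD', ?_, rfl⟩
        rcases h with rfl | h
        · exact hne.1
        · intro e
          rw [e] at h
          exact h.not_gt hl.1.lt
      · intro D' t' hD' e
        exact ⟨D', t', hD', Or.inr (by rw [← e, D'.involutive, e]; exact hl.1.lt), rfl⟩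


/-! ### Moving the boundary between two sites -/

/-- The functional `φ (T ⊗ T)` on the strands of the block `B`, of which the first `m` form the
first site. -/
def blockRow {F : Type*} [Field F] (q : F) {S : Type*} (B : List S) (m : ℕ) (φ : ℤ → ℤ → F)
    (s : S → Bool) : F :=
  rowT q φ ((B.take m).map s) ((B.drop m).map s)

section Field

variable {F : Type*} [Field F] {q : F}

/-- The strand `x` is moved from the second block `x :: l` to the first block `L`. -/
lemma sum_mul_rowT_opE (hq : q ≠ 0) (L : List S) (x : S) (l : List S)
    (hnd : (L ++ x :: l).Nodup) (ρ : (S → Bool) → F)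
    (hρ : ∀ y ∈ L ++ x :: l, ∀ s v, ρ (Function.update s y v) = ρ s) (φ : ℤ → ℤ → F)
    (w : (S → Bool) → F) :
    ∑ s, ρ s * rowT q (opE q (l.length + 1 : ℕ) φ) (L.map s) ((x :: l).map s) * w s =
      ∑ s, ρ s * rowT q φ ((L ++ [x]).map s) (l.map s) * clasp q (x :: l) w s := by
  obtain ⟨-, hxl, h1⟩ := List.nodup_append.1 hnd
  have hL : ∀ y ∈ x :: l, ∀ (s : S → Bool) v, L.map (Function.update s y v) = L.map s :=
    fun y hy s v =>
    map_update_of_notMem (fun h => h1 y h y hy rfl) s v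
  have hx : ∀ y ∈ l, y ≠ x := fun y hy e => (List.nodup_cons.1 hxl).1 (e ▸ hy)
  have h := sum_mul_clasp hq x l hxl
    (fun s t => ρ s * φ (up ((L ++ [x]).map s)) t * q ^ inv ((L ++ [x]).map s)) (by
      intro y hy s v
      have hy' : y ∈ x :: l := List.mem_cons_of_mem _ hy
      simp only [List.map_append, List.map_cons, List.map_nil, hL y hy',
        Function.update_of_ne (hx y hy).symm, hρ y (List.mem_append_right _ hy')]) w
  refine Eq.trans ?_ (h.symm.trans ?_)
  · refine Finset.sum_congr rfl fun s _ => ?_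
    simp only [List.map_append, List.map_cons (f := Function.update s x _), List.map_nil,
      hL x List.mem_cons_self, Function.update_self, hρ x (by simp), rowT, opE_apply,
      up_append, inv_append, up_true, up_false, inv_true, inv_false, dn_true, dn_false, up_nil,
      inv_nil, dn_nil, pow_add]
    push_cast
    rw [sub_eq_add_neg (up (L.map s) : ℤ), zpow_add₀ hq, zpow_natCast]
    ring_nf
  · refine Finset.sum_congr rfl fun s _ => ?_
    simp only [rowT]
    ring

/-- The strand `x` is moved from the first block `L ++ [x]` to the second block `R`. -/
lemma sum_mul_rowT_opF (hq : q ≠ 0) (L : List S) (x : S) (R : List S)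
    (hnd : (L ++ x :: R).Nodup) (ρ : (S → Bool) → F)
    (hρ : ∀ y ∈ L ++ x :: R, ∀ s v, ρ (Function.update s y v) = ρ s) (φ : ℤ → ℤ → F)
    (w : (S → Bool) → F) :
    ∑ s, ρ s * rowT q (opF q (L.length + 1 : ℕ) R.length φ) ((L ++ [x]).map s) (R.map s) * w s =
      ∑ s, ρ s * rowT q φ (L.map s) ((x :: R).map s) * claspRev q (x :: L.reverse) w s := by
  have hnd' := List.nodup_append.1 hnd
  obtain ⟨hLn, hxR, h1⟩ := hnd'
  have hxL : (x :: L.reverse).Nodup := by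
    rw [List.nodup_cons, List.mem_reverse, List.nodup_reverse]
    exact ⟨fun h => h1 x h x List.mem_cons_self rfl, hLn⟩
  have hR : ∀ y ∈ x :: L.reverse, ∀ (s : S → Bool) v, R.map (Function.update s y v) = R.map s := by
    intro y hy s v
    refine map_update_of_notMem (fun h => ?_) s v
    rcases List.mem_cons.1 hy with rfl | hy
    · exact (List.nodup_cons.1 hxR).1 h
    · exact h1 y (List.mem_reverse.1 hy) y (List.mem_cons_of_mem _ h) rfl
  have hx : ∀ y ∈ L.reverse, y ≠ x := fun y hy e => (List.nodup_cons.1 hxL).1 (e ▸ hy)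
  have h := sum_mul_claspRev hq x L.reverse hxL
    (fun s t => ρ s * φ t (up ((x :: R).map s)) * q ^ inv ((x :: R).map s)) (by
      intro y hy s v
      have hy' : y ∈ x :: L.reverse := List.mem_cons_of_mem _ hy
      have hy2 : y ∈ L ++ x :: R := List.mem_append_left _ (List.mem_reverse.1 hy)
      simp only [List.map_cons, hR y hy', Function.update_of_ne (hx y hy).symm, hρ y hy2]) w
  have hup : ∀ l : List Bool, up l.reverse = up l := fun l => by simp [up]
  have hdn : ∀ l : List Bool, dn l.reverse = dn l := fun l => by simp [dn]
  have hco : ∀ l : List Bool, coinv l.reverse = inv l := by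
    intro l
    induction l with
    | nil => rfl
    | cons a l ih => cases a <;> simp [ih, hdn]
  refine Eq.trans ?_ (h.symm.trans ?_)
  · refine Finset.sum_congr rfl fun s _ => ?_
    have e1 : up ((x :: L.reverse).map s) = up ((L ++ [x]).map s) := by
      rw [← hup, ← List.map_reverse]; simp
    have e2 : coinv ((x :: L.reverse).map s) = inv ((L ++ [x]).map s) := by
      rw [← hco, ← List.map_reverse]; simp
    have e3 : ((dn (R.map s) : ℕ) : ℤ) = R.length - up (R.map s) := by
      have := up_add_dn (R.map s)
      rw [List.length_map] at this
      omega
    simp only [e1, e2, rowT, opF_apply]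
    generalize up ((L ++ [x]).map s) = a
    simp only [List.map_cons (f := Function.update s x _), hR x List.mem_cons_self,
      Function.update_self, hρ x (by simp), up_true, up_false, inv_true,
      inv_false, pow_add, List.length_reverse]
    rw [← zpow_natCast q (dn _), e3, show (R.length : ℤ) - up (R.map s) - (L.length + 1 : ℕ) + a =
      (a - (L.length + 1)) + (R.length - up (R.map s)) by push_cast; ring, zpow_add₀ hq]
    push_cast
    ring
  · refine Finset.sum_congr rfl fun s _ => ?_
    simp only [rowT, List.map_reverse, hup, hco]
    ring

end Field

end Moving

section Positivity

open scoped NNReal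

variable {S : Type*} [LinearOrder S] [Fintype S] {q : ℝ}

lemma mem_capCone_of_mem_span {A : Set ((S → Bool) → ℂ)}
    (hA : ∀ w ∈ A, ∃ (D : CapDiagram S) (t : S → Bool), D.Admissible t ∧
      w = capCoeff (q : ℂ) D t) {w : (S → Bool) → ℂ} (hw : w ∈ Submodule.span ℝ≥0 A) :
    w ∈ capCone q S :=
  Submodule.span_mono hA hw

/-- An existence statement for functionals that is linear in the vector need only be shown for the
generators of the cone. -/
lemma exists_mem_capCone_of_generators {ι : Type*} (P : ι → Prop) (Ψ Ψ' : ι → (S → Bool) → ℂ)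
    (h : ∀ (D : CapDiagram S) (t : S → Bool), D.Admissible t → ∃ w' ∈ capCone q S, ∀ i, P i →
      ∑ s, Ψ i s * capCoeff (q : ℂ) D t s = ∑ s, Ψ' i s * w' s)
    {w : (S → Bool) → ℂ} (hw : w ∈ capCone q S) :
    ∃ w' ∈ capCone q S, ∀ i, P i → ∑ s, Ψ i s * w s = ∑ s, Ψ' i s * w' s := by
  induction hw using Submodule.span_induction with
  | mem w hw => obtain ⟨D, t, hD, rfl⟩ := hw; exact h D t hD
  | zero => exact ⟨0, zero_mem _, fun i _ => by simp⟩
  | add v w _ _ hv hw =>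
    obtain ⟨v', hv', hv⟩ := hv
    obtain ⟨w', hw', hw⟩ := hw
    exact ⟨v' + w', add_mem hv' hw', fun i hi => by
      simp only [Pi.add_apply, mul_add, Finset.sum_add_distrib, hv i hi, hw i hi]⟩
  | smul c w _ hw =>
    obtain ⟨w', hw', hw⟩ := hw
    refine ⟨c • w', Submodule.smul_mem _ c hw', fun i hi => ?_⟩
    simp only [Pi.smul_apply, mul_smul_comm, ← Finset.smul_sum, hw i hi]

/-- `ρ` does not depend on the arrows of the strands of `B`. -/
def IndepOf {F : Type*} {S : Type*} [DecidableEq S] (B : List S) (ρ : (S → Bool) → F) : Prop :=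
  ∀ y ∈ B, ∀ s v, ρ (Function.update s y v) = ρ s

/-- Moving the boundary between the two parts of the block `B` by one strand to the right maps the
cone to itself. The other strands may carry any functional `ρ`. -/
lemma exists_moveRight (hq : 0 < q) {B : List S} (hB : B.IsChain (· ⋖ ·)) {m : ℕ}
    (hm : m < B.length) {w : (S → Bool) → ℂ} (hw : w ∈ capCone q S) :
    ∃ w' ∈ capCone q S, ∀ (ρ : (S → Bool) → ℂ) (φ : ℤ → ℤ → ℂ), IndepOf B ρ →
      ∑ s, ρ s * blockRow (q : ℂ) B m (opE (q : ℂ) (B.length - m : ℕ) φ) s * w s =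
        ∑ s, ρ s * blockRow (q : ℂ) B (m + 1) φ s * w' s := by
  have hq' : (q : ℂ) ≠ 0 := by exact_mod_cast hq.ne'
  obtain ⟨L, x, l, rfl, rfl⟩ : ∃ L x l, B = L ++ x :: l ∧ L.length = m :=
    ⟨B.take m, B[m], B.drop (m + 1), by simp, by simp; omega⟩
  have h1 : (L ++ x :: l).take (L.length + 1) = L ++ [x] := by
    simp [List.take_append]
  have h2 : (L ++ x :: l).drop (L.length + 1) = l := by
    simp [List.drop_append]
  have h3 : (L ++ x :: l).length - L.length = l.length + 1 := by simp
  have hnd : (L ++ x :: l).Nodup :=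
    (List.isChain_iff_pairwise.1 (hB.imp fun _ _ h => h.lt)).imp fun h => h.ne
  have hC : (x :: l).IsChain (· ⋖ ·) := hB.right_of_append
  suffices ∃ w' ∈ capCone q S, ∀ p : ((S → Bool) → ℂ) × (ℤ → ℤ → ℂ), IndepOf (L ++ x :: l) p.1 →
      ∑ s, (p.1 s * rowT (q : ℂ) (opE (q : ℂ) (l.length + 1 : ℕ) p.2) (L.map s)
        ((x :: l).map s)) * w s =
        ∑ s, (p.1 s * rowT (q : ℂ) p.2 ((L ++ [x]).map s) (l.map s)) * w' s by
    obtain ⟨w', hw', h⟩ := this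
    refine ⟨w', hw', fun ρ φ hρ => ?_⟩
    simpa only [blockRow, h1, h2, h3, List.take_left, List.drop_left] using h (ρ, φ) hρ
  refine exists_mem_capCone_of_generators (ι := ((S → Bool) → ℂ) × (ℤ → ℤ → ℂ))
    (fun p => IndepOf (L ++ x :: l) p.1) _ _ ?_ hw
  intro D t hD
  by_cases hne : (x :: l).IsChain fun a b => D.partner a ≠ b
  · refine ⟨clasp (q : ℂ) (x :: l) (capCoeff (q : ℂ) D t), mem_capCone_of_mem_span ?_
      (clasp_capCoeff_mem hq hD x l hC hne), ?_⟩
    · rintro w ⟨D', t', hD', -, rfl⟩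
      exact ⟨D', t', hD', rfl⟩
    · rintro ⟨ρ, φ⟩ hρ
      exact sum_mul_rowT_opE hq' L x l hnd ρ hρ φ _
  · -- The functional on the left symmetrizes the two legs of an arc.
    refine ⟨0, zero_mem _, ?_⟩
    rintro ⟨ρ, φ⟩ hρ
    replace hρ : ∀ y ∈ L ++ x :: l, ∀ s v, ρ (Function.update s y v) = ρ s := hρ
    have h := sum_mul_inv_mul_capCoeff_eq_zero (q := (q : ℂ)) t hC hne
      (fun s b => ρ s * opE (q : ℂ) (l.length + 1 : ℕ) φ (up (L.map s)) b * (q : ℂ) ^ inv (L.map s))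
      (fun y hy s v => by
        have hyL : y ∉ L := fun h => (List.nodup_append.1 hnd).2.2 y h y hy rfl
        simp only [map_update_of_notMem hyL, hρ y (List.mem_append_right _ hy)])
    simp only [Pi.zero_apply, mul_zero, Finset.sum_const_zero]
    rw [← h]
    refine Finset.sum_congr rfl fun s _ => ?_
    simp only [rowT]
    ring

/-- The mirror image of `exists_moveRight`. -/
lemma exists_moveLeft (hq : 0 < q) {B : List S} (hB : B.IsChain (· ⋖ ·)) {m : ℕ}
    (hm : m < B.length) {w : (S → Bool) → ℂ} (hw : w ∈ capCone q S) :
    ∃ w' ∈ capCone q S, ∀ (ρ : (S → Bool) → ℂ) (φ : ℤ → ℤ → ℂ), IndepOf B ρ →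
      ∑ s, ρ s * blockRow (q : ℂ) B (m + 1)
          (opF (q : ℂ) (m + 1 : ℕ) (B.length - (m + 1) : ℕ) φ) s * w s =
        ∑ s, ρ s * blockRow (q : ℂ) B m φ s * w' s := by
  have hq' : (q : ℂ) ≠ 0 := by exact_mod_cast hq.ne'
  obtain ⟨L, x, l, rfl, rfl⟩ : ∃ L x l, B = L ++ x :: l ∧ L.length = m :=
    ⟨B.take m, B[m], B.drop (m + 1), by simp, by simp; omega⟩
  have h1 : (L ++ x :: l).take (L.length + 1) = L ++ [x] := by
    simp [List.take_append]
  have h2 : (L ++ x :: l).drop (L.length + 1) = l := by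
    simp [List.drop_append]
  have h3 : (L ++ x :: l).length - (L.length + 1) = l.length := by simp; omega
  have hnd : (L ++ x :: l).Nodup :=
    (List.isChain_iff_pairwise.1 (hB.imp fun _ _ h => h.lt)).imp fun h => h.ne
  have hC : (L ++ [x]).IsChain (· ⋖ ·) := by
    rw [List.append_cons] at hB
    exact hB.left_of_append
  suffices ∃ w' ∈ capCone q S, ∀ p : ((S → Bool) → ℂ) × (ℤ → ℤ → ℂ), IndepOf (L ++ x :: l) p.1 →
      ∑ s, (p.1 s * rowT (q : ℂ) (opF (q : ℂ) (L.length + 1 : ℕ) l.length p.2) ((L ++ [x]).map s)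
        (l.map s)) * w s =
        ∑ s, (p.1 s * rowT (q : ℂ) p.2 (L.map s) ((x :: l).map s)) * w' s by
    obtain ⟨w', hw', h⟩ := this
    refine ⟨w', hw', fun ρ φ hρ => ?_⟩
    simpa only [blockRow, h1, h2, h3, List.take_left, List.drop_left] using h (ρ, φ) hρ
  refine exists_mem_capCone_of_generators (ι := ((S → Bool) → ℂ) × (ℤ → ℤ → ℂ))
    (fun p => IndepOf (L ++ x :: l) p.1) _ _ ?_ hw
  intro D t hD
  by_cases hne : (L ++ [x]).IsChain fun a b => D.partner a ≠ b
  · have hrev : (L ++ [x]).reverse = x :: L.reverse := by simp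
    refine ⟨claspRev (q : ℂ) (x :: L.reverse) (capCoeff (q : ℂ) D t), mem_capCone_of_mem_span ?_
      (claspRev_capCoeff_mem hq hD x L.reverse ?_ ?_), ?_⟩
    · rintro w ⟨D', t', hD', -, rfl⟩
      exact ⟨D', t', hD', rfl⟩
    · rw [← hrev]; exact List.isChain_reverse.2 hC
    · rw [← hrev]; exact List.isChain_reverse.2 hne
    · rintro ⟨ρ, φ⟩ hρ
      exact sum_mul_rowT_opF hq' L x l hnd ρ hρ φ _
  · -- The functional on the left symmetrizes the two legs of an arc.
    refine ⟨0, zero_mem _, ?_⟩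
    rintro ⟨ρ, φ⟩ hρ
    replace hρ : ∀ y ∈ L ++ x :: l, ∀ s v, ρ (Function.update s y v) = ρ s := hρ
    have h := sum_mul_inv_mul_capCoeff_eq_zero (q := (q : ℂ)) t hC hne
      (fun s b => ρ s * opF (q : ℂ) (L.length + 1 : ℕ) l.length φ b (up (l.map s)) *
        (q : ℂ) ^ inv (l.map s))
      (fun y hy s v => by
        have hyl : y ∉ l := by
          rw [List.append_cons] at hnd
          exact fun h => (List.nodup_append.1 hnd).2.2 y hy y h rfl
        simp only [map_update_of_notMem hyl, hρ y (by
          rw [List.append_cons]; exact List.mem_append_left _ hy)])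
    simp only [Pi.zero_apply, mul_zero, Finset.sum_const_zero]
    rw [← h]
    refine Finset.sum_congr rfl fun s _ => ?_
    simp only [rowT]
    ring

lemma exists_iterE (hq : 0 < q) {B : List S} (hB : B.IsChain (· ⋖ ·)) {m : ℕ} (k : ℕ)
    (hm : m + k ≤ B.length) {w : (S → Bool) → ℂ} (hw : w ∈ capCone q S) :
    ∃ w' ∈ capCone q S, ∀ (ρ : (S → Bool) → ℂ) (φ : ℤ → ℤ → ℂ), IndepOf B ρ →
      ∑ s, ρ s * blockRow (q : ℂ) B m (iterE (q : ℂ) k (B.length - m : ℕ) φ) s * w s =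
        ∑ s, ρ s * blockRow (q : ℂ) B (m + k) φ s * w' s := by
  induction k generalizing m w with
  | zero => exact ⟨w, hw, fun ρ φ _ => rfl⟩
  | succ k ih =>
    obtain ⟨w₁, hw₁, h₁⟩ := exists_moveRight hq hB (m := m) (by omega) hw
    obtain ⟨w₂, hw₂, h₂⟩ := ih (m := m + 1) (by omega) hw₁
    refine ⟨w₂, hw₂, fun ρ φ hρ => ?_⟩
    rw [iterE_succ, h₁ ρ _ hρ,
      show ((B.length - m : ℕ) : ℤ) - 1 = (B.length - (m + 1) : ℕ) by omega,
      h₂ ρ φ hρ, show m + 1 + k = m + (k + 1) by ring]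

lemma exists_iterF (hq : 0 < q) {B : List S} (hB : B.IsChain (· ⋖ ·)) {m : ℕ} (k : ℕ)
    (hm : m + k ≤ B.length) {w : (S → Bool) → ℂ} (hw : w ∈ capCone q S) :
    ∃ w' ∈ capCone q S, ∀ (ρ : (S → Bool) → ℂ) (φ : ℤ → ℤ → ℂ), IndepOf B ρ →
      ∑ s, ρ s * blockRow (q : ℂ) B (m + k)
          (iterF (q : ℂ) k (m + k : ℕ) (B.length - (m + k) : ℕ) φ) s * w s =
        ∑ s, ρ s * blockRow (q : ℂ) B m φ s * w' s := by
  induction k generalizing w with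
  | zero => exact ⟨w, hw, fun ρ φ _ => rfl⟩
  | succ k ih =>
    obtain ⟨w₁, hw₁, h₁⟩ := exists_moveLeft hq hB (m := m + k) (by omega) hw
    obtain ⟨w₂, hw₂, h₂⟩ := ih (by omega) hw₁
    refine ⟨w₂, hw₂, fun ρ φ hρ => ?_⟩
    rw [iterF_succ, ← add_assoc, h₁ ρ _ hρ, show ((m + k + 1 : ℕ) : ℤ) - 1 = (m + k : ℕ) by omega,
      show ((B.length - (m + k + 1) : ℕ) : ℤ) + 1 = (B.length - (m + k) : ℕ) by omega, h₂ ρ φ hρ]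

/-- A non-negative multiple of a vector of the cone is in the cone. -/
lemma div_smul_mem_capCone (hq : 0 < q) (a b c d : ℕ) {w : (S → Bool) → ℂ} (hw : w ∈ capCone q S) :
    (qFact (q : ℂ) a * qFact (q : ℂ) b / (qFact (q : ℂ) c * qFact (q : ℂ) d)) • w ∈
      capCone q S := by
  choose f hf using qFact_ofReal hq
  have h : qFact (q : ℂ) a * qFact (q : ℂ) b / (qFact (q : ℂ) c * qFact (q : ℂ) d) =
      ((f a * f b / (f c * f d) : ℝ≥0) : ℝ) := by
    rw [hf, hf, hf, hf]; push_cast; rfl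
  have h' : ((((f a * f b / (f c * f d) : ℝ≥0) : ℝ) : ℂ)) • w = (f a * f b / (f c * f d)) • w := by
    funext s
    rw [Pi.smul_apply, Pi.smul_apply, NNReal.smul_def, Complex.real_smul, smul_eq_mul]
  rw [h, h']
  exact Submodule.smul_mem _ _ hw

/-- The transpose of a cascade operator on two neighbouring blocks, applied to row functionals, is
the transpose of an operator that preserves the cone. -/
lemma exists_cascadeK (hq : 0 < q) {B : List S} (hB : B.IsChain (· ⋖ ·)) {m n : ℕ}
    (hmn : B.length = m + n) (k : ℤ) (hk : -(m : ℤ) ≤ k) (hk' : k ≤ n) {w : (S → Bool) → ℂ}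
    (hw : w ∈ capCone q S) :
    ∃ w' ∈ capCone q S, ∀ (ρ : (S → Bool) → ℂ) (φ : ℤ → ℤ → ℂ), IndepOf B ρ →
      ∃ ψ, IsRowAct (cascadeK (q : ℂ) m n k) φ ψ ∧
      ∑ s, ρ s * blockRow (q : ℂ) B m ψ s * w s = ∑ s, ρ s * blockRow (q : ℂ) B m φ s * w' s := by
  have hq' : (q : ℂ) ≠ 0 := by exact_mod_cast hq.ne'
  have hsmul : ∀ (c : ℂ) (χ : ℤ → ℤ → ℂ) s, blockRow (q : ℂ) B m (c • χ) s =
      c * blockRow (q : ℂ) B m χ s := by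
    intro c χ s
    simp only [blockRow, rowT, Pi.smul_apply, smul_eq_mul]
    ring
  rcases le_total 0 k with h0 | h0
  · obtain ⟨k, rfl⟩ := Int.eq_ofNat_of_zero_le h0
    have hkn : k ≤ n := by exact_mod_cast hk'
    obtain ⟨w₁, hw₁, h₁⟩ := exists_iterE hq hB (m := m) k (by omega) hw
    obtain ⟨w₂, hw₂, h₂⟩ := exists_iterF hq hB (m := m) k (by omega) hw₁
    refine ⟨_, div_smul_mem_capCone hq m (n - k) (m + k) n hw₂, fun ρ φ hρ =>
      ⟨_, cascadeK_isRowAct hq' (qInt_ne_zero hq) hkn φ, ?_⟩⟩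
    have e₁ := h₁ ρ (iterF (q : ℂ) k (m + k : ℕ) (n - k : ℕ) φ) hρ
    have e₂ := h₂ ρ φ hρ
    rw [show B.length - m = n by omega] at e₁
    rw [show B.length - (m + k) = n - k by omega] at e₂
    have e := e₁.trans e₂
    simp only [hsmul, Pi.smul_apply, smul_eq_mul, mul_left_comm _ (_ / _ : ℂ), mul_assoc,
      ← Finset.mul_sum] at e ⊢
    rw [e]
  · obtain ⟨k, rfl⟩ : ∃ j : ℕ, k = -(j : ℤ) := ⟨k.natAbs, by omega⟩
    have hkm : k ≤ m := by omega
    obtain ⟨w₁, hw₁, h₁⟩ := exists_iterF hq hB (m := m - k) k (by omega) hw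
    obtain ⟨w₂, hw₂, h₂⟩ := exists_iterE hq hB (m := m - k) k (by omega) hw₁
    refine ⟨_, div_smul_mem_capCone hq n (m - k) (n + k) m hw₂, fun ρ φ hρ =>
      ⟨_, cascadeK_neg_isRowAct hq' (qInt_ne_zero hq) hkm φ, ?_⟩⟩
    have e₁ := h₁ ρ (iterE (q : ℂ) k (n + k : ℕ) φ) hρ
    have e₂ := h₂ ρ φ hρ
    rw [show m - k + k = m by omega, show B.length - m = n by omega] at e₁
    rw [show m - k + k = m by omega, show B.length - (m - k) = n + k by omega] at e₂
    have e := e₁.trans e₂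
    simp only [hsmul, Pi.smul_apply, smul_eq_mul, mul_left_comm _ (_ / _ : ℂ), mul_assoc,
      ← Finset.mul_sum] at e ⊢
    rw [e]

end Positivity

/-! ### Cascade operators on a chain -/

section Chain

variable {L : ℕ} {n : Fin L → ℕ}

lemma strand_lt {i j : Fin L} {a : Fin (n i)} {b : Fin (n j)} :
    (toLex ⟨i, a⟩ : Strands n) < toLex ⟨j, b⟩ ↔ i < j ∨ i = j ∧ a.val < b.val := by
  rw [Sigma.Lex.lt_def]
  refine or_congr Iff.rfl ⟨?_, ?_⟩
  · rintro ⟨h, h'⟩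
    change i = j at h
    subst h
    exact ⟨rfl, h'⟩
  · rintro ⟨h, h'⟩
    subst h
    exact ⟨rfl, h'⟩

lemma strand_inj {i j : Fin L} {a : Fin (n i)} {b : Fin (n j)} :
    (toLex ⟨i, a⟩ : Strands n) = toLex ⟨j, b⟩ ↔ i = j ∧ a.val = b.val := by
  constructor
  · intro h
    obtain ⟨rfl, h⟩ := Sigma.mk.inj_iff.1 (toLex_inj.1 h)
    exact ⟨rfl, congrArg Fin.val (eq_of_heq h)⟩
  · rintro ⟨rfl, h⟩
    rw [Fin.ext h]

lemma exists_strand (x : Strands n) : ∃ i a, x = toLex ⟨i, a⟩ := ⟨(ofLex x).1, (ofLex x).2, rfl⟩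

/-- The strands of the site `i`, from left to right. -/
def siteStrands (n : Fin L → ℕ) (i : Fin L) : List (Strands n) :=
  List.ofFn fun a : Fin (n i) => toLex ⟨i, a⟩

lemma map_siteStrands (i : Fin L) (s : Strands n → Bool) :
    (siteStrands n i).map s = List.ofFn fun a => s (toLex ⟨i, a⟩) := by
  rw [siteStrands, List.map_ofFn]; rfl

lemma isChain_siteStrands (i : Fin L) : (siteStrands n i).IsChain (· ⋖ ·) := by
  rw [siteStrands, List.isChain_ofFn]
  intro a ha
  refine ⟨strand_lt.2 (Or.inr ⟨rfl, by simp⟩), fun c hc hc' => ?_⟩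
  obtain ⟨j, b, rfl⟩ := exists_strand c
  rw [strand_lt] at hc hc'
  rcases hc with hc | ⟨rfl, hc⟩
  · rcases hc' with hc' | ⟨rfl, hc'⟩
    · exact hc.not_gt hc'
    · exact hc.false
  · rcases hc' with hc' | ⟨-, hc'⟩
    · exact hc'.false
    · simp only at hc hc'; omega

lemma isChain_siteStrands_append {i i' : Fin L} (h : i'.val = i.val + 1) :
    (siteStrands n i ++ siteStrands n i').IsChain (· ⋖ ·) := by
  rw [List.isChain_append]
  refine ⟨isChain_siteStrands i, isChain_siteStrands i', fun x hx y hy => ?_⟩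
  have hxl : ∃ a : Fin (n i), a.val + 1 = n i ∧ x = toLex ⟨i, a⟩ := by
    rcases Nat.eq_zero_or_pos (n i) with h0 | h0
    · rw [siteStrands, List.getLast?_eq_getElem?] at hx
      simp [h0] at hx
    · refine ⟨⟨n i - 1, by omega⟩, by simp; omega, ?_⟩
      rw [siteStrands, List.getLast?_eq_getElem?, Option.mem_def, List.length_ofFn,
        List.getElem?_ofFn, dif_pos (by omega)] at hx
      exact (Option.some.inj hx).symm
  have hyl : ∃ a : Fin (n i'), a.val = 0 ∧ y = toLex ⟨i', a⟩ := by
    rw [siteStrands, List.head?_eq_getElem?, Option.mem_def, List.getElem?_ofFn] at hy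
    split_ifs at hy with h0
    exact ⟨⟨0, h0⟩, rfl, (Option.some.inj hy).symm⟩
  obtain ⟨a, ha, rfl⟩ := hxl
  obtain ⟨b, hb, rfl⟩ := hyl
  refine ⟨strand_lt.2 (Or.inl (by rw [Fin.lt_def]; omega)), fun c hc hc' => ?_⟩
  obtain ⟨j, d, rfl⟩ := exists_strand c
  rw [strand_lt] at hc hc'
  rcases hc with hc | ⟨rfl, hc⟩
  · rcases hc' with hc' | ⟨rfl, hc'⟩
    · rw [Fin.lt_def] at hc hc'; omega
    · omega
  · have := d.isLt; omega

section Field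

variable {F : Type*} [Field F] {q : F}

/-- The `q`-symmetrization `T_{n_1} ⊗ ... ⊗ T_{n_L}`. -/
def chainT (q : F) (n : Fin L → ℕ) : ((Strands n → Bool) → F) →ₗ[F] Chain F n where
  toFun w := ∑ s : Strands n → Bool, w s •
    PiTensorProduct.tprod F fun i => fun c => symT q (n i) c fun a => s (toLex ⟨i, a⟩)
  map_add' v w := by simp only [Pi.add_apply, add_smul, Finset.sum_add_distrib]
  map_smul' c w := by
    simp only [Pi.smul_apply, smul_eq_mul, mul_smul, ← Finset.smul_sum, RingHom.id_apply]

lemma capVector_eq_chainT (D : CapDiagram (Strands n)) (t : Strands n → Bool) :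
    capVector q n D t = chainT q n (capCoeff q D t) := rfl

lemma repr_chainT (w : (Strands n → Bool) → F) (x : ∀ i, Fin (n i + 1)) :
    (chainBasis F n).repr (chainT q n w) x =
      ∑ s, w s * ∏ i, symT q (n i) (x i) fun a => s (toLex ⟨i, a⟩) := by
  simp only [chainT, LinearMap.coe_mk, AddHom.coe_mk, map_sum, map_smul, Finsupp.coe_finsetSum,
    Finset.sum_apply, Finsupp.smul_apply, smul_eq_mul]
  refine Finset.sum_congr rfl fun s _ => ?_
  rw [chainBasis, Basis.piTensorProduct_repr_tprod_apply]
  rfl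

lemma repr_twoSite (i i' : Fin L) (hne : i ≠ i')
    (A : Matrix (Fin (n i + 1) × Fin (n i' + 1)) (Fin (n i + 1) × Fin (n i' + 1)) F)
    (v : Chain F n) (x' : ∀ i, Fin (n i + 1)) :
    (chainBasis F n).repr (twoSite n i i' A v) x' =
      ∑ p : Fin (n i + 1) × Fin (n i' + 1), A (x' i, x' i') p *
        (chainBasis F n).repr v (Function.update (Function.update x' i p.1) i' p.2) := by
  have h := congrFun (LinearMap.toMatrix_mulVec_repr (chainBasis F n) (chainBasis F n)
    (twoSite n i i' A) v) x'
  obtain ⟨M, hM, hM'⟩ : ∃ M : Matrix (∀ i, Fin (n i + 1)) (∀ i, Fin (n i + 1)) F,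
      twoSite n i i' A = Matrix.toLin (chainBasis F n) (chainBasis F n) M ∧ ∀ x' x, M x' x =
        if ∀ l, l ≠ i → l ≠ i' → x' l = x l then A (x' i, x' i') (x i, x i') else 0 :=
    ⟨_, rfl, fun _ _ => rfl⟩
  rw [← h, hM, LinearMap.toMatrix_toLin, Matrix.mulVec, dotProduct]
  simp only [hM']
  symm
  refine Fintype.sum_of_injective
    (fun p : Fin (n i + 1) × Fin (n i' + 1) =>
      Function.update (Function.update x' i p.1) i' p.2) ?_ _ _ ?_ ?_
  · rintro ⟨a, b⟩ ⟨a', b'⟩ h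
    have h1 := congrFun h i
    have h2 := congrFun h i'
    simp only [Function.update_self, Function.update_of_ne hne] at h1 h2
    rw [h1, h2]
  · intro x hx
    rw [if_neg, zero_mul]
    intro hxx
    refine hx ⟨(x i, x i'), ?_⟩
    funext l
    by_cases h1 : l = i'
    · subst h1; simp
    · by_cases h2 : l = i
      · subst h2; simp [h1]
      · simp [h1, h2, hxx l h2 h1]
  · rintro ⟨a, b⟩
    rw [if_pos]
    · simp [Function.update_of_ne hne]
    · intro l h1 h2
      rw [Function.update_of_ne h2, Function.update_of_ne h1]

end Field

variable {q : ℝ}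

/-- The image of the cone under the `q`-symmetrizations is preserved by the cascade operators. -/
lemma exists_twoSite_chainT (hq : 0 < q) {i i' : Fin L} (h : i'.val = i.val + 1) (k : ℤ)
    (hk : -(n i : ℤ) ≤ k) (hk' : k ≤ n i') {w : (Strands n → Bool) → ℂ}
    (hw : w ∈ capCone q (Strands n)) :
    ∃ w' ∈ capCone q (Strands n),
      twoSite n i i' (cascadeK (q : ℂ) (n i) (n i') k) (chainT (q : ℂ) n w) =
        chainT (q : ℂ) n w' := by
  have hne : i ≠ i' := fun e => by rw [e] at h; omega
  obtain ⟨w', hw', H⟩ := exists_cascadeK hq (isChain_siteStrands_append (n := n) h)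
    (m := n i) (n := n i') (by simp [siteStrands]) k hk hk' hw
  refine ⟨w', hw', (chainBasis ℂ n).repr.injective (Finsupp.ext fun x' => ?_)⟩
  set ρ : (Strands n → Bool) → ℂ := fun s => ∏ l ∈ ({i, i'} : Finset (Fin L))ᶜ,
    symT (q : ℂ) (n l) (x' l) fun a => s (toLex ⟨l, a⟩) with hρ
  have hρi : IndepOf (siteStrands n i ++ siteStrands n i') ρ := by
    intro y hy s v
    refine Finset.prod_congr rfl fun l hl => ?_
    congr 1
    funext a
    refine Function.update_of_ne (fun e => ?_) _ _
    simp only [Finset.mem_compl, Finset.mem_insert, Finset.mem_singleton, not_or] at hl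
    simp only [siteStrands, List.mem_append, List.mem_ofFn] at hy
    rcases hy with ⟨b, rfl⟩ | ⟨b, rfl⟩
    · exact hl.1 (strand_inj.1 e).1
    · exact hl.2 (strand_inj.1 e).1
  set φ : ℤ → ℤ → ℂ := fun a b => if a = (x' i : ℤ) ∧ b = (x' i' : ℤ) then 1 else 0 with hφ
  have hφs : ∀ f : Fin (n i + 1) × Fin (n i' + 1) → ℂ,
      ∑ p : Fin (n i + 1) × Fin (n i' + 1), φ p.1 p.2 * f p = f (x' i, x' i') := by
    intro f
    rw [Finset.sum_eq_single (x' i, x' i')]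
    · simp [hφ]
    · rintro ⟨a, b⟩ - hab
      rw [hφ]
      simp only
      rw [if_neg, zero_mul]
      rintro ⟨h1, h2⟩
      exact hab (Prod.ext (Fin.ext (by exact_mod_cast h1)) (Fin.ext (by exact_mod_cast h2)))
    · simp
  obtain ⟨ψ, hψ, e⟩ := H ρ φ hρi
  have hlen : (siteStrands n i).length = n i := by simp [siteStrands]
  have hrow : ∀ χ s, blockRow (q : ℂ) (siteStrands n i ++ siteStrands n i') (n i) χ s =
      ∑ p : Fin (n i + 1) × Fin (n i' + 1), χ p.1 p.2 *
        (symT (q : ℂ) (n i) p.1 (fun a => s (toLex ⟨i, a⟩)) *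
          symT (q : ℂ) (n i') p.2 (fun a => s (toLex ⟨i', a⟩))) := by
    intro χ s
    rw [blockRow, List.take_left' hlen, List.drop_left' hlen, map_siteStrands, map_siteStrands,
      ← sum_mul_symTPair]
    rfl
  have hprod : ∀ (x : ∀ l, Fin (n l + 1)) (s : Strands n → Bool),
      (∀ l, l ≠ i → l ≠ i' → x l = x' l) →
      ∏ l, symT (q : ℂ) (n l) (x l) (fun a => s (toLex ⟨l, a⟩)) =
        (symT (q : ℂ) (n i) (x i) (fun a => s (toLex ⟨i, a⟩)) *
          symT (q : ℂ) (n i') (x i') (fun a => s (toLex ⟨i', a⟩))) * ρ s := by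
    intro x s hx
    rw [← Finset.prod_mul_prod_compl {i, i'}, Finset.prod_pair hne, hρ]
    congr 1
    refine Finset.prod_congr rfl fun l hl => ?_
    simp only [Finset.mem_compl, Finset.mem_insert, Finset.mem_singleton, not_or] at hl
    rw [hx l hl.1 hl.2]
  have hK : ∀ p : Fin (n i + 1) × Fin (n i' + 1),
      cascadeK (q : ℂ) (n i) (n i') k (x' i, x' i') p = ψ p.1 p.2 := by
    rintro ⟨a, b⟩
    rw [← hψ a b, hφs]
  rw [repr_twoSite i i' hne, repr_chainT]
  simp only [repr_chainT, hK]
  have hL : ∀ p : Fin (n i + 1) × Fin (n i' + 1), ∀ s : Strands n → Bool,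
      ∏ l, symT (q : ℂ) (n l) (Function.update (Function.update x' i p.1) i' p.2 l)
        (fun a => s (toLex ⟨l, a⟩)) =
        (symT (q : ℂ) (n i) p.1 (fun a => s (toLex ⟨i, a⟩)) *
          symT (q : ℂ) (n i') p.2 (fun a => s (toLex ⟨i', a⟩))) * ρ s := by
    intro p s
    rw [hprod _ s fun l h1 h2 => by rw [Function.update_of_ne h2, Function.update_of_ne h1],
      Function.update_self, Function.update_of_ne hne, Function.update_self]
  simp only [hL, hprod x' _ fun _ _ _ => rfl, Finset.mul_sum]
  rw [Finset.sum_comm]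
  refine Eq.trans ?_ (e.trans ?_)
  · refine Finset.sum_congr rfl fun s _ => ?_
    rw [hrow, Finset.mul_sum, Finset.sum_mul]
    exact Finset.sum_congr rfl fun p _ => by ring
  · refine Finset.sum_congr rfl fun s _ => ?_
    rw [hrow, hφs]
    ring

end Chain

/-! ### Cap diagrams and words -/

section Words

variable {S : Type*} [LinearOrder S]

namespace CapDiagram

/-- The word of a cap diagram: up arrows at the left legs of the arcs, down arrows at the right
legs, and the arrows `t` on the through lines. -/
def word (D : CapDiagram S) (t : S → Bool) (a : S) : Bool :=
  if a < D.partner a then true else if D.partner a < a then false else t a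

lemma word_of_lt {D : CapDiagram S} (t : S → Bool) {a : S} (h : a < D.partner a) :
    D.word t a = true := if_pos h

lemma word_of_gt {D : CapDiagram S} (t : S → Bool) {a : S} (h : D.partner a < a) :
    D.word t a = false := by rw [word, if_neg h.not_gt, if_pos h]

lemma word_of_eq {D : CapDiagram S} (t : S → Bool) {a : S} (h : D.partner a = a) :
    D.word t a = t a := by rw [word, h, if_neg (lt_irrefl a), if_neg (lt_irrefl a)]

/-- In the word of an admissible diagram, an up arrow directly to the left of a down arrow comes
from an arc. -/
lemma Admissible.partner_eq {D : CapDiagram S} {t : S → Bool} (h : D.Admissible t) {x y : S}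
    (hxy : x ⋖ y) (hx : D.word t x = true) (hy : D.word t y = false) : D.partner x = y := by
  by_contra hne
  have hne' : D.partner y ≠ x := fun e => hne (by rw [← e, D.involutive])
  have hlt := hxy.lt
  have cov : ∀ c, c ≤ x ∨ y ≤ c := fun c => by
    by_contra! h
    exact hxy.2 h.1 h.2
  rcases lt_trichotomy x (D.partner x) with h1 | h1 | h1
  · have h1' : y < D.partner x :=
      lt_of_le_of_ne ((cov _).resolve_left h1.not_ge) (Ne.symm hne)
    rcases lt_trichotomy y (D.partner y) with h2 | h2 | h2
    · rw [word_of_lt t h2] at hy; exact absurd hy (by decide)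
    · exact D.through x y h2.symm ⟨hlt, h1'⟩
    · have h2' : D.partner y < x := lt_of_le_of_ne ((cov _).resolve_right h2.not_ge) hne'
      exact D.noncrossing (D.partner y) x (by rw [D.involutive]; exact ⟨h2', hlt, h1'⟩)
  · rcases lt_trichotomy y (D.partner y) with h2 | h2 | h2
    · rw [word_of_lt t h2] at hy; exact absurd hy (by decide)
    · have := h x y h1.symm h2.symm hlt
      rw [← word_of_eq t h1.symm, ← word_of_eq t h2.symm, hx, hy] at this
      exact absurd this (by decide)
    · have h2' : D.partner y < x := lt_of_le_of_ne ((cov _).resolve_right h2.not_ge) hne'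
      exact D.through (D.partner y) x h1.symm (by rw [D.involutive]; exact ⟨h2', hlt⟩)
  · rw [word_of_gt t h1] at hx; exact absurd hx (by decide)

lemma partner_eq_of_word_eq [Finite S] {D D' : CapDiagram S} {t t' : S → Bool}
    (h' : D'.Admissible t') (hw : D.word t = D'.word t') (a : S) (ha : a < D.partner a) :
    D'.partner a = D.partner a := by
  -- The arcs under the arc at `a` have their left legs to the right of `a`.
  induction a using WellFoundedGT.induction with
  | ind a ih =>
  obtain ⟨b, hb⟩ : ∃ b, D.partner a = b := ⟨_, rfl⟩
  rw [hb] at ha ⊢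
  have hb' : D.partner b = a := by rw [← hb, D.involutive]
  have inner : ∀ c, a < c → c < b → D'.partner c = D.partner c := by
    intro c h1 h2
    have h3 : a < D.partner c := by
      by_contra! h
      have hne : D.partner c ≠ a := fun e => h2.ne (by rw [← D.involutive c, e, hb])
      exact D.noncrossing (D.partner c) a (by
        rw [D.involutive, hb]; exact ⟨lt_of_le_of_ne h hne, h1, h2⟩)
    rcases lt_trichotomy c (D.partner c) with h | h | h
    · exact ih c h1 h
    · exact absurd ⟨h1, by rw [hb]; exact h2⟩ (D.through a c h.symm)
    · have := ih (D.partner c) h3 (by rw [D.involutive]; exact h)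
      rw [D.involutive] at this
      rw [← this, D'.involutive, this]
  have inner' : ∀ c, a < c → c < b → D'.partner c ≠ a ∧ D'.partner c ≠ b := by
    intro c h1 h2
    rw [inner c h1 h2]
    exact ⟨fun e => h2.ne (by rw [← D.involutive c, e, hb]),
      fun e => h1.ne' (by rw [← D.involutive c, e, hb'])⟩
  by_contra hne
  have hne' : D'.partner b ≠ a := fun e => hne (by rw [← e, D'.involutive])
  have hwa : D'.word t' a = true := by rw [← hw, word_of_lt t (hb.symm ▸ ha)]
  have hwb : D'.word t' b = false := by rw [← hw, word_of_gt t (hb'.symm ▸ ha)]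
  have pa : a < D'.partner a → b < D'.partner a := by
    intro h
    by_contra! h2
    exact (inner' _ h (lt_of_le_of_ne h2 hne)).1 (D'.involutive a)
  have pb : D'.partner b < b → D'.partner b < a := by
    intro h
    by_contra! h2
    exact (inner' _ (lt_of_le_of_ne h2 (Ne.symm hne')) h).2 (D'.involutive b)
  rcases lt_trichotomy a (D'.partner a) with h1 | h1 | h1
  · rcases lt_trichotomy b (D'.partner b) with h2 | h2 | h2
    · rw [word_of_lt t' h2] at hwb; exact absurd hwb (by decide)
    · exact D'.through a b h2.symm ⟨ha, pa h1⟩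
    · exact D'.noncrossing (D'.partner b) a (by rw [D'.involutive]; exact ⟨pb h2, ha, pa h1⟩)
  · rcases lt_trichotomy b (D'.partner b) with h2 | h2 | h2
    · rw [word_of_lt t' h2] at hwb; exact absurd hwb (by decide)
    · have := h' a b h1.symm h2.symm ha
      rw [← word_of_eq t' h1.symm, ← word_of_eq t' h2.symm, hwa, hwb] at this
      exact absurd this (by decide)
    · exact D'.through (D'.partner b) a h1.symm (by rw [D'.involutive]; exact ⟨pb h2, ha⟩)
  · rw [word_of_gt t' h1] at hwa; exact absurd hwa (by decide)

/-- The vector of an admissible cap diagram only depends on its word. -/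
lemma capCoeff_eq_of_word_eq {F : Type*} [Field F] {q : F} [Fintype S] {D D' : CapDiagram S}
    {t t' : S → Bool} (h : D.Admissible t) (h' : D'.Admissible t')
    (hw : D.word t = D'.word t') : capCoeff q D t = capCoeff q D' t' := by
  have h1 := partner_eq_of_word_eq h' hw
  have h2 := partner_eq_of_word_eq h hw.symm
  have hp : ∀ a, D'.partner a = D.partner a := by
    intro a
    rcases lt_trichotomy a (D.partner a) with h3 | h3 | h3
    · exact h1 a h3
    · rcases lt_trichotomy a (D'.partner a) with h4 | h4 | h4
      · exact (h2 a h4).symm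
      · rw [← h3, ← h4]
      · have := h2 (D'.partner a) (by rw [D'.involutive]; exact h4)
        rw [D'.involutive] at this
        rw [← this, D.involutive, this]
    · have := h1 (D.partner a) (by rw [D.involutive]; exact h3)
      rw [D.involutive] at this
      rw [← this, D'.involutive, this]
  funext s
  refine Finset.prod_congr rfl fun a _ => ?_
  rw [hp]
  by_cases ha : D.partner a = a
  · have : t a = t' a := by
      rw [← word_of_eq t ha, hw, word_of_eq t' ((hp a).trans ha)]
    rw [this]
  · rw [if_neg ha, if_neg ha]

/-- The diagram in which the neighbouring through lines at `x` and `y` are replaced by an arc. -/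
def join (D : CapDiagram S) (x y : S) (hxy : x < y) (hx : D.partner x = x) (hy : D.partner y = y)
    (hb : ∀ b, D.partner b = b → ¬ (x < b ∧ b < y)) : CapDiagram S where
  partner c := if c = x then y else if c = y then x else D.partner c
  involutive a := by
    have := D.involutive a
    grind
  noncrossing a b := by
    have h1 := D.noncrossing a b
    have h2 := D.through a x hx
    have h3 := D.through a y hy
    have h4 := D.through b x hx
    have h5 := D.through b y hy
    grind
  through a b := by
    have h1 := D.through a b
    have h2 := hb b
    grind

/-- Every word is the word of an admissible cap diagram. -/
lemma exists_word_eq [Fintype S] (s : S → Bool) :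
    ∃ D : CapDiagram S, D.Admissible s ∧ D.word s = s := by
  suffices ∀ (N : ℕ) (D : CapDiagram S), D.word s = s →
      (Finset.univ.filter fun a => D.partner a = a).card = N →
      ∃ D : CapDiagram S, D.Admissible s ∧ D.word s = s by
    refine this _ ⟨id, fun _ => rfl, fun a b h => (h.1.trans h.2.1).false,
      fun a b _ h => (h.1.trans h.2).false⟩ ?_ rfl
    funext a
    exact word_of_eq s rfl
  intro N
  induction N using Nat.strong_induction_on with
  | _ N ih =>
  intro D hD hN
  by_cases hadm : D.Admissible s
  · exact ⟨D, hadm, hD⟩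
  -- There are neighbouring through lines with arrows up and down; they can be joined.
  obtain ⟨x, y, hxy, hx, hy, hb, hsx, hsy⟩ : ∃ x y, x < y ∧ D.partner x = x ∧ D.partner y = y ∧
      (∀ b, D.partner b = b → ¬ (x < b ∧ b < y)) ∧ s x = true ∧ s y = false := by
    classical
    simp only [Admissible, not_forall] at hadm
    obtain ⟨x₀, y₀, hx₀, hy₀, hxy₀, hs⟩ := hadm
    rw [Bool.le_iff_imp] at hs
    have hs : s x₀ = true ∧ s y₀ = false := by
      cases h1 : s x₀ <;> cases h2 : s y₀ <;> simp_all
    set X := Finset.univ.filter fun x => D.partner x = x ∧ s x = true ∧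
      ∃ y, x < y ∧ D.partner y = y ∧ s y = false with hX
    obtain ⟨x, hxX, hxm⟩ := X.exists_max_image id ⟨x₀, by
      rw [hX, Finset.mem_filter]; exact ⟨Finset.mem_univ _, hx₀, hs.1, y₀, hxy₀, hy₀, hs.2⟩⟩
    rw [hX, Finset.mem_filter] at hxX
    obtain ⟨-, hx, hsx, y₁, hxy₁, hy₁, hsy₁⟩ := hxX
    set Y := Finset.univ.filter fun y => x < y ∧ D.partner y = y ∧ s y = false with hY
    obtain ⟨y, hyY, hym⟩ := Y.exists_min_image id ⟨y₁, by
      rw [hY, Finset.mem_filter]; exact ⟨Finset.mem_univ _, hxy₁, hy₁, hsy₁⟩⟩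
    rw [hY, Finset.mem_filter] at hyY
    obtain ⟨-, hxy, hy, hsy⟩ := hyY
    refine ⟨x, y, hxy, hx, hy, fun b hb hbb => ?_, hsx, hsy⟩
    cases hsb : s b
    · exact hbb.2.not_ge (hym b (by
        rw [hY, Finset.mem_filter]; exact ⟨Finset.mem_univ _, hbb.1, hb, hsb⟩))
    · exact hbb.1.not_ge (hxm b (by
        rw [hX, Finset.mem_filter]; exact ⟨Finset.mem_univ _, hb, hsb, y, hbb.2, hy, hsy⟩))
  refine ih _ ?_ (D.join x y hxy hx hy hb) ?_ rfl
  · rw [← hN]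
    refine Finset.card_lt_card ⟨fun a ha => ?_, fun h => ?_⟩
    · simp only [Finset.mem_filter, Finset.mem_univ, true_and, join] at ha ⊢
      grind
    · have := (Finset.mem_filter.1 (h (Finset.mem_filter.2 ⟨Finset.mem_univ x, hx⟩))).2
      simp only [join, if_true] at this
      exact hxy.ne' this
  · funext a
    have hDa := congrFun hD a
    by_cases hax : a = x
    · subst hax
      rw [hsx]; exact word_of_lt s (by simpa [join] using hxy)
    · by_cases hay : a = y
      · subst hay
        rw [hsy]; exact word_of_gt s (by simpa [join, hax] using hxy)
      · rw [← hDa]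
        simp only [word, join, if_neg hax, if_neg hay]

end CapDiagram

variable {F : Type*} [Field F] {q : F} [Fintype S]

lemma capCoeff_word (D : CapDiagram S) (t : S → Bool) : capCoeff q D t (D.word t) = 1 := by
  refine Finset.prod_eq_one fun a _ => ?_
  by_cases h : a < D.partner a
  · have h' : D.partner (D.partner a) < D.partner a := by rwa [D.involutive]
    rw [if_pos h, CapDiagram.word_of_lt t h, CapDiagram.word_of_gt t h', capDelta]
  · rw [if_neg h]
    by_cases h' : D.partner a = a
    · rw [if_pos h', CapDiagram.word_of_eq t h', if_pos rfl]
    · rw [if_neg h']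

/-- If `g` increases along the arcs, then the word of a diagram is the unique configuration in its
vector of smallest weight, where the weight of a configuration is the sum of `g` over the up
arrows. -/
lemma sum_word_lt {D : CapDiagram S} {t s : S → Bool} (hs : capCoeff q D t s ≠ 0)
    (hne : s ≠ D.word t) (g : S → ℕ) (hg : ∀ a, a < D.partner a → g a < g (D.partner a)) :
    ∑ a, (if D.word t a then g a else 0) < ∑ a, if s a then g a else 0 := by
  have hinv : ∀ f : S → ℕ, ∑ a, f (D.partner a) = ∑ a, f a := fun f =>
    Equiv.sum_comp (Function.Involutive.toPerm D.partner D.involutive) f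
  have two : ∀ f : S → ℕ, 2 * ∑ a, f a = ∑ a, (f a + f (D.partner a)) := fun f => by
    rw [Finset.sum_add_distrib, hinv, two_mul]
  have hf : ∀ a, capFactor q D t s a ≠ 0 := fun a =>
    Finset.prod_ne_zero_iff.1 hs a (Finset.mem_univ a)
  have key : ∀ a, a < D.partner a → (s a = D.word t a ∧ s (D.partner a) = D.word t (D.partner a)) ∨
      ((if D.word t a then g a else 0) + (if D.word t (D.partner a) then g (D.partner a) else 0) <
        (if s a then g a else 0) + if s (D.partner a) then g (D.partner a) else 0) := by
    intro a ha
    have h1 := hf a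
    rw [capFactor, if_pos ha] at h1
    have h2 := hg a ha
    have h3 := CapDiagram.word_of_lt t ha
    have h4 : D.word t (D.partner a) = false :=
      CapDiagram.word_of_gt t (by rwa [D.involutive])
    rw [h3, h4]
    cases h5 : s a <;> cases h6 : s (D.partner a) <;> simp_all [capDelta]
  have key' : ∀ a, s a = D.word t a ∧ s (D.partner a) = D.word t (D.partner a) ∨
      ((if D.word t a then g a else 0) + (if D.word t (D.partner a) then g (D.partner a) else 0) <
        (if s a then g a else 0) + if s (D.partner a) then g (D.partner a) else 0) := by
    intro a
    rcases lt_trichotomy a (D.partner a) with h | h | h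
    · exact key a h
    · left
      have h1 := hf a
      rw [capFactor, if_neg (by rw [← h]; exact lt_irrefl a), if_pos h.symm] at h1
      have h2 : s a = t a := by
        by_contra h2
        exact h1 (if_neg h2)
      rw [← h, CapDiagram.word_of_eq t h.symm]
      exact ⟨h2, h2⟩
    · have := key (D.partner a) (by rw [D.involutive]; exact h)
      rw [D.involutive] at this
      rcases this with h | h
      · exact Or.inl ⟨h.2, h.1⟩
      · right; omega
  have : 2 * ∑ a, (if D.word t a then g a else 0) < 2 * ∑ a, if s a then g a else 0 := by
    rw [two, two]
    obtain ⟨a, ha⟩ := Function.ne_iff.1 hne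
    refine Finset.sum_lt_sum (fun a _ => ?_) ⟨a, Finset.mem_univ a, ?_⟩
    · rcases key' a with h | h
      · rw [h.1, h.2]
      · exact h.le
    · exact (key' a).resolve_left fun h => ha h.1
  omega

end Words

/-! ### The dual canonical basis -/

section Basis

lemma numUp_step {n c : ℕ} (hc : c ≤ n) :
    numUp (fun a : Fin n => decide (n ≤ a.val + c)) = c := by
  have h : ∀ a : Fin n, n ≤ a.val + c ↔ (Fin.rev a).val < c := fun a => by
    rw [Fin.val_rev]; omega
  simp only [numUp, decide_eq_true_eq, h]
  rw [Finset.card_equiv Fin.revPerm (t := Finset.univ.filter fun b : Fin n => b.val < c)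
    (by intro a; simp), Fin.card_filter_val_lt, min_eq_right hc]

lemma eq_step_of_monotone {n : ℕ} {s : Fin n → Bool} (hs : Monotone s) (a : Fin n) :
    s a = decide (n ≤ a.val + numUp s) := by
  cases h : s a
  · have h1 : (Finset.univ.filter fun b => s b = true) ⊆ Finset.Ioi a := by
      intro b hb
      rw [Finset.mem_filter] at hb
      rw [Finset.mem_Ioi]
      by_contra! hab
      have := Bool.le_iff_imp.1 (hs hab) hb.2
      rw [h] at this
      exact absurd this (by decide)
    have h2 := Finset.card_le_card h1
    rw [Fin.card_Ioi] at h2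
    change numUp s ≤ _ at h2
    have := a.isLt
    symm
    rw [decide_eq_false_iff_not]
    omega
  · have h1 : Finset.Ici a ⊆ Finset.univ.filter fun b => s b = true := by
      intro b hb
      rw [Finset.mem_Ici] at hb
      exact Finset.mem_filter.2 ⟨Finset.mem_univ _, Bool.le_iff_imp.1 (hs hb) h⟩
    have h2 := Finset.card_le_card h1
    rw [Fin.card_Ici] at h2
    change _ ≤ numUp s at h2
    symm
    rw [decide_eq_true_eq]
    omega

variable {L : ℕ} {n : Fin L → ℕ}

/-- The word with, at every site `i`, first `n i - c i` down arrows and then `c i` up arrows. -/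
def siteWord (n : Fin L → ℕ) (c : ∀ i, Fin (n i + 1)) (x : Strands n) : Bool :=
  decide (n (ofLex x).1 ≤ (ofLex x).2.val + (c (ofLex x).1).val)

variable {F : Type*} [Field F] {q : F}

lemma chainT_capCoeff_eq_zero {D : CapDiagram (Strands n)} (t : Strands n → Bool) {i : Fin L}
    (h : ¬ (siteStrands n i).IsChain fun a b => D.partner a ≠ b) :
    chainT q n (capCoeff q D t) = 0 := by
  refine (chainBasis F n).repr.injective (Finsupp.ext fun x => ?_)
  rw [repr_chainT, map_zero, Finsupp.zero_apply]
  set ρ : (Strands n → Bool) → F := fun s => ∏ l ∈ ({i} : Finset (Fin L))ᶜ,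
    symT q (n l) (x l) fun a => s (toLex ⟨l, a⟩) with hρ
  have h0 := sum_mul_inv_mul_capCoeff_eq_zero (q := q) t (isChain_siteStrands i) h
    (fun s b => if b = (x i : ℤ) then ρ s else 0) (by
      intro y hy s v
      have : ρ (Function.update s y v) = ρ s := by
        refine Finset.prod_congr rfl fun l hl => ?_
        congr 1
        funext a
        refine Function.update_of_ne (fun e => ?_) _ _
        simp only [Finset.mem_compl, Finset.mem_singleton] at hl
        obtain ⟨b, rfl⟩ := (List.mem_ofFn).1 hy
        exact hl (strand_inj.1 e).1
      funext b
      change (if b = (x i : ℤ) then ρ (Function.update s y v) else 0) = _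
      rw [this])
  rw [← h0]
  refine Finset.sum_congr rfl fun s _ => ?_
  rw [← Finset.prod_mul_prod_compl {i}, Finset.prod_singleton, symT_eq, map_siteStrands]
  simp only [hρ, Nat.cast_inj]
  split_ifs <;> ring

/-- The word of a diagram with non-zero image in the chain increases along every site. -/
lemma exists_word_eq_siteWord {D : CapDiagram (Strands n)} {t : Strands n → Bool}
    (h : D.Admissible t) (h0 : capVector q n D t ≠ 0) :
    ∃ c : ∀ i, Fin (n i + 1), D.word t = siteWord n c := by
  have hmono : ∀ i, Monotone fun a : Fin (n i) => D.word t (toLex ⟨i, a⟩) := by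
    intro i
    have h1 : (siteStrands n i).IsChain fun a b => D.partner a ≠ b := by
      by_contra h1
      exact h0 (chainT_capCoeff_eq_zero t h1)
    have h2 : (siteStrands n i).IsChain fun a b => D.word t a ≤ D.word t b := by
      rw [List.isChain_iff_forall_rel_of_append_cons_cons] at h1 ⊢
      intro a b l₁ l₂ e
      rw [Bool.le_iff_imp]
      intro ha
      by_contra hb
      exact h1 e (h.partner_eq (List.isChain_iff_forall_rel_of_append_cons_cons.1
        (isChain_siteStrands i) e) ha (by simpa using hb))
    have h3 := List.isChain_iff_pairwise.1 h2
    intro a b hab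
    rcases hab.eq_or_lt with rfl | hab
    · exact le_rfl
    · exact (List.pairwise_ofFn.1 h3) hab
  have hle : ∀ i, numUp (fun a : Fin (n i) => D.word t (toLex ⟨i, a⟩)) < n i + 1 := fun i =>
    Nat.lt_succ_of_le ((Finset.card_le_univ _).trans_eq (Fintype.card_fin _))
  refine ⟨fun i => ⟨_, hle i⟩, funext fun x => ?_⟩
  obtain ⟨i, a, rfl⟩ := exists_strand x
  exact eq_step_of_monotone (hmono i) a

/-- The two legs of an arc belong to different sites if the word increases along every site. -/
lemma site_lt_of_lt_partner {D : CapDiagram (Strands n)} {t : Strands n → Bool}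
    {c : ∀ i, Fin (n i + 1)} (hD : D.word t = siteWord n c) (x : Strands n)
    (hx : x < D.partner x) : (ofLex x).1.val < (ofLex (D.partner x)).1.val := by
  have h1 := CapDiagram.word_of_lt t hx
  have h2 : D.word t (D.partner x) = false :=
    CapDiagram.word_of_gt t (by rwa [D.involutive])
  generalize D.partner x = y at *
  obtain ⟨i, a, rfl⟩ := exists_strand x
  obtain ⟨j, b, rfl⟩ := exists_strand y
  rw [strand_lt] at hx
  rcases hx with hx | ⟨rfl, hx⟩
  · exact hx
  · rw [hD] at h1 h2
    have h3 := of_decide_eq_true h1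
    have h4 := of_decide_eq_false h2
    dsimp only [ofLex_toLex] at h3 h4
    omega

/-- The sum of the positions of the sites of all up arrows depends only on the number of up arrows
at every site. -/
lemma sum_site (c : ∀ i, Fin (n i + 1)) (s : Strands n → Bool)
    (hs : ∀ i, numUp (fun a => s (toLex ⟨i, a⟩)) = c i) :
    ∑ x : Strands n, (if s x then (ofLex x).1.val else 0) = ∑ i, (c i).val * i.val := by
  have e : ∑ x : Strands n, (if s x then (ofLex x).1.val else 0) =
      ∑ x : Σ i : Fin L, Fin (n i), if s (toLex x) then x.1.val else 0 :=
    (Equiv.sum_comp (toLex : (Σ i : Fin L, Fin (n i)) ≃ Strands n)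
      fun x : Strands n => if s x then (ofLex x).1.val else 0).symm
  rw [e, Fintype.sum_sigma]
  refine Finset.sum_congr rfl fun i _ => ?_
  rw [← hs i, numUp, Finset.card_filter, Finset.sum_mul]
  exact Finset.sum_congr rfl fun a _ => by simp

lemma numUp_siteWord (c : ∀ i, Fin (n i + 1)) (i : Fin L) :
    numUp (fun a => siteWord n c (toLex ⟨i, a⟩)) = c i :=
  numUp_step (Nat.le_of_lt_succ (c i).isLt)

lemma exists_ne_zero_of_repr_ne_zero {w : (Strands n → Bool) → F} {x : ∀ i, Fin (n i + 1)}
    (h : (chainBasis F n).repr (chainT q n w) x ≠ 0) :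
    ∃ s, w s ≠ 0 ∧ ∀ i, numUp (fun a => s (toLex ⟨i, a⟩)) = x i := by
  rw [repr_chainT] at h
  obtain ⟨s, -, hs⟩ := Finset.exists_ne_zero_of_sum_ne_zero h
  refine ⟨s, left_ne_zero_of_mul hs, fun i => ?_⟩
  have := Finset.prod_ne_zero_iff.1 (right_ne_zero_of_mul hs) i (Finset.mem_univ i)
  by_contra hne
  exact this (if_neg hne)

/-- The vectors of the diagrams with words `siteWord n c` are triangular in the
standard basis: the other non-zero coordinates are at indices of larger weight. -/
lemma repr_capVector_of_ne {D : CapDiagram (Strands n)} {t : Strands n → Bool}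
    {c : ∀ i, Fin (n i + 1)} (hD : D.word t = siteWord n c) {x : ∀ i, Fin (n i + 1)} (hx : x ≠ c)
    (h : (chainBasis F n).repr (capVector q n D t) x ≠ 0) :
    ∑ i, (c i).val * i.val < ∑ i, (x i).val * i.val := by
  obtain ⟨s, hs, hsx⟩ := exists_ne_zero_of_repr_ne_zero h
  have hne : s ≠ D.word t := by
    rintro rfl
    refine hx (funext fun i => Fin.ext ?_)
    rw [← hsx i, hD, numUp_siteWord]
  have := sum_word_lt hs hne (fun x => (ofLex x).1.val) (site_lt_of_lt_partner hD)
  rwa [sum_site x s hsx, hD, sum_site c _ (numUp_siteWord c)] at this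

lemma repr_capVector_self (hq : q ≠ 0) {D : CapDiagram (Strands n)} {t : Strands n → Bool}
    {c : ∀ i, Fin (n i + 1)} (hD : D.word t = siteWord n c) :
    (chainBasis F n).repr (capVector q n D t) c ≠ 0 := by
  rw [capVector_eq_chainT, repr_chainT, Finset.sum_eq_single (D.word t)]
  · rw [capCoeff_word, one_mul, Finset.prod_ne_zero_iff]
    intro i _
    rw [symT, hD, if_pos (numUp_siteWord c i)]
    exact pow_ne_zero _ hq
  · intro s _ hne
    by_contra h
    have hsx : ∀ i, numUp (fun a => s (toLex ⟨i, a⟩)) = c i := by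
      intro i
      have := Finset.prod_ne_zero_iff.1 (right_ne_zero_of_mul h) i (Finset.mem_univ i)
      by_contra hne
      exact this (if_neg hne)
    have := sum_word_lt (left_ne_zero_of_mul h) hne (fun x => (ofLex x).1.val)
      (site_lt_of_lt_partner hD)
    rw [sum_site c s hsx, hD, sum_site c _ (numUp_siteWord c)] at this
    exact this.false
  · exact fun h => absurd (Finset.mem_univ _) h

/-- The dual canonical basis is a basis. -/
lemma exists_basis_dualCanonical (hq : q ≠ 0) (n : Fin L → ℕ) :
    ∃ b : Module.Basis (dualCanonical q n) F (Chain F n), ∀ v, b v = (v : Chain F n) := by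
  choose D hadm hD using fun c : ∀ i, Fin (n i + 1) =>
    CapDiagram.exists_word_eq (siteWord n c)
  classical
  set v : (∀ i, Fin (n i + 1)) → Chain F n := fun c => capVector q n (D c) (siteWord n c) with hv
  have hli : LinearIndependent F v := by
    rw [Fintype.linearIndependent_iff]
    intro g hg
    by_contra! hne
    obtain ⟨c₀, hc₀⟩ := hne
    -- Look at the coordinate at the index of smallest weight.
    obtain ⟨c, hc, hmin⟩ := (Finset.univ.filter fun c => g c ≠ 0).exists_min_image
      (fun c => ∑ i, (c i).val * i.val) ⟨c₀, by simpa using hc₀⟩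
    have h := DFunLike.congr_fun (congrArg (chainBasis F n).repr hg) c
    simp only [map_sum, map_smul, map_zero, Finsupp.coe_finsetSum, Finset.sum_apply,
      Finsupp.smul_apply, smul_eq_mul, Finsupp.zero_apply] at h
    rw [Finset.sum_eq_single c] at h
    · exact (mul_ne_zero (Finset.mem_filter.1 hc).2 (repr_capVector_self hq (hD c))) h
    · intro c' _ hne
      by_contra h'
      have h1 := hmin c' (Finset.mem_filter.2 ⟨Finset.mem_univ _, left_ne_zero_of_mul h'⟩)
      exact h1.not_gt (repr_capVector_of_ne (hD c') hne.symm (right_ne_zero_of_mul h'))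
    · exact fun h => absurd (Finset.mem_univ _) h
  have hrange : Set.range v = dualCanonical q n := by
    ext u
    constructor
    · rintro ⟨c, rfl⟩
      exact ⟨hli.ne_zero c, D c, siteWord n c, hadm c, rfl⟩
    · rintro ⟨h0, D', t, h, rfl⟩
      obtain ⟨c, hc⟩ := exists_word_eq_siteWord h h0
      refine ⟨c, ?_⟩
      change chainT q n _ = chainT q n _
      rw [CapDiagram.capCoeff_eq_of_word_eq (hadm c) h ((hD c).trans hc.symm)]
  let b := basisOfLinearIndependentOfCardEqFinrank hli
    (Module.finrank_eq_card_basis (chainBasis F n)).symm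
  have hb : ⇑b = v := coe_basisOfLinearIndependentOfCardEqFinrank _ _
  have hr : Set.range b = dualCanonical q n := by rw [hb, hrange]
  refine ⟨b.reindexRange.reindex (Equiv.setCongr hr), fun u => ?_⟩
  rw [Module.Basis.reindex_apply, Module.Basis.reindexRange_apply]
  rfl

end Basis

/-! ### Matrix entries of the cascade operators -/

section Positivity

open scoped NNReal

variable {L : ℕ} {n : Fin L → ℕ} {q : ℝ}

lemma repr_chainT_nonneg (b : Module.Basis (dualCanonical (q : ℂ) n) ℂ (Chain ℂ n))
    (hb : ∀ v, b v = (v : Chain ℂ n)) {w : (Strands n → Bool) → ℂ}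
    (hw : w ∈ capCone q (Strands n)) (u : dualCanonical (q : ℂ) n) :
    ∃ r : ℝ, 0 ≤ r ∧ b.repr (chainT (q : ℂ) n w) u = (r : ℂ) := by
  induction hw using Submodule.span_induction with
  | mem w hw =>
    obtain ⟨D, t, hD, rfl⟩ := hw
    by_cases h0 : capVector (q : ℂ) n D t = 0
    · exact ⟨0, le_rfl, by rw [← capVector_eq_chainT, h0]; simp⟩
    · have h : capVector (q : ℂ) n D t ∈ dualCanonical (q : ℂ) n := ⟨h0, D, t, hD, rfl⟩
      classical
      refine ⟨if (⟨_, h⟩ : dualCanonical (q : ℂ) n) = u then 1 else 0, by positivity, ?_⟩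
      have hr : b.repr (capVector (q : ℂ) n D t) = Finsupp.single ⟨_, h⟩ 1 := by
        rw [← b.repr_self ⟨_, h⟩, hb]
      rw [← capVector_eq_chainT, hr, Finsupp.single_apply]
      split_ifs <;> simp
  | zero => exact ⟨0, le_rfl, by simp⟩
  | add v w _ _ hv hw =>
    obtain ⟨r, hr, hv⟩ := hv
    obtain ⟨r', hr', hw⟩ := hw
    exact ⟨r + r', add_nonneg hr hr', by rw [map_add, map_add, Finsupp.add_apply, hv, hw]; simp⟩
  | smul c w _ hw =>
    obtain ⟨r, hr, hw⟩ := hw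
    have h : c • w = ((c : ℝ) : ℂ) • w := by
      funext s
      rw [Pi.smul_apply, Pi.smul_apply, NNReal.smul_def, Complex.real_smul, smul_eq_mul]
    exact ⟨c * r, mul_nonneg c.2 hr, by
      rw [h, map_smul, map_smul, Finsupp.smul_apply, hw]; simp⟩

end Positivity

theorem mainTheorem4 (q : ℝ) (hq : 0 < q) :
    (∀ (L : ℕ) (n : Fin L → ℕ),
      ∃ b : Module.Basis (dualCanonical (q : ℂ) n) ℂ (Chain ℂ n),
        (∀ v, b v = (v : Chain ℂ n)) ∧
        ∀ i i' : Fin L, i'.val = i.val + 1 →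
          ∀ k : ℤ, -(n i : ℤ) ≤ k → k ≤ (n i' : ℤ) →
            ∀ u v, ∃ r : ℝ, 0 ≤ r ∧
              b.repr (twoSite n i i' (cascadeK (q : ℂ) (n i) (n i') k) (b v)) u = (r : ℂ)) ∧
    (∀ m n k j : ℕ, j ≤ m → j + k ≤ n →
      cascadeK (q : ℂ) m n (k : ℤ) * arcDiagram (q : ℂ) m n j =
        ∑ l ∈ Finset.range (min k (m - j) + 1),
          cascadeCoeff (q : ℂ) m n k j l • arcCupDiagram (q : ℂ) m n j l) ∧
    (∀ m n k j : ℕ, j ≤ m → j ≤ n → k ≤ n → n < j + k →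
      cascadeK (q : ℂ) m n (k : ℤ) * arcDiagram (q : ℂ) m n j = 0) := by
  have hq' : (q : ℂ) ≠ 0 := by exact_mod_cast hq.ne'
  refine ⟨fun L n => ?_, fun m n k j => cascadeK_mul_arcDiagram hq' (qInt_ne_zero hq) m n k j,
    fun m n k j => cascadeK_mul_arcDiagram_eq_zero hq' (qInt_ne_zero hq) m n k j⟩
  obtain ⟨b, hb⟩ := exists_basis_dualCanonical hq' n
  refine ⟨b, hb, fun i i' h k hk hk' u v => ?_⟩
  obtain ⟨-, D, t, hD, hv⟩ := v.2
  have hw : capCoeff (q : ℂ) D t ∈ capCone q (Strands n) :=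
    Submodule.subset_span ⟨D, t, hD, rfl⟩
  obtain ⟨w', hw', e⟩ := exists_twoSite_chainT hq h k hk hk' hw
  rw [hb, hv, capVector_eq_chainT, e]
  exact repr_chainT_nonneg b hb hw' u
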